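/- **Theorem (classification of grim reapers).** Let $\mathbb H^3=\{(x,y,z): z>0\}$ carry the metric $\langle\cdot,\cdot\rangle=z^{-2}(dx^2+dy^2+dz^2)$. A horo-shrinker is a smooth immersion of an oriented smooth surface into $\mathbb H^3$ whose mean curvature $H$ (half of the trace of the second fundamental form) satisfies $H=\langle N,\partial_z\rangle$, with $N$ its unit normal. A one-parameter group of parabolic translations is, if its fixed ideal point is $\infty$, the group of translations $q\mapsto q+tv$, $t\in\mathbb R$, for a horizontal vector $v\neq0$; if its fixed ideal point is $p\in\{z=0\}$, it is the conjugate of such a group by the inversion in the unit sphere centred at $p$. A surface is invariant under the group if each element of the group maps its image onto itself. A grim reaper is a horo-shrinker invariant under a one-parameter group of parabolic translations. For $z_0\in(0,1)$ let $(x,z,\theta)$ be the solution on $\mathbb R$ of $$x'=z\cos\theta,\qquad z'=z\sin\theta,\qquad \theta'=2\cos\theta\,\frac{1-z}{z},\qquad (x,z,\theta)(0)=(0,z_0,0),$$ let $\alpha_{z_0}=\{(x(s),z(s)):s\in\mathbb R\}$, and for a horizontal Euclidean unit vector $w$ and $c\in\mathbb R$ let $\mathcal G_{w,c}(z_0)=\{q=(q_1,q_2,q_3):(\langle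 w,q\rangle_e-c,\,q_3)\in\alpha_{z_0}\}$. The surface $\mathcal G(z_0)$ is $\mathcal G_{w,c}(z_0)$ with $w=(1,0,0)$, $c=0$; the others differ from it by a horizontal Euclidean rigid motion. (i) Let $\Sigma$ be a connected horo-shrinker invariant under $q\mapsto q+tv$, $t\in\mathbb R$, where $v\ne0$ is horizontal. Then the image of $\Sigma$ is contained in one of the following surfaces, and is equal to it if $\Sigma$ is complete: (1) a vertical plane $\{\langle w,q\rangle_e=c\}$ of $\mathbb H^3$; (2) the horosphere $\mathsf H_1=\{z=1\}$; (3) a surface $\mathcal G_{w,c}(z_0)$ with $z_0\in(0,1)$; here $w$ is a horizontal unit vector orthogonal to $v$, and $c\in\mathbb R$. Conversely, each of the surfaces (1), (2), (3) is a complete embedded horo-shrinker invariant under this group. (ii) Let $\Sigma$ be a connected horo-shrinker invariant under a one-parameter group of parabolic translations fixing a point $p\in\{z=0\}$, the conjugate by the inversion centred at $p$ of the translations in the direction $v$. Then the image of $\Sigma$ is contained in the vertical plane through $p$ parallel to $v$, and is equal to it if $\Sigma$ is complete. Conversely, this plane is a complete embedded horo-shrinker invariant under this group. (iii) For each $z_0\in(0,1)$,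 $\alpha_{z_0}$ is the graph $z=u_{z_0}(x)$ of a smooth periodic function $u_{z_0}:\mathbb R\to(0,\infty)$, so that $\mathcal G(z_0)$ is an entire graph that is periodic in $x$. The minimum of $u_{z_0}$ is $z_0$, and it has a maximum $z_0^*$. The map $z_0\mapsto z_0^*$ is a bijection of $(0,1)$ onto $(1,\infty)$, with $z_0^*\to\infty$ as $z_0\to0$ and $z_0^*\to1$ as $z_0\to1$. (iv) As $z_0\to0$, $\mathcal G(z_0)$ converges to the doubly covered vertical plane $\{x=0\}$, smoothly on compact sets: there are functions $f_{z_0}$ such that for all $0<a<b$ and $R>0$ and all sufficiently small $z_0$, $f_{z_0}$ is smooth and positive on $[a,b]$, the part of the graph of $u_{z_0}$ in $[-R,R]\times[a,b]$ is the part there of the union of the two curves $x=\pm f_{z_0}(z)$, and $f_{z_0}\to0$ uniformly on $[a,b]$ with all derivatives. As $z_0\to1$, $\mathcal G(z_0)$ converges to $\mathsf H_1$: $u_{z_0}\to1$ uniformly on $\mathbb R$ with all derivatives. -/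

import Mathlib

open Set Filter Topology MeasureTheory
open scoped ContDiff Manifold

universe u

namespace HoroShrinker

noncomputable section

/-- Parameter plane of local coordinates. -/
abbrev E2 : Type := EuclideanSpace ℝ (Fin 2)

/-- The ambient space `ℝ³`, with coordinates `q 0 = x`, `q 1 = y`, `q 2 = z`.
The hyperbolic space is its open upper half `upperHalfSpace`. -/
abbrev E3 : Type := EuclideanSpace ℝ (Fin 3)

/-- The upper half-space model of the hyperbolic space. -/
def upperHalfSpace : Set E3 := {q | 0 < q 2}

/-- The constant (coordinate) vector field `∂_z`. -/
def dz : E3 := EuclideanSpace.single 2 1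

/-- The hyperbolic metric `⟨a, b⟩ = ⟨a, b⟩_e / z²` at the point `q`. -/
def hypInner (q a b : E3) : ℝ := inner ℝ a b / (q 2) ^ 2

/-- The Christoffel symbols `Γ_q(a, b) = Γ^k_{ij} a^i b^j ∂_k` of the hyperbolic metric:
the Levi-Civita connection is `∇_a b = D_a b + Γ(a, b)`, with
`Γ(a, b) = -(a₃ b + b₃ a - ⟨a, b⟩_e ∂_z) / z`. -/
def christoffel (q a b : E3) : E3 :=
  -((q 2)⁻¹ • (a 2 • b + b 2 • a - (inner ℝ a b : ℝ) • dz))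

/-- The `i`-th partial derivative of a map of the parameter plane into space. -/
def pd (X : E2 → E3) (i : Fin 2) (x : E2) : E3 :=
  fderiv ℝ X x (EuclideanSpace.single i 1)

/-- First fundamental form of the parametrized surface `X`, for the hyperbolic metric. -/
def firstForm (X : E2 → E3) (x : E2) : Matrix (Fin 2) (Fin 2) ℝ :=
  Matrix.of fun i j => hypInner (X x) (pd X i x) (pd X j x)

/-- Second fundamental form `⟨∇_{∂_i} ∂_j X, n⟩` of the parametrized surface `X`, for the
hyperbolic metric and the normal vector `n`. -/
def secondForm (X : E2 → E3) (x : E2) (n : E3) : Matrix (Fin 2) (Fin 2) ℝ :=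
  Matrix.of fun i j =>
    hypInner (X x) (pd (pd X j) i x + christoffel (X x) (pd X i x) (pd X j x)) n

/-- Hyperbolic mean curvature: half of the trace of the second fundamental form with respect to
the first one. -/
def meanCurvature (X : E2 → E3) (x : E2) (n : E3) : ℝ :=
  (1 / 2) * ((firstForm X x)⁻¹ * secondForm X x n).trace

/-- `Ψ : M → ℍ³` is a horo-shrinker: a smooth immersion of the smooth surface `M` into the upper
half-space, oriented by a smooth (hyperbolic) unit normal field `N`, with `H = ⟨N, ∂_z⟩`. -/
def IsHoroShrinker {M : Type u} [TopologicalSpace M] [ChartedSpace E2 M] (Ψ : M → E3) : Prop :=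
  (∀ p, Ψ p ∈ upperHalfSpace) ∧
  ContMDiff (𝓡 2) 𝓘(ℝ, E3) ∞ Ψ ∧
  (∀ p, Function.Injective (mfderiv (𝓡 2) 𝓘(ℝ, E3) Ψ p)) ∧
  ∃ N : M → E3,
    ContMDiff (𝓡 2) 𝓘(ℝ, E3) ∞ N ∧
    (∀ p, hypInner (Ψ p) (N p) (N p) = 1) ∧
    (∀ p (w : TangentSpace (𝓡 2) p),
      hypInner (Ψ p) (mfderiv (𝓡 2) 𝓘(ℝ, E3) Ψ p w) (N p) = 0) ∧
    (∀ e ∈ atlas E2 M, ∀ p ∈ e.source,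
      meanCurvature (Ψ ∘ e.symm) (e p) (N p) = hypInner (Ψ p) (N p) dz)

/-- Completeness of the metric induced by the immersion `Ψ` into the hyperbolic space: every
half-open curve in `M` of finite hyperbolic length has an end point in `M`. -/
def IsCompleteImmersion {M : Type u} [TopologicalSpace M] [ChartedSpace E2 M]
    (Ψ : M → E3) : Prop :=
  ∀ γ : ℝ → M, ContMDiffOn 𝓘(ℝ, ℝ) (𝓡 2) 1 γ (Ico 0 1) →
    (∫⁻ t in Ico (0 : ℝ) 1, ENNReal.ofReal (‖deriv (Ψ ∘ γ) t‖ / (Ψ (γ t)) 2)) < ⊤ →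
    ∃ p, Tendsto γ (𝓝[<] 1) (𝓝 p)

/-- The parabolic translations with fixed point `∞`: horizontal Euclidean translations in the
direction `v`. -/
def parabolicInfty (v : E3) (t : ℝ) (q : E3) : E3 := q + t • v

/-- The parabolic translations with fixed point `p` in the ideal plane `z = 0`: the conjugates of
the horizontal translations by the inversion in the unit sphere centred at `p`, a hyperbolic
isometry that interchanges `p` and `∞`. -/
def parabolicAt (p v : E3) (t : ℝ) (q : E3) : E3 :=
  EuclideanGeometry.inversion p 1
    (parabolicInfty v t (EuclideanGeometry.inversion p 1 q))

/-- The surface `Ψ` is invariant under the one-parameter group `φ`. -/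
def IsInvariantUnder {M : Type u} (Ψ : M → E3) (φ : ℝ → E3 → E3) : Prop :=
  ∀ t, φ t '' range Ψ = range Ψ

/-- `w` is a horizontal unit vector orthogonal to `v`. -/
def IsHorizontalNormal (v w : E3) : Prop := w 2 = 0 ∧ ‖w‖ = 1 ∧ inner ℝ v w = 0

/-- The vertical plane `⟨w, q⟩_e = c` (for a horizontal unit vector `w`). -/
def verticalPlane (w : E3) (c : ℝ) : Set E3 := {q | q ∈ upperHalfSpace ∧ inner ℝ w q = c}

/-- The horosphere `z = 1`. -/
def horosphereOne : Set E3 := {q | q 2 = 1}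

/-- Solutions, on the whole line, of the system of the generating curves of grim reapers,
parametrized by hyperbolic arc length. -/
structure IsGeneratingSolution (x z θ : ℝ → ℝ) : Prop where
  pos : ∀ s, 0 < z s
  hx : ∀ s, HasDerivAt x (z s * Real.cos (θ s)) s
  hz : ∀ s, HasDerivAt z (z s * Real.sin (θ s)) s
  hθ : ∀ s, HasDerivAt θ (2 * Real.cos (θ s) * ((1 - z s) / z s)) s

/-- The generating curve in the `xz`-plane: the trace of the solution with initial data
`x(0) = 0`, `z(0) = z₀`, `θ(0) = 0`. -/
def generatingCurve (z₀ : ℝ) : Set (ℝ × ℝ) :=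
  {q | ∃ x z θ : ℝ → ℝ, IsGeneratingSolution x z θ ∧ x 0 = 0 ∧ z 0 = z₀ ∧ θ 0 = 0 ∧
    ∃ s, q = (x s, z s)}

/-- The surface `𝒢(z₀)`, placed so that the `x`-direction is the horizontal unit vector `w`, and
translated by `c` in that direction. -/
def grimReaper (w : E3) (c z₀ : ℝ) : Set E3 :=
  {q | ((inner ℝ w q : ℝ) - c, q 2) ∈ generatingCurve z₀}

/-- The three kinds of surfaces with rulings parallel to `v`. -/
def IsGrimReaperModel (v : E3) (S : Set E3) : Prop :=
  (∃ w c, IsHorizontalNormal v w ∧ S = verticalPlane w c) ∨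
  S = horosphereOne ∨
  (∃ w c z₀, IsHorizontalNormal v w ∧ z₀ ∈ Ioo (0 : ℝ) 1 ∧ S = grimReaper w c z₀)

/-- As `z₀ → 0`, the graphs of the functions `U z₀` converge to the half-line `{x = 0, z > 0}`
covered twice, smoothly on compact sets of the half-plane `z > 0`: in every compact rectangle the
graph finally consists of two disjoint sheets `x = ± f z₀ z`, `f z₀ > 0`, and `f z₀` tends to zero
there with all its derivatives. -/
def ConvergesToDoubleVertical (U : ℝ → ℝ → ℝ) : Prop :=
  ∃ f : ℝ → ℝ → ℝ, ∀ a b R : ℝ, 0 < a → a < b → 0 < R →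
    (∀ᶠ z₀ in 𝓝[>] (0 : ℝ),
      (∃ O : Set ℝ, IsOpen O ∧ Icc a b ⊆ O ∧ ContDiffOn ℝ ∞ (f z₀) O) ∧
      (∀ z ∈ Icc a b, 0 < f z₀ z) ∧
      ∀ x ∈ Icc (-R) R, ∀ z ∈ Icc a b, (z = U z₀ x ↔ x = f z₀ z ∨ x = -f z₀ z)) ∧
    ∀ k : ℕ, TendstoUniformlyOn (fun z₀ => iteratedDeriv k (f z₀)) (fun _ => 0)
      (𝓝[>] (0 : ℝ)) (Icc a b)

end

end HoroShrinker

open HoroShrinker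

namespace HoroShrinker

noncomputable section

/-! Everything rests on one conserved quantity. Along a generating curve with tangent angle `θ`, the
quotient of `cos θ` by `weight z = z² e^{2/z}` is constant. The weight falls on `(0, 1]`, rises on
`[1, ∞)` and blows up at both ends, so a curve starting horizontally at height `z₀ < 1` stays
between `z₀` and the other root `z₀*` of `weight z = weight z₀`. There `cos θ` stays positive, so
the curve is a graph `u` with slope `p` and `(1 + p²) weight(u)² = weight(z₀)²`. It cannot climb
forever: a limit would be an equilibrium, hence at height 1, against the conserved quantity. So it
reaches `z₀*` with zero slope, and reflections in critical points make it periodic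
(`IsProfile.reflect`, `IsProfile.exists_halfPeriod`).

As `z₀ → 1` the pair `(u, p)` is squeezed to `(1, 0)`, and every derivative of `u` is a fixed smooth
function of `(u, p)`. As `z₀ → 0`, the inverse branch has slope `eW / √(1 - (eW)²)` with `W = weight
z` and `e = 1 / weight z₀ → 0`, smooth up to `e = 0`, where it vanishes. It remains to bound the
branch at one height (`sheet_le`) and to see that the period tends to infinity
(`topHeight_le_halfPeriod`).

For the classification, the translation direction `v` must be tangent to an invariant surface, since
otherwise the image would contain an open set although its Hausdorff dimension is at most 2
(`exists_fderiv_eq_of_invariant`). The surface is then locally a cylinder over a plane curve, whose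
curvature is determined by the mean curvature (`IsRuledPatch.exists_structure`). For horo-shrinkers
the curve satisfies the system above, and the value of the conserved quantity separates vertical
planes, the horosphere and the periodic curves (`IsGeneratingFrame.classification`). A complete
surface covers its model because segments of the parameter plane lift to it
(`surjective_of_isCompleteImmersion`).

If the fixed point `p` is finite, the inversion at `p` is a hyperbolic isometry that turns the group
into translations and `∂_z` into another field. The resulting curvature of the plane curve contains
the square of the coordinate along the rulings, multiplied by `cos θ`, whereas the curvature of a
cylinder is constant along rulings. Hence `cos θ = 0`, and the equation that is left forces the
vertical plane through `p` (`IsGeneratingFrame.eq_zero_of_inverted`,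
`IsGeneratingFrame.eq_const_of_inverted`). -/

/-! ### The weight `z² e^{2/z}` and the maximal height -/

/-- The function `z² e^{2/z}`; the quotient of `cos θ` by it is constant along the solutions of the
system of the generating curves. -/
def weight (z : ℝ) : ℝ := z ^ 2 * Real.exp (2 / z)

lemma weight_pos {z : ℝ} (hz : 0 < z) : 0 < weight z := by unfold weight; positivity

lemma hasDerivAt_weight {z : ℝ} (hz : z ≠ 0) :
    HasDerivAt weight (weight z * (2 * (z - 1) / z ^ 2)) z := by
  have h1 : HasDerivAt (fun z : ℝ => 2 / z) (-2 / z ^ 2) z := by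
    exact ((hasDerivAt_const z (2 : ℝ)).div (hasDerivAt_id' z) hz).congr_deriv (by ring)
  have h := (hasDerivAt_pow 2 z).mul h1.exp
  refine h.congr_deriv ?_
  simp only [weight]
  field_simp
  push_cast
  ring

lemma contDiffOn_weight : ContDiffOn ℝ ∞ weight (Ioi 0) := by
  have h : ContDiffOn ℝ ∞ (fun z : ℝ => 2 / z) (Ioi 0) :=
    contDiffOn_const.div contDiffOn_id fun z hz => ne_of_gt hz
  exact (contDiff_id.pow 2).contDiffOn.mul h.exp

lemma continuousOn_weight : ContinuousOn weight (Ioi 0) := contDiffOn_weight.continuousOn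

lemma strictAntiOn_weight : StrictAntiOn weight (Ioc 0 1) := by
  refine strictAntiOn_of_deriv_neg (convex_Ioc 0 1)
    (continuousOn_weight.mono fun z hz => hz.1) fun z hz => ?_
  rw [interior_Ioc] at hz
  rw [(hasDerivAt_weight hz.1.ne').deriv]
  refine mul_neg_of_pos_of_neg (weight_pos hz.1) (div_neg_of_neg_of_pos ?_ (by have := hz.1; positivity))
  linarith [hz.2]

lemma strictMonoOn_weight : StrictMonoOn weight (Ici 1) := by
  refine strictMonoOn_of_deriv_pos (convex_Ici 1)
    (continuousOn_weight.mono fun z hz => mem_Ioi.2 (one_pos.trans_le hz)) fun z hz => ?_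
  rw [interior_Ici] at hz
  have h0 : 0 < z := one_pos.trans hz
  rw [(hasDerivAt_weight h0.ne').deriv]
  exact mul_pos (weight_pos h0) (div_pos (by linarith [mem_Ioi.1 hz]) (by positivity))

lemma weight_one_le {z : ℝ} (hz : 0 < z) : weight 1 ≤ weight z := by
  rcases le_total z 1 with h | h
  · exact strictAntiOn_weight.antitoneOn ⟨hz, h⟩ ⟨one_pos, le_rfl⟩ h
  · exact strictMonoOn_weight.monotoneOn self_mem_Ici h h

lemma eq_one_of_weight_le {z : ℝ} (hz : 0 < z) (h : weight z ≤ weight 1) : z = 1 := by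
  rcases lt_trichotomy z 1 with h1 | h1 | h1
  · exact absurd (strictAntiOn_weight ⟨hz, h1.le⟩ ⟨one_pos, le_rfl⟩ h1) h.not_gt
  · exact h1
  · exact absurd (strictMonoOn_weight self_mem_Ici h1.le h1) h.not_gt

lemma sq_le_weight {z : ℝ} (hz : 0 < z) : z ^ 2 ≤ weight z := by
  have : (1 : ℝ) ≤ Real.exp (2 / z) := Real.one_le_exp (by positivity)
  unfold weight
  nlinarith [sq_nonneg z]

lemma inv_le_weight {z : ℝ} (hz : 0 < z) : z⁻¹ ≤ weight z := by
  -- The cubic term of the exponential series is the first that beats the factor `z²` as `z → 0`.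
  have h := Real.pow_div_factorial_le_exp (2 / z) (by positivity) 3
  have h2 : z ^ 2 * ((2 / z) ^ 3 / (Nat.factorial 3 : ℝ)) ≤ weight z :=
    mul_le_mul_of_nonneg_left h (by positivity)
  refine le_trans ?_ h2
  have h3 : (Nat.factorial 3 : ℝ) = 6 := by norm_num [Nat.factorial]
  rw [h3, show z ^ 2 * ((2 / z) ^ 3 / 6) = (8 / 6) * z⁻¹ by field_simp; ring]
  have : 0 < z⁻¹ := by positivity
  linarith

lemma tendsto_weight_zero : Tendsto weight (𝓝[>] 0) atTop :=
  tendsto_atTop_mono' _ (eventually_mem_nhdsWithin.mono fun _ hz => inv_le_weight hz)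
    tendsto_inv_nhdsGT_zero

lemma tendsto_weight_atTop : Tendsto weight atTop atTop :=
  tendsto_atTop_mono' _ ((eventually_gt_atTop 0).mono fun _ hz => sq_le_weight hz)
    (tendsto_pow_atTop two_ne_zero)

lemma exists_weight_eq_of_one_lt {c : ℝ} (hc : weight 1 < c) : ∃ z ∈ Ioi (1 : ℝ), weight z = c := by
  obtain ⟨B, hB1, hB⟩ := ((eventually_gt_atTop 1).and
    (tendsto_weight_atTop.eventually (eventually_gt_atTop c))).exists
  obtain ⟨z, hz, rfl⟩ := intermediate_value_Ioo hB1.le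
    (continuousOn_weight.mono fun z hz => lt_of_lt_of_le one_pos hz.1) ⟨hc, hB⟩
  exact ⟨z, hz.1, rfl⟩

lemma exists_weight_eq_of_lt_one {c : ℝ} (hc : weight 1 < c) :
    ∃ z ∈ Ioo (0 : ℝ) 1, weight z = c := by
  obtain ⟨B, ⟨hB1, hB⟩, hB0⟩ := (((Ioo_mem_nhdsGT (one_pos : (0 : ℝ) < 1)) |> Filter.eventually_mem_set.2 |>.and
    (tendsto_weight_zero.eventually (eventually_gt_atTop c))).and eventually_mem_nhdsWithin).exists
  obtain ⟨z, hz, rfl⟩ := intermediate_value_Ioo' hB1.2.le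
    (continuousOn_weight.mono fun z hz => lt_of_lt_of_le hB0 hz.1) ⟨hc, hB⟩
  exact ⟨z, ⟨hB1.1.trans hz.1, hz.2⟩, rfl⟩

/-- The maximal height `z₀^*`: the solution in `(1, ∞)` of `weight z = weight z₀`. -/
def topHeight (z₀ : ℝ) : ℝ := Function.invFunOn weight (Ioi 1) (weight z₀)

lemma weight_one_lt {z : ℝ} (hz : z ∈ Ioo (0 : ℝ) 1) : weight 1 < weight z :=
  strictAntiOn_weight ⟨hz.1, hz.2.le⟩ ⟨one_pos, le_rfl⟩ hz.2

lemma one_lt_topHeight {z₀ : ℝ} (hz : z₀ ∈ Ioo (0 : ℝ) 1) : 1 < topHeight z₀ :=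
  Function.invFunOn_mem (exists_weight_eq_of_one_lt (weight_one_lt hz))

lemma weight_topHeight {z₀ : ℝ} (hz : z₀ ∈ Ioo (0 : ℝ) 1) : weight (topHeight z₀) = weight z₀ :=
  Function.invFunOn_eq (exists_weight_eq_of_one_lt (weight_one_lt hz))

/-- The weight is strictly monotone on either side of 1 and takes the same value at `z₀` and
`topHeight z₀`, so its sublevel set is the interval between them. This turns energy estimates into
height bounds. -/
lemma weight_le_iff {z₀ z : ℝ} (hz₀ : z₀ ∈ Ioo (0 : ℝ) 1) (hz : 0 < z) :
    weight z ≤ weight z₀ ↔ z ∈ Icc z₀ (topHeight z₀) := by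
  have h1 := one_lt_topHeight hz₀
  rcases le_total z 1 with h | h
  · rw [strictAntiOn_weight.le_iff_ge ⟨hz, h⟩ ⟨hz₀.1, hz₀.2.le⟩]
    exact ⟨fun h' => ⟨h', h.trans h1.le⟩, fun h' => h'.1⟩
  · rw [← weight_topHeight hz₀, strictMonoOn_weight.le_iff_le h h1.le]
    exact ⟨fun h' => ⟨hz₀.2.le.trans h, h'⟩, fun h' => h'.2⟩

lemma weight_eq_iff {z₀ z : ℝ} (hz₀ : z₀ ∈ Ioo (0 : ℝ) 1) (hz : 0 < z) :
    weight z = weight z₀ ↔ z = z₀ ∨ z = topHeight z₀ := by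
  have h1 := one_lt_topHeight hz₀
  rcases le_total z 1 with h | h
  · rw [strictAntiOn_weight.eq_iff_eq ⟨hz, h⟩ ⟨hz₀.1, hz₀.2.le⟩]
    exact ⟨fun h => Or.inl h.symm, fun h' => (h'.resolve_right (by linarith)).symm⟩
  · rw [← weight_topHeight hz₀, strictMonoOn_weight.eq_iff_eq h h1.le]
    exact ⟨fun h => Or.inr h, fun h' => h'.resolve_left (by have := hz₀.2; linarith)⟩

lemma weight_lt_iff {z₀ z : ℝ} (hz₀ : z₀ ∈ Ioo (0 : ℝ) 1) (hz : 0 < z) :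
    weight z < weight z₀ ↔ z ∈ Ioo z₀ (topHeight z₀) := by
  rw [lt_iff_le_and_ne, weight_le_iff hz₀ hz, Ne, weight_eq_iff hz₀ hz, not_or]
  exact ⟨fun h => ⟨lt_of_le_of_ne h.1.1 (Ne.symm h.2.1), lt_of_le_of_ne h.1.2 h.2.2⟩,
    fun h => ⟨⟨h.1.le, h.2.le⟩, h.1.ne', h.2.ne⟩⟩

lemma strictAntiOn_topHeight : StrictAntiOn topHeight (Ioo 0 1) := by
  intro a ha b hb hab
  rw [← strictMonoOn_weight.lt_iff_lt (one_lt_topHeight hb).le (one_lt_topHeight ha).le,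
    weight_topHeight ha, weight_topHeight hb]
  exact strictAntiOn_weight ⟨ha.1, ha.2.le⟩ ⟨hb.1, hb.2.le⟩ hab

lemma bijOn_topHeight : BijOn topHeight (Ioo 0 1) (Ioi 1) := by
  refine ⟨fun z hz => one_lt_topHeight hz, strictAntiOn_topHeight.injOn, fun Z hZ => ?_⟩
  have hZ' : Z ∈ Ici (1 : ℝ) := le_of_lt (mem_Ioi.1 hZ)
  have hZ1 : weight 1 < weight Z := strictMonoOn_weight self_mem_Ici hZ' hZ
  obtain ⟨z, hz, h⟩ := exists_weight_eq_of_lt_one hZ1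
  exact ⟨z, hz, strictMonoOn_weight.injOn (one_lt_topHeight hz).le hZ'
    ((weight_topHeight hz).trans h)⟩

lemma tendsto_topHeight_zero : Tendsto topHeight (𝓝[>] 0) atTop := by
  refine tendsto_atTop.2 fun B => ?_
  -- The maximum with `1 + 1` keeps the target above 1, where `topHeight` is surjective;
  -- monotonicity does the rest.
  obtain ⟨b, hb, hbB⟩ := bijOn_topHeight.surjOn (mem_Ioi.2 (lt_max_of_lt_right (lt_add_one 1)) :
    max B (1 + 1) ∈ Ioi (1 : ℝ))
  filter_upwards [Ioo_mem_nhdsGT hb.1] with z hz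
  exact (le_max_left B _).trans (hbB ▸ (strictAntiOn_topHeight ⟨hz.1, hz.2.trans hb.2⟩ hb hz.2).le)

lemma tendsto_topHeight_one : Tendsto topHeight (𝓝[<] 1) (𝓝 1) := by
  refine tendsto_order.2 ⟨fun a ha => ?_, fun a ha => ?_⟩
  · filter_upwards [Ioo_mem_nhdsLT (zero_lt_one' ℝ)] with z hz
    exact ha.trans (one_lt_topHeight hz)
  · obtain ⟨b, hb, hba⟩ := bijOn_topHeight.surjOn ha
    filter_upwards [Ioo_mem_nhdsLT hb.2] with z hz
    exact hba ▸ strictAntiOn_topHeight hb ⟨hb.1.trans hz.1, hz.2⟩ hz.1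

/-! ### Global solutions of ordinary differential equations -/

/-- Boundedness by `L` confines a solution on `[-(n + 1), n + 1]` to a ball of radius `L (n + 1)`,
so Picard–Lindelöf applies on every such interval, and uniqueness glues the solutions. -/
lemma exists_global_solution {E : Type*} [NormedAddCommGroup E] [NormedSpace ℝ E] [CompleteSpace E]
    {f : E → E} {K L : NNReal} (hf : LipschitzWith K f) (hL : ∀ x, ‖f x‖ ≤ L) (x₀ : E) :
    ∃ α : ℝ → E, α 0 = x₀ ∧ ∀ t, HasDerivAt α (f (α t)) t := by
  have key : ∀ n : ℕ, ∃ α : ℝ → E, α 0 = x₀ ∧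
      ∀ t ∈ Ioo (-(n + 1 : ℝ)) (n + 1), HasDerivAt α (f (α t)) t := by
    intro n
    have h0 : (0 : ℝ) ∈ Icc (-(n + 1 : ℝ)) (n + 1) := ⟨by linarith [n.cast_nonneg (α := ℝ)],
      by linarith [n.cast_nonneg (α := ℝ)]⟩
    have hp : IsPicardLindelof (fun _ => f) (⟨0, h0⟩ : Icc (-(n + 1 : ℝ)) (n + 1)) x₀
        (L * (n + 1)) 0 L K :=
      ⟨fun _ _ => hf.lipschitzOnWith, fun _ _ => continuousOn_const, fun _ _ x _ => hL x, by simp⟩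
    obtain ⟨α, h1, h2⟩ := hp.exists_eq_forall_mem_Icc_hasDerivWithinAt₀
    exact ⟨α, h1, fun t ht => (h2 t (Ioo_subset_Icc_self ht)).hasDerivAt (Icc_mem_nhds ht.1 ht.2)⟩
  choose α hα0 hα using key
  have agree : ∀ m n : ℕ, m ≤ n → EqOn (α m) (α n) (Ioo (-(m + 1 : ℝ)) (m + 1)) := by
    intro m n hmn
    have hmn' : (m : ℝ) ≤ n := by exact_mod_cast hmn
    have h0 : (0 : ℝ) ∈ Ioo (-(m + 1 : ℝ)) (m + 1) := ⟨by linarith [m.cast_nonneg (α := ℝ)],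
      by linarith [m.cast_nonneg (α := ℝ)]⟩
    exact ODE_solution_unique_of_mem_Ioo (v := fun _ => f) (s := fun _ => univ) (K := K)
      (fun _ _ => hf.lipschitzOnWith) h0 (fun t ht => ⟨hα m t ht, trivial⟩)
      (fun t ht => ⟨hα n t ⟨by linarith [ht.1], by linarith [ht.2]⟩, trivial⟩)
      ((hα0 m).trans (hα0 n).symm)
  -- The solution of index `⌈|t|⌉` lives on an interval longer by 1, so `t` is an interior point of
  -- it.
  refine ⟨fun t => α ⌈|t|⌉₊ t, by simpa using hα0 _, fun t => ?_⟩
  have ht : t ∈ Ioo (-((⌈|t|⌉₊ : ℝ) + 1)) (⌈|t|⌉₊ + 1) := by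
    have := abs_le.1 (Nat.le_ceil |t|)
    exact ⟨by linarith [this.1], by linarith [this.2]⟩
  refine (hα _ t ht).congr_of_eventuallyEq ?_
  filter_upwards [isOpen_Ioo.mem_nhds ht] with s hs
  have hs' : s ∈ Ioo (-((⌈|s|⌉₊ : ℝ) + 1)) (⌈|s|⌉₊ + 1) := by
    have := abs_le.1 (Nat.le_ceil |s|)
    exact ⟨by linarith [this.1], by linarith [this.2]⟩
  rcases le_total ⌈|s|⌉₊ ⌈|t|⌉₊ with h | h
  · exact agree _ _ h hs'
  · exact (agree _ _ h hs).symm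

/-! ### Generating curves and their profile functions -/

lemma IsGeneratingSolution.cos_mul_weight {x z θ : ℝ → ℝ} (h : IsGeneratingSolution x z θ) (s : ℝ) :
    Real.cos (θ s) * weight (z 0) = Real.cos (θ 0) * weight (z s) := by
  have hd : ∀ s, HasDerivAt (fun s => Real.cos (θ s) / weight (z s)) 0 s := by
    intro s
    have hz := h.pos s
    have hw := weight_pos hz
    refine ((h.hθ s).cos.div ((hasDerivAt_weight hz.ne').comp s (h.hz s)) hw.ne').congr_deriv ?_
    simp only [Function.comp]
    field_simp
    ring
  have hc := is_const_of_deriv_eq_zero (fun s => (hd s).differentiableAt) (fun s => (hd s).deriv) s 0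
  have h1 := weight_pos (h.pos s)
  have h2 := weight_pos (h.pos 0)
  rw [div_eq_div_iff h1.ne' h2.ne'] at hc
  exact hc

/-- With `y = log z` the system reads `y' = sin θ`, `θ' = 2 cos θ (e^{-y} - 1)`. The exponential is
truncated below `y₀ = log z₀` to get a bounded Lipschitz field; the conserved quantity of the
truncated system shows that the truncation is never felt. -/
lemma exists_generatingSolution {z₀ : ℝ} (hz₀ : z₀ ∈ Ioo (0 : ℝ) 1) :
    ∃ x z θ : ℝ → ℝ, IsGeneratingSolution x z θ ∧ x 0 = 0 ∧ z 0 = z₀ ∧ θ 0 = 0 := by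
  set y₀ := Real.log z₀ with hy₀
  have hy₀neg : y₀ < 0 := Real.log_neg hz₀.1 hz₀.2
  set b : ℝ → ℝ := fun y => Real.exp (-max y y₀) - 1 with hb
  set M := Real.exp (-y₀) with hM
  have hM1 : 1 ≤ M := Real.one_le_exp (by linarith)
  have hbM : ∀ y, |b y| ≤ M := by
    intro y
    have h1 : Real.exp (-max y y₀) ≤ M := Real.exp_le_exp.2 (neg_le_neg (le_max_right _ _))
    have h2 := Real.exp_pos (-max y y₀)
    exact abs_le.2 ⟨by simp only [hb]; linarith, by simp only [hb]; linarith⟩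
  have hexp : ∀ m m' : ℝ, y₀ ≤ m → m ≤ m' → |Real.exp (-m) - Real.exp (-m')| ≤ M * |m - m'| := by
    intro m m' h0 h
    have h1 : Real.exp (-m') = Real.exp (-m) * Real.exp (m - m') := by
      rw [← Real.exp_add]; ring_nf
    have h2 := Real.add_one_le_exp (m - m')
    have h3 : Real.exp (-m) ≤ M := Real.exp_le_exp.2 (by linarith)
    have h4 : Real.exp (-m') ≤ Real.exp (-m) := Real.exp_le_exp.2 (by linarith)
    rw [abs_of_nonneg (by linarith), abs_of_nonpos (by linarith)]
    nlinarith [Real.exp_pos (-m)]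
  have hbL : ∀ y y', |b y - b y'| ≤ M * |y - y'| := by
    intro y y'
    have h1 : |b y - b y'| ≤ M * |max y y₀ - max y' y₀| := by
      have : b y - b y' = Real.exp (-max y y₀) - Real.exp (-max y' y₀) := by simp only [hb]; ring
      rw [this]
      rcases le_total (max y y₀) (max y' y₀) with h | h
      · exact hexp _ _ (le_max_right _ _) h
      · rw [abs_sub_comm, abs_sub_comm (max y y₀)]
        exact hexp _ _ (le_max_right _ _) h
    exact h1.trans (mul_le_mul_of_nonneg_left (abs_max_sub_max_le_abs _ _ _) (by linarith))
  have hbcont : Continuous b := by fun_prop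
  set f : ℝ × ℝ → ℝ × ℝ := fun q => (Real.sin q.2, 2 * Real.cos q.2 * b q.1) with hf
  have hfL : LipschitzWith (max 1 (4 * M.toNNReal)) f := by
    refine LipschitzWith.prodMk ?_ (LipschitzWith.of_dist_le_mul fun q q' => ?_)
    · simpa using! Real.lipschitzWith_sin.comp (LipschitzWith.prod_snd (α := ℝ) (β := ℝ))
    · have h1 : |Real.cos q.2 - Real.cos q'.2| ≤ |q.2 - q'.2| := by
        simpa [Real.dist_eq] using Real.lipschitzWith_cos.dist_le_mul q.2 q'.2
      have h2 : |q.1 - q'.1| ≤ dist q q' := le_max_left _ _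
      have h3 : |q.2 - q'.2| ≤ dist q q' := le_max_right _ _
      have h4 : 2 * Real.cos q.2 * b q.1 - 2 * Real.cos q'.2 * b q'.1 =
        2 * ((Real.cos q.2 - Real.cos q'.2) * b q.1 + Real.cos q'.2 * (b q.1 - b q'.1)) := by ring
      have h5 := abs_add_le ((Real.cos q.2 - Real.cos q'.2) * b q.1)
        (Real.cos q'.2 * (b q.1 - b q'.1))
      rw [abs_mul, abs_mul] at h5
      have h6 := mul_le_mul (h1.trans h3) (hbM q.1) (abs_nonneg _) dist_nonneg
      have h7 := mul_le_mul (Real.abs_cos_le_one q'.2) ((hbL q.1 q'.1).trans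
        (mul_le_mul_of_nonneg_left h2 (by linarith))) (abs_nonneg _) zero_le_one
      rw [Real.dist_eq, h4, abs_mul, abs_two]
      push_cast
      rw [Real.coe_toNNReal M (by linarith)]
      linarith
  have hfB : ∀ q, ‖f q‖ ≤ (max 1 (2 * M.toNNReal) : NNReal) := by
    intro q
    push_cast
    rw [Real.coe_toNNReal M (by linarith)]
    refine max_le_max (Real.abs_sin_le_one _) ?_
    rw [Real.norm_eq_abs, abs_mul, abs_mul, abs_two]
    nlinarith [Real.abs_cos_le_one q.2, hbM q.1, abs_nonneg (b q.1), abs_nonneg (Real.cos q.2)]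
  obtain ⟨α, hα0, hα⟩ := exists_global_solution hfL hfB (y₀, 0)
  set y : ℝ → ℝ := fun s => (α s).1 with hy
  set θ : ℝ → ℝ := fun s => (α s).2 with hθ
  have hyd : ∀ s, HasDerivAt y (Real.sin (θ s)) s := fun s =>
    (ContinuousLinearMap.fst ℝ ℝ ℝ).hasFDerivAt.comp_hasDerivAt s (hα s)
  have hθd : ∀ s, HasDerivAt θ (2 * Real.cos (θ s) * b (y s)) s := fun s =>
    (ContinuousLinearMap.snd ℝ ℝ ℝ).hasFDerivAt.comp_hasDerivAt s (hα s)
  have hy0 : y 0 = y₀ := by simp [hy, hα0]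
  have hθ0 : θ 0 = 0 := by simp [hθ, hα0]
  -- `B` is a primitive of `b`, so `cos θ · e^{2B(y)}` is conserved; it is the analogue of `cos θ /
  -- weight z` for the truncated system.
  set B : ℝ → ℝ := fun t => ∫ r in y₀..t, b r with hB
  have hBd : ∀ t, HasDerivAt B (b t) t := fun t => (hbcont.integral_hasStrictDerivAt y₀ t).hasDerivAt
  have hI : ∀ s, HasDerivAt (fun s => Real.cos (θ s) * Real.exp (2 * B (y s))) 0 s := by
    intro s
    refine ((hθd s).cos.mul ((((hBd (y s)).comp s (hyd s)).const_mul 2).exp)).congr_deriv ?_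
    simp only [Function.comp]
    ring
  have hIc : ∀ s, Real.cos (θ s) * Real.exp (2 * B (y s)) = 1 := by
    intro s
    have := is_const_of_deriv_eq_zero (fun s => (hI s).differentiableAt) (fun s => (hI s).deriv) s 0
    rw [this, hθ0, hy0]
    simp [hB]
  -- Below `y₀` the truncated `b` is the positive constant `M - 1`, so `B < 0` there and the
  -- conserved quantity would force `cos θ > 1`.
  have hyge : ∀ s, y₀ ≤ y s := by
    intro s
    by_contra! hlt
    have h1 : B (y s) = (y s - y₀) * (M - 1) := by
      have : EqOn b (fun _ => M - 1) (uIcc y₀ (y s)) := by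
        intro r hr
        rw [uIcc_of_ge hlt.le] at hr
        simp only [hb, hM, max_eq_right hr.2]
      simp only [hB]
      rw [intervalIntegral.integral_congr this, intervalIntegral.integral_const, smul_eq_mul]
    have hM2 : 1 < M := Real.one_lt_exp_iff.2 (by linarith)
    have h2 : B (y s) < 0 := by rw [h1]; nlinarith
    have h3 : Real.exp (2 * B (y s)) < 1 := by rw [← Real.exp_zero]; exact Real.exp_lt_exp.2 (by linarith)
    have h4 := hIc s
    nlinarith [Real.cos_le_one (θ s), Real.exp_pos (2 * B (y s))]
  have hcont : Continuous fun s => Real.exp (y s) * Real.cos (θ s) :=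
    ((continuous_iff_continuousAt.2 fun s => (hyd s).continuousAt).rexp).mul
      (Real.continuous_cos.comp (continuous_iff_continuousAt.2 fun s => (hθd s).continuousAt))
  refine ⟨fun s => ∫ r in (0 : ℝ)..s, Real.exp (y r) * Real.cos (θ r), fun s => Real.exp (y s), θ,
    ⟨fun s => Real.exp_pos _, fun s => (hcont.integral_hasStrictDerivAt 0 s).hasDerivAt,
      fun s => (hyd s).exp, fun s => ?_⟩, by simp, by simp [hy0, hy₀, Real.exp_log hz₀.1], hθ0⟩
  refine (hθd s).congr_deriv ?_
  simp only [hb, max_eq_left (hyge s), Real.exp_neg]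
  field_simp

/-- The profile `u` of a grim reaper of minimal height `z₀`, with its derivative `p`. -/
structure IsProfile (z₀ : ℝ) (u p : ℝ → ℝ) : Prop where
  pos : ∀ x, 0 < u x
  hu : ∀ x, HasDerivAt u (p x) x
  hp : ∀ x, HasDerivAt p (2 * (1 + p x ^ 2) * (1 - u x) / u x ^ 2) x
  u_zero : u 0 = z₀
  p_zero : p 0 = 0

/-- With `p = tan θ` one has `1 + p² = 1 / cos² θ`, so this is the square of the conservation law
for `cos θ / weight z`. -/
lemma IsProfile.energy {z₀ : ℝ} {u p : ℝ → ℝ} (h : IsProfile z₀ u p) (x : ℝ) :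
    (1 + p x ^ 2) * weight (u x) ^ 2 = weight z₀ ^ 2 := by
  have hd : ∀ x, HasDerivAt (fun x => (1 + p x ^ 2) * weight (u x) ^ 2) 0 x := by
    intro x
    have hz := h.pos x
    refine ((((h.hp x).pow 2).const_add 1).mul
      (((hasDerivAt_weight hz.ne').comp x (h.hu x)).pow 2)).congr_deriv ?_
    simp only [Function.comp, Pi.pow_apply]
    push_cast
    field_simp
    ring
  have := is_const_of_deriv_eq_zero (fun s => (hd s).differentiableAt) (fun s => (hd s).deriv) x 0
  rw [this, h.u_zero, h.p_zero]
  ring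

lemma weight_le_of_energy {z₀ z q : ℝ} (hz₀ : 0 < z₀)
    (h : (1 + q ^ 2) * weight z ^ 2 = weight z₀ ^ 2) : weight z ≤ weight z₀ := by
  refine le_of_sq_le_sq ?_ (weight_pos hz₀).le
  nlinarith [mul_nonneg (sq_nonneg q) (sq_nonneg (weight z))]

lemma IsProfile.mem_Icc {z₀ : ℝ} {u p : ℝ → ℝ} (hz₀ : z₀ ∈ Ioo (0 : ℝ) 1) (h : IsProfile z₀ u p)
    (x : ℝ) : u x ∈ Icc z₀ (topHeight z₀) :=
  (weight_le_iff hz₀ (h.pos x)).1 (weight_le_of_energy hz₀.1 (h.energy x))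

lemma IsGeneratingSolution.cos_pos {z₀ : ℝ} {x z θ : ℝ → ℝ} (hz₀ : 0 < z₀)
    (h : IsGeneratingSolution x z θ) (h0 : z 0 = z₀) (hθ : θ 0 = 0) (s : ℝ) :
    Real.cos (θ s) = weight (z s) / weight z₀ := by
  have := h.cos_mul_weight s
  rw [h0, hθ, Real.cos_zero, one_mul] at this
  rw [← this, mul_div_cancel_right₀ _ (weight_pos hz₀).ne']

/-- Uniqueness for the profile equation, along an arbitrary change `a` of the parameter. -/
lemma IsProfile.eq_of_reparam {z₀ : ℝ} {u p : ℝ → ℝ} (hz₀ : z₀ ∈ Ioo (0 : ℝ) 1)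
    (h : IsProfile z₀ u p) {a a' Z q : ℝ → ℝ} (ha'c : ContinuousOn a' (Icc 0 1))
    (ha : ∀ t ∈ Icc (0 : ℝ) 1, HasDerivAt a (a' t) t)
    (hZ : ∀ t ∈ Icc (0 : ℝ) 1, HasDerivAt Z (q t * a' t) t)
    (hq : ∀ t ∈ Icc (0 : ℝ) 1, HasDerivAt q (2 * (1 + q t ^ 2) * (1 - Z t) / Z t ^ 2 * a' t) t)
    (hZpos : ∀ t ∈ Icc (0 : ℝ) 1, 0 < Z t)
    (hE : ∀ t ∈ Icc (0 : ℝ) 1, (1 + q t ^ 2) * weight (Z t) ^ 2 = weight z₀ ^ 2)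
    (hZ0 : Z 0 = u (a 0)) (hq0 : q 0 = p (a 0)) : Z 1 = u (a 1) ∧ q 1 = p (a 1) := by
  -- On the energy level `1 + q²` can be eliminated. The acceleration becomes a function `g` of the
  -- height alone, Lipschitz on the compact interval of admissible heights, although the original
  -- field grows quadratically in the slope.
  set g : ℝ → ℝ := fun z => 2 * weight z₀ ^ 2 * (1 - z) / (z ^ 2 * weight z ^ 2) with hg
  have hgC : ContDiffOn ℝ 1 g (Icc z₀ (topHeight z₀)) := by
    have hw : ContDiffOn ℝ 1 weight (Icc z₀ (topHeight z₀)) :=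
      (contDiffOn_weight.of_le (by norm_cast)).mono fun z hz => hz₀.1.trans_le hz.1
    refine ContDiffOn.div (by fun_prop) (by fun_prop) fun z hz => ?_
    have hz0 : 0 < z := hz₀.1.trans_le hz.1
    have := weight_pos hz0
    positivity
  obtain ⟨K, hK⟩ := hgC.exists_lipschitzOnWith one_ne_zero (convex_Icc _ _) isCompact_Icc
  have hgE : ∀ z q : ℝ, 0 < z → (1 + q ^ 2) * weight z ^ 2 = weight z₀ ^ 2 →
      2 * (1 + q ^ 2) * (1 - z) / z ^ 2 = g z := by
    intro z q hz hE
    have := weight_pos hz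
    simp only [hg]
    rw [← hE]
    field_simp
  obtain ⟨C, hC⟩ := isCompact_Icc.exists_bound_of_continuousOn ha'c
  have hC0 : 0 ≤ C := (norm_nonneg _).trans (hC 0 (by simp))
  set S : Set (ℝ × ℝ) := Icc z₀ (topHeight z₀) ×ˢ univ
  have hvL : ∀ t ∈ Ico (0 : ℝ) 1, LipschitzOnWith (C.toNNReal * max 1 K)
      (fun y : ℝ × ℝ => a' t • (y.2, g y.1)) S := by
    intro t ht
    have h1 : LipschitzOnWith (max 1 K) (fun y : ℝ × ℝ => (y.2, g y.1)) S := by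
      refine LipschitzOnWith.prodMk (LipschitzWith.prod_snd.lipschitzOnWith) ?_
      simpa using! hK.comp (LipschitzWith.prod_fst (α := ℝ) (β := ℝ)).lipschitzOnWith
        (fun y (hy : y ∈ S) => hy.1)
    refine LipschitzOnWith.of_dist_le_mul fun y hy y' hy' => ?_
    rw [dist_smul₀]
    push_cast
    rw [Real.coe_toNNReal _ hC0, mul_assoc]
    have h2 := h1.dist_le_mul y hy y' hy'
    push_cast at h2
    exact mul_le_mul (hC t (Ico_subset_Icc_self ht)) h2 dist_nonneg hC0
  have hfd : ∀ t ∈ Icc (0 : ℝ) 1, HasDerivAt (fun t => (Z t, q t)) (a' t • (q t, g (Z t))) t := by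
    intro t ht
    refine ((hZ t ht).prodMk (hq t ht)).congr_deriv ?_
    rw [hgE _ _ (hZpos t ht) (hE t ht)]
    simp [mul_comm]
  have hgd : ∀ t ∈ Icc (0 : ℝ) 1, HasDerivAt (fun t => (u (a t), p (a t)))
      (a' t • (p (a t), g (u (a t)))) t := by
    intro t ht
    refine (((h.hu (a t)).comp t (ha t ht)).prodMk ((h.hp (a t)).comp t (ha t ht))).congr_deriv ?_
    rw [hgE _ _ (h.pos _) (h.energy _)]
    simp [mul_comm]
  have key := ODE_solution_unique_of_mem_Icc_right (v := fun t y => a' t • (y.2, g y.1))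
    (s := fun _ => S) hvL (fun t ht => (hfd t ht).continuousAt.continuousWithinAt)
    (fun t ht => (hfd t (Ico_subset_Icc_self ht)).hasDerivWithinAt)
    (fun t ht => ⟨(weight_le_iff hz₀ (hZpos t (Ico_subset_Icc_self ht))).1 (weight_le_of_energy hz₀.1
      (hE t (Ico_subset_Icc_self ht))), trivial⟩)
    (fun t ht => (hgd t ht).continuousAt.continuousWithinAt)
    (fun t ht => (hgd t (Ico_subset_Icc_self ht)).hasDerivWithinAt)
    (fun t _ => ⟨h.mem_Icc hz₀ _, trivial⟩) (by simp [hZ0, hq0])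
    (right_mem_Icc.2 zero_le_one)
  simpa using key

lemma hasDerivAt_tan_comp {f : ℝ → ℝ} {f' t : ℝ} (hc : Real.cos (f t) ≠ 0) (h : HasDerivAt f f' t) :
    HasDerivAt (fun t => Real.tan (f t)) (1 / Real.cos (f t) ^ 2 * f') t :=
  (Real.hasDerivAt_tan hc).comp t h

/-- Along the solution `x' = z cos θ` is bounded below by a positive constant, so `x` is a bijection
of the line and can serve as parameter. -/
lemma exists_profile {z₀ : ℝ} (hz₀ : z₀ ∈ Ioo (0 : ℝ) 1) :
    ∃ u p : ℝ → ℝ, IsProfile z₀ u p ∧ ∃ x z θ : ℝ → ℝ, IsGeneratingSolution x z θ ∧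
      x 0 = 0 ∧ z 0 = z₀ ∧ θ 0 = 0 ∧ Function.Surjective x ∧ ∀ s, z s = u (x s) := by
  obtain ⟨x, z, θ, h, hx0, hz0, hθ0⟩ := exists_generatingSolution hz₀
  have hw0 := weight_pos hz₀.1
  have hcos : ∀ s, Real.cos (θ s) = weight (z s) / weight z₀ := h.cos_pos hz₀.1 hz0 hθ0
  have hcpos : ∀ s, 0 < Real.cos (θ s) := fun s => by
    rw [hcos]; exact div_pos (weight_pos (h.pos s)) hw0
  have hzge : ∀ s, z₀ ≤ z s := by
    intro s
    have h1 := Real.cos_le_one (θ s)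
    rw [hcos, div_le_one hw0] at h1
    exact ((weight_le_iff hz₀ (h.pos s)).1 h1).1
  -- Lower bound for `x'`: the height is at least `z₀`, and `cos θ = weight z / weight z₀` is
  -- smallest where the weight is, at height 1.
  set δ := z₀ * (weight 1 / weight z₀) with hδ
  have hδ0 : 0 < δ := mul_pos hz₀.1 (div_pos (weight_pos one_pos) hw0)
  have hδx : ∀ s, δ ≤ z s * Real.cos (θ s) := by
    intro s
    rw [hcos]
    exact mul_le_mul (hzge s) (div_le_div_of_nonneg_right (weight_one_le (h.pos s)) hw0.le)
      (div_pos (weight_pos one_pos) hw0).le (h.pos s).le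
  have hmono : Monotone fun s => x s - δ * s :=
    monotone_of_deriv_nonneg (fun s => ((h.hx s).sub ((hasDerivAt_id' s).const_mul δ)).differentiableAt)
      fun s => by
        have := ((h.hx s).sub ((hasDerivAt_id' s).const_mul δ)).deriv
        change deriv (x - fun s => δ * s) s ≥ 0
        rw [this]
        linarith [hδx s]
  have hstrict : StrictMono x := by
    intro s t hst
    have := hmono hst.le
    simp only at this
    nlinarith
  have hxc : Continuous x := continuous_iff_continuousAt.2 fun s => (h.hx s).continuousAt
  have hsurj : Function.Surjective x := by
    refine hxc.surjective ?_ ?_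
    · refine tendsto_atTop_mono' _ ?_ (tendsto_id.const_mul_atTop hδ0)
      filter_upwards [eventually_ge_atTop 0] with s hs
      have := hmono hs
      simp only [hx0] at this
      simp only [id]
      linarith
    · refine tendsto_atBot_mono' _ ?_ (tendsto_id.const_mul_atBot hδ0)
      filter_upwards [eventually_le_atBot 0] with s hs
      have := hmono hs
      simp only [hx0] at this
      simp only [id]
      linarith
  set e := hstrict.orderIsoOfSurjective x hsurj with he
  have hxe : ∀ r, x (e.symm r) = r := fun r => e.apply_symm_apply r
  have hex : ∀ s, e.symm (x s) = s := fun s => e.symm_apply_apply s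
  have hg : ∀ r, HasDerivAt e.symm (z (e.symm r) * Real.cos (θ (e.symm r)))⁻¹ r := fun r =>
    HasDerivAt.of_local_left_inverse e.symm.continuous.continuousAt (h.hx _)
      (mul_pos (h.pos _) (hcpos _)).ne' (Eventually.of_forall hxe)
  have hg0 : e.symm 0 = 0 := by rw [← hx0, hex, hx0]
  refine ⟨fun r => z (e.symm r), fun r => Real.tan (θ (e.symm r)), ⟨fun r => h.pos _, fun r => ?_,
    fun r => ?_, by simp [hg0, hz0], by simp [hg0, hθ0]⟩, x, z, θ, h, hx0, hz0, hθ0, hsurj,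
    fun s => by simp [hex]⟩
  · refine ((h.hz _).comp r (hg r)).congr_deriv ?_
    have h1 := (h.pos (e.symm r)).ne'
    have h2 := (hcpos (e.symm r)).ne'
    rw [Real.tan_eq_sin_div_cos]
    field_simp
  · refine (hasDerivAt_tan_comp (f := θ ∘ e.symm) (hcpos _).ne' ((h.hθ (e.symm r)).comp r (hg r))).congr_deriv ?_
    have h1 := (h.pos (e.symm r)).ne'
    have h2 := (hcpos (e.symm r)).ne'
    simp only [Function.comp]
    rw [Real.tan_eq_sin_div_cos]
    field_simp
    linear_combination (-(1 - z (e.symm r))) * (Real.sin_sq_add_cos_sq (θ (e.symm r)))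

lemma IsProfile.generatingCurve_eq {z₀ : ℝ} {u p : ℝ → ℝ} (hz₀ : z₀ ∈ Ioo (0 : ℝ) 1)
    (h : IsProfile z₀ u p) : generatingCurve z₀ = {q | q.2 = u q.1} := by
  have key : ∀ x z θ : ℝ → ℝ, IsGeneratingSolution x z θ → x 0 = 0 → z 0 = z₀ → θ 0 = 0 →
      ∀ s, z s = u (x s) := by
    intro x z θ hs hx0 hz0 hθ0 s
    have hcos := hs.cos_pos hz₀.1 hz0 hθ0
    have hc : ∀ r, Real.cos (θ r) ≠ 0 := fun r => by
      rw [hcos]; exact (div_pos (weight_pos (hs.pos r)) (weight_pos hz₀.1)).ne'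
    have hzc : Continuous z := continuous_iff_continuousAt.2 fun s => (hs.hz s).continuousAt
    have hθc : Continuous θ := continuous_iff_continuousAt.2 fun s => (hs.hθ s).continuousAt
    -- The time interval between 0 and `s`, of either sign, is rescaled to `[0, 1]` to apply the
    -- uniqueness statement.
    have hm : ∀ t, HasDerivAt (fun t => s * t) s t := fun t => by
      simpa using (hasDerivAt_id' t).const_mul s
    have := h.eq_of_reparam hz₀ (a := fun t => x (s * t)) (Z := fun t => z (s * t))
      (q := fun t => Real.tan (θ (s * t)))
      (a' := fun t => z (s * t) * Real.cos (θ (s * t)) * s) (by fun_prop)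
      (fun t _ => (hs.hx _).comp t (hm t))
      (fun t _ => ((hs.hz _).comp t (hm t)).congr_deriv (by
        rw [Real.tan_eq_sin_div_cos]
        have := hc (s * t)
        field_simp))
      (fun t _ => (hasDerivAt_tan_comp (f := fun t => θ (s * t)) (hc _) ((hs.hθ (s * t)).comp t (hm t))).congr_deriv (by
        rw [Real.tan_eq_sin_div_cos]
        have := hc (s * t)
        have := (hs.pos (s * t)).ne'
        field_simp
        linear_combination (-(1 - z (s * t)) * s) * (Real.sin_sq_add_cos_sq (θ (s * t)))))
      (fun t _ => hs.pos _)
      (fun t _ => by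
        have h1 := hc (s * t)
        have h2 : weight (z (s * t)) = Real.cos (θ (s * t)) * weight z₀ := by
          rw [hcos, div_mul_cancel₀ _ (weight_pos hz₀.1).ne']
        simp only [Real.tan_eq_sin_div_cos, h2]
        field_simp
        linear_combination weight z₀ ^ 2 * Real.sin_sq_add_cos_sq (θ (s * t)))
      (by simp [hx0, hz0, h.u_zero]) (by simp [hx0, hθ0, h.p_zero])
    simpa using this.1
  ext ⟨a, b⟩
  constructor
  · rintro ⟨x, z, θ, hs, hx0, hz0, hθ0, s, hq⟩
    simp only [Prod.mk.injEq] at hq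
    simp only [mem_ofPred_eq, hq.1, hq.2]
    exact key x z θ hs hx0 hz0 hθ0 s
  · intro (hb : b = u a)
    obtain ⟨_, _, _, x, z, θ, hs, hx0, hz0, hθ0, hsurj, _⟩ := exists_profile hz₀
    obtain ⟨s, rfl⟩ := hsurj a
    exact ⟨x, z, θ, hs, hx0, hz0, hθ0, s, by rw [hb, key x z θ hs hx0 hz0 hθ0 s]⟩

/-! ### Symmetry and periodicity of the profile -/

/-- The profile equation is invariant under `x ↦ 2c - x`. If the slope vanishes at `c`, both halves
have the same initial data there, and uniqueness applies. -/
lemma IsProfile.reflect {z₀ : ℝ} {u p : ℝ → ℝ} (hz₀ : z₀ ∈ Ioo (0 : ℝ) 1) (h : IsProfile z₀ u p)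
    {c : ℝ} (hc : p c = 0) (s : ℝ) : u (c - s) = u (c + s) ∧ p (c - s) = -p (c + s) := by
  have hm : ∀ t, HasDerivAt (fun t => c - s * t) (-s) t := fun t => by
    simpa using ((hasDerivAt_id' t).const_mul s).const_sub c
  have hm' : ∀ t, HasDerivAt (fun t => c + s * t) s t := fun t => by
    simpa using ((hasDerivAt_id' t).const_mul s).const_add c
  have := h.eq_of_reparam hz₀ (a := fun t => c + s * t) (Z := fun t => u (c - s * t))
      (q := fun t => -p (c - s * t)) (a' := fun _ => s) continuousOn_const
      (fun t _ => hm' t)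
      (fun t _ => ((h.hu _).comp t (hm t)).congr_deriv (by ring))
      (fun t _ => (((h.hp (c - s * t)).comp t (hm t)).neg).congr_deriv (by ring))
      (fun t _ => h.pos _)
      (fun t _ => by rw [neg_sq]; exact h.energy _)
      (by simp) (by simp [hc])
  simp only [mul_one] at this
  exact ⟨this.1, by linarith [this.2]⟩

lemma IsProfile.even {z₀ : ℝ} {u p : ℝ → ℝ} (hz₀ : z₀ ∈ Ioo (0 : ℝ) 1) (h : IsProfile z₀ u p)
    (s : ℝ) : u (-s) = u s ∧ p (-s) = -p s := by
  simpa using h.reflect hz₀ h.p_zero s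

/-- By the mean value theorem `f'` takes the value `f(x + 1) - f(x)` somewhere in `(x, x + 1)`, and
this difference tends to `L - L`. -/
lemma eq_zero_of_tendsto_deriv {f f' : ℝ → ℝ} {L m : ℝ} (hf : ∀ x, HasDerivAt f (f' x) x)
    (hL : Tendsto f atTop (𝓝 L)) (hm : Tendsto f' atTop (𝓝 m)) : m = 0 := by
  have h1 : ∀ x : ℝ, ∃ ξ ∈ Ioo x (x + 1), f' ξ = (f (x + 1) - f x) / (x + 1 - x) := fun x =>
    exists_hasDerivAt_eq_slope f f' (by linarith)
      (fun y _ => (hf y).continuousAt.continuousWithinAt) fun y _ => hf y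
  choose ξ hξ hξ' using h1
  have h2 : Tendsto ξ atTop atTop := tendsto_atTop_mono (fun x => (hξ x).1.le) tendsto_id
  have h3 : Tendsto (fun x => f (x + 1) - f x) atTop (𝓝 (L - L)) :=
    (hL.comp (tendsto_atTop_add_const_right _ 1 tendsto_id)).sub hL
  rw [sub_self] at h3
  refine tendsto_nhds_unique (hm.comp h2) (h3.congr fun x => ?_)
  simp [hξ']

lemma IsProfile.continuous_u {z₀ : ℝ} {u p : ℝ → ℝ} (h : IsProfile z₀ u p) : Continuous u :=
  continuous_iff_continuousAt.2 fun s => (h.hu s).continuousAt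

lemma IsProfile.continuous_p {z₀ : ℝ} {u p : ℝ → ℝ} (h : IsProfile z₀ u p) : Continuous p :=
  continuous_iff_continuousAt.2 fun s => (h.hp s).continuousAt

lemma IsProfile.eq_or_eq {z₀ : ℝ} {u p : ℝ → ℝ} (hz₀ : z₀ ∈ Ioo (0 : ℝ) 1) (h : IsProfile z₀ u p)
    {x : ℝ} (hx : p x = 0) : u x = z₀ ∨ u x = topHeight z₀ := by
  rw [← weight_eq_iff hz₀ (h.pos x)]
  have h1 := h.energy x
  rw [hx] at h1
  exact (sq_eq_sq₀ (weight_pos (h.pos x)).le (weight_pos hz₀.1).le).1 (by linarith)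

/-- With positive slope forever, `u` would increase to a limit `L`. The energy gives a limit for
`p`, which must be 0; then `p'` converges and its limit must be 0 too, so `L = 1`. The energy at the
limit would read `weight 1 = weight z₀`. -/
lemma IsProfile.exists_zero {z₀ : ℝ} {u p : ℝ → ℝ} (hz₀ : z₀ ∈ Ioo (0 : ℝ) 1)
    (h : IsProfile z₀ u p) {ε : ℝ} (hpε : 0 < p ε) : ∃ x, ε ≤ x ∧ p x = 0 := by
  by_contra! hne
  have hpos : ∀ x, ε ≤ x → 0 < p x := by
    intro x hx
    by_contra! hlt
    obtain ⟨y, hy, hy0⟩ := intermediate_value_Icc' hx h.continuous_p.continuousOn ⟨hlt, hpε.le⟩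
    exact hne y hy.1 hy0
  have hmono : MonotoneOn u (Ici ε) :=
    monotoneOn_of_deriv_nonneg (convex_Ici ε) h.continuous_u.continuousOn
      (fun x _ => (h.hu x).differentiableAt.differentiableWithinAt) fun x hx => by
        rw [interior_Ici] at hx
        rw [(h.hu x).deriv]
        exact (hpos x (le_of_lt hx)).le
  have hmono' : Monotone fun x => u (max x ε) := fun x y hxy =>
    hmono (mem_Ici.2 (le_max_right x ε)) (mem_Ici.2 (le_max_right y ε)) (max_le_max_right _ hxy)
  have hbdd : BddAbove (range fun x => u (max x ε)) :=
    ⟨topHeight z₀, by rintro _ ⟨x, rfl⟩; exact (h.mem_Icc hz₀ _).2⟩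
  obtain ⟨L, hL⟩ : ∃ L, Tendsto u atTop (𝓝 L) := ⟨_, (tendsto_atTop_ciSup hmono' hbdd).congr' (by
    filter_upwards [eventually_ge_atTop ε] with x hx
    rw [max_eq_left hx])⟩
  have hLmem : L ∈ Icc z₀ (topHeight z₀) :=
    isClosed_Icc.mem_of_tendsto hL (Eventually.of_forall fun x => h.mem_Icc hz₀ x)
  have hL0 : 0 < L := hz₀.1.trans_le hLmem.1
  have hwL : Tendsto (fun x => weight (u x)) atTop (𝓝 (weight L)) :=
    (hasDerivAt_weight hL0.ne').continuousAt.tendsto.comp hL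
  have hp2 : Tendsto (fun x => p x ^ 2) atTop (𝓝 (weight z₀ ^ 2 / weight L ^ 2 - 1)) := by
    refine Tendsto.congr (fun x => ?_) ((tendsto_const_nhds.div (hwL.pow 2)
      (pow_pos (weight_pos hL0) 2).ne').sub_const 1)
    have := weight_pos (h.pos x)
    rw [Pi.div_apply, ← h.energy x]
    field_simp
    ring
  have hp1 : Tendsto p atTop (𝓝 √(weight z₀ ^ 2 / weight L ^ 2 - 1)) := by
    refine ((Real.continuous_sqrt.tendsto _).comp hp2).congr' ?_
    filter_upwards [eventually_ge_atTop ε] with x hx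
    exact Real.sqrt_sq (hpos x hx).le
  have hz := eq_zero_of_tendsto_deriv h.hu hL hp1
  rw [hz] at hp1
  have hwL0 := weight_pos hL0
  have hp2' : weight z₀ ^ 2 / weight L ^ 2 - 1 = 0 :=
    tendsto_nhds_unique hp2 (by simpa using hp1.pow 2)
  have hp3 := ((((hp1.pow 2).const_add 1).const_mul 2).mul (hL.const_sub 1)).div (hL.pow 2)
    (pow_pos hL0 2).ne'
  have h4 := eq_zero_of_tendsto_deriv h.hp hp1 hp3
  have hL1 : L = 1 := by
    have : L ≠ 0 := hL0.ne'
    field_simp at h4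
    norm_num at h4
    linarith
  subst hL1
  have h5 := weight_one_lt hz₀
  rw [sub_eq_zero, div_eq_one_iff_eq (by positivity)] at hp2'
  nlinarith

/-- The profile increases from its minimum to its maximum on an interval `[0, x₁]`. -/
lemma IsProfile.exists_halfPeriod {z₀ : ℝ} {u p : ℝ → ℝ} (hz₀ : z₀ ∈ Ioo (0 : ℝ) 1)
    (h : IsProfile z₀ u p) :
    ∃ x₁, 0 < x₁ ∧ (∀ x ∈ Ioo 0 x₁, 0 < p x) ∧ p x₁ = 0 ∧ u x₁ = topHeight z₀ := by
  -- At the minimum `p = 0` and `p' > 0` because `z₀ < 1`. Starting the search for zeros at `ε`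
  -- excludes the zero at the origin.
  obtain ⟨ε, hε, hpε⟩ : ∃ ε > 0, ∀ x ∈ Ioc 0 ε, 0 < p x := by
    have hd := h.hp 0
    rw [h.p_zero, h.u_zero] at hd
    have hd0 : 0 < 2 * (1 + (0 : ℝ) ^ 2) * (1 - z₀) / z₀ ^ 2 := by
      have := hz₀.1
      have := sub_pos.2 hz₀.2
      positivity
    have h1 := hasDerivAt_iff_tendsto_slope.1 hd
    have h2 : ∀ᶠ x in 𝓝[>] (0 : ℝ), 0 < slope p 0 x :=
      (h1.mono_left (nhdsWithin_mono _ fun x hx => ne_of_gt hx)).eventually (eventually_gt_nhds hd0)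
    obtain ⟨ε, hε, hε'⟩ := (mem_nhdsGT_iff_exists_Ioc_subset).1 h2
    refine ⟨ε, hε, fun x hx => ?_⟩
    have h3 : 0 < slope p 0 x := hε' hx
    rw [slope_def_field, h.p_zero, sub_zero, sub_zero] at h3
    exact (div_pos_iff_of_pos_right hx.1).1 h3
  have hε0 : 0 < ε := hε
  set S := {x | ε ≤ x ∧ p x = 0} with hS
  have hSne : S.Nonempty := h.exists_zero hz₀ (hpε ε ⟨hε0, le_rfl⟩)
  have hSc : IsClosed S := isClosed_Ici.inter (isClosed_singleton.preimage h.continuous_p)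
  have hSb : BddBelow S := ⟨ε, fun x hx => hx.1⟩
  have hmem : sInf S ∈ S := hSc.csInf_mem hSne hSb
  have hx₁ : 0 < sInf S := hε0.trans_le hmem.1
  have hpos : ∀ x ∈ Ioo 0 (sInf S), 0 < p x := by
    intro x hx
    by_contra! hlt
    rcases le_total x ε with hxε | hxε
    · exact absurd (hpε x ⟨hx.1, hxε⟩) hlt.not_gt
    · obtain ⟨y, hy, hy0⟩ := intermediate_value_Icc' hxε h.continuous_p.continuousOn
        ⟨hlt, (hpε ε ⟨hε0, le_rfl⟩).le⟩
      exact absurd (csInf_le hSb (⟨hy.1, hy0⟩ : y ∈ S)) (by linarith [hy.2, hx.2])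
  have hmono : StrictMonoOn u (Icc 0 (sInf S)) :=
    strictMonoOn_of_deriv_pos (convex_Icc _ _) h.continuous_u.continuousOn fun x hx => by
      rw [interior_Icc] at hx
      rw [(h.hu x).deriv]
      exact hpos x hx
  have hlt := hmono (left_mem_Icc.2 hx₁.le) (right_mem_Icc.2 hx₁.le) hx₁
  rw [h.u_zero] at hlt
  exact ⟨_, hx₁, hpos, hmem.2, (h.eq_or_eq hz₀ hmem.2).resolve_left hlt.ne'⟩

lemma IsProfile.strictMonoOn {z₀ : ℝ} {u p : ℝ → ℝ} (h : IsProfile z₀ u p) {x₁ : ℝ}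
    (hp : ∀ x ∈ Ioo 0 x₁, 0 < p x) : StrictMonoOn u (Icc 0 x₁) :=
  strictMonoOn_of_deriv_pos (convex_Icc _ _) h.continuous_u.continuousOn fun x hx => by
    rw [interior_Icc] at hx
    rw [(h.hu x).deriv]
    exact hp x hx

lemma IsProfile.exists_periodic {z₀ : ℝ} {u p : ℝ → ℝ} (hz₀ : z₀ ∈ Ioo (0 : ℝ) 1)
    (h : IsProfile z₀ u p) : ∃ T, 0 < T ∧ Function.Periodic u T := by
  obtain ⟨x₁, hx₁, -, hp, -⟩ := h.exists_halfPeriod hz₀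
  -- The composition of the reflections in the critical points 0 and `x₁` is the translation by `2
  -- x₁`.
  refine ⟨2 * x₁, by linarith, fun x => ?_⟩
  rw [show x + 2 * x₁ = x₁ + (x₁ + x) by ring, ← (h.reflect hz₀ hp _).1, ← (h.even hz₀ x).1]
  congr 1
  ring

lemma IsProfile.isLeast {z₀ : ℝ} {u p : ℝ → ℝ} (hz₀ : z₀ ∈ Ioo (0 : ℝ) 1)
    (h : IsProfile z₀ u p) : IsLeast (range u) z₀ :=
  ⟨⟨0, h.u_zero⟩, by rintro _ ⟨x, rfl⟩; exact (h.mem_Icc hz₀ x).1⟩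

lemma IsProfile.isGreatest {z₀ : ℝ} {u p : ℝ → ℝ} (hz₀ : z₀ ∈ Ioo (0 : ℝ) 1)
    (h : IsProfile z₀ u p) : IsGreatest (range u) (topHeight z₀) := by
  obtain ⟨x₁, -, -, -, hx⟩ := h.exists_halfPeriod hz₀
  exact ⟨⟨x₁, hx⟩, by rintro _ ⟨x, rfl⟩; exact (h.mem_Icc hz₀ x).2⟩

/-! ### Smoothness of the profile and the limit `z₀ → 1` -/

/-- The derivatives of a profile, as functions of its value and its slope. -/
def profileDeriv : ℕ → ℝ × ℝ → ℝ
  | 0 => Prod.fst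
  | k + 1 => fun y => fderiv ℝ (profileDeriv k) y (y.2, 2 * (1 + y.2 ^ 2) * (1 - y.1) / y.1 ^ 2)

lemma contDiffOn_profileDeriv (k : ℕ) : ContDiffOn ℝ ∞ (profileDeriv k) {y | 0 < y.1} := by
  have ho : IsOpen {y : ℝ × ℝ | 0 < y.1} := isOpen_lt continuous_const continuous_fst
  induction k with
  | zero => exact contDiff_fst.contDiffOn
  | succ k ih =>
    refine (ih.fderiv_of_isOpen ho (m := ∞) (by norm_num)).clm_apply ?_
    refine contDiffOn_snd.prodMk (ContDiffOn.div (by fun_prop) (by fun_prop) fun y hy => ?_)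
    exact pow_ne_zero 2 (ne_of_gt hy)

lemma IsProfile.hasDerivAt_profileDeriv {z₀ : ℝ} {u p : ℝ → ℝ} (h : IsProfile z₀ u p) (k : ℕ)
    (x : ℝ) : HasDerivAt (fun x => profileDeriv k (u x, p x)) (profileDeriv (k + 1) (u x, p x)) x := by
  have ho : IsOpen {y : ℝ × ℝ | 0 < y.1} := isOpen_lt continuous_const continuous_fst
  have hd : DifferentiableAt ℝ (profileDeriv k) (u x, p x) :=
    ((contDiffOn_profileDeriv k).differentiableOn (by norm_num)).differentiableAt
      (ho.mem_nhds (h.pos x))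
  exact hd.hasFDerivAt.comp_hasDerivAt x ((h.hu x).prodMk (h.hp x))

lemma IsProfile.iteratedDeriv_eq {z₀ : ℝ} {u p : ℝ → ℝ} (h : IsProfile z₀ u p) (k : ℕ) :
    iteratedDeriv k u = fun x => profileDeriv k (u x, p x) := by
  induction k with
  | zero => simp [profileDeriv]
  | succ k ih =>
    rw [iteratedDeriv_succ, ih]
    exact funext fun x => (h.hasDerivAt_profileDeriv k x).deriv

lemma IsProfile.contDiff {z₀ : ℝ} {u p : ℝ → ℝ} (h : IsProfile z₀ u p) : ContDiff ℝ ∞ u := by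
  refine contDiff_of_differentiable_iteratedDeriv fun k _ => ?_
  rw [h.iteratedDeriv_eq]
  exact fun x => (h.hasDerivAt_profileDeriv k x).differentiableAt

/-- The function `u_{z₀}` of which the generating curve is the graph. -/
def profile (z₀ : ℝ) : ℝ → ℝ := if h : z₀ ∈ Ioo (0 : ℝ) 1 then (exists_profile h).choose else 1

lemma isProfile_profile {z₀ : ℝ} (hz₀ : z₀ ∈ Ioo (0 : ℝ) 1) :
    IsProfile z₀ (profile z₀) (deriv (profile z₀)) := by
  obtain ⟨p, hp, -⟩ := (exists_profile hz₀).choose_spec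
  have h : IsProfile z₀ (profile z₀) p := by rw [profile, dif_pos hz₀]; exact hp
  rwa [show deriv (profile z₀) = p from funext fun x => (h.hu x).deriv]

/-- Both `|u - 1|` and `|p|` become uniformly small: the first by the height bounds, the second by
the energy and `weight u ≥ weight 1`. Continuity of `profileDeriv k` at `(1, 0)` then handles all
orders at once. -/
lemma tendstoUniformly_profile_one (k : ℕ) :
    TendstoUniformly (fun z₀ => iteratedDeriv k (profile z₀))
      (iteratedDeriv k (fun _ : ℝ => (1 : ℝ))) (𝓝[<] (1 : ℝ)) := by
  have ho : IsOpen {y : ℝ × ℝ | 0 < y.1} := isOpen_lt continuous_const continuous_fst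
  have h0 : iteratedDeriv k (fun _ : ℝ => (1 : ℝ)) = fun _ => profileDeriv k (1, 0) := by
    cases k with
    | zero => simp [profileDeriv]
    | succ k =>
      ext x
      simp only [profileDeriv, iteratedDeriv_const]
      norm_num
      -- The point `(1, 0)` is an equilibrium of the profile system, so the direction of
      -- differentiation vanishes there.
      exact (map_zero _).symm
  rw [h0]
  have hc : ContinuousAt (profileDeriv k) (1, 0) :=
    (contDiffOn_profileDeriv k).continuousOn.continuousAt (ho.mem_nhds (by simp))
  rw [Metric.tendstoUniformly_iff]
  intro ε hε
  obtain ⟨δ, hδ, hδε⟩ := Metric.continuousAt_iff.1 hc ε hε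
  have hw : Tendsto (fun z₀ => (weight z₀ / weight 1) ^ 2 - 1) (𝓝[<] 1) (𝓝 0) := by
    have h1 : ContinuousAt (fun z₀ => (weight z₀ / weight 1) ^ 2 - 1) 1 :=
      (((hasDerivAt_weight one_ne_zero).continuousAt.div_const _).pow 2).sub continuousAt_const
    have h2 := h1.tendsto
    rw [div_self (weight_pos one_pos).ne', one_pow, sub_self] at h2
    exact h2.mono_left nhdsWithin_le_nhds
  filter_upwards [Ioo_mem_nhdsLT (zero_lt_one' ℝ), hw.eventually (eventually_lt_nhds (pow_pos hδ 2)),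
    tendsto_topHeight_one.eventually (eventually_lt_nhds (show (1 : ℝ) < 1 + δ by linarith)),
    nhdsWithin_le_nhds (eventually_gt_nhds (show 1 - δ < (1 : ℝ) by linarith))] with z₀ hz₀ h1 h2 h3 x
  have hP := isProfile_profile hz₀
  rw [hP.iteratedDeriv_eq, dist_comm]
  refine hδε ?_
  have hu := hP.mem_Icc hz₀ x
  have hE := hP.energy x
  have hw1 := weight_pos one_pos
  have hwu := weight_one_le (hP.pos x)
  have h4 : deriv (profile z₀) x ^ 2 < δ ^ 2 := by
    refine lt_of_le_of_lt ?_ h1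
    rw [le_sub_iff_add_le, div_pow, le_div_iff₀ (by positivity), ← hE, add_comm]
    exact mul_le_mul_of_nonneg_left (pow_le_pow_left₀ hw1.le hwu 2) (by positivity)
  rw [Prod.dist_eq, Real.dist_eq, Real.dist_eq]
  refine max_lt (abs_lt.2 ⟨by linarith [hu.1], by linarith [hu.2]⟩) ?_
  rw [sub_zero]
  exact abs_lt_of_sq_lt_sq h4 hδ.le

/-! ### Convergence to the doubly covered vertical plane -/

/-- The iterated partial derivatives of a function of two variables in the second variable. -/
def partialSnd (Φ : ℝ × ℝ → ℝ) : ℕ → ℝ × ℝ → ℝ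
  | 0 => Φ
  | k + 1 => fun y => fderiv ℝ (partialSnd Φ k) y (0, 1)

lemma contDiffOn_partialSnd {Φ : ℝ × ℝ → ℝ} {D : Set (ℝ × ℝ)} (hD : IsOpen D)
    (hΦ : ContDiffOn ℝ ∞ Φ D) (k : ℕ) : ContDiffOn ℝ ∞ (partialSnd Φ k) D := by
  induction k with
  | zero => exact hΦ
  | succ k ih => exact (ih.fderiv_of_isOpen hD (m := ∞) (by norm_num)).clm_apply contDiffOn_const

lemma iteratedDeriv_eq_partialSnd {Φ : ℝ × ℝ → ℝ} {D : Set (ℝ × ℝ)} (hD : IsOpen D)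
    (hΦ : ContDiffOn ℝ ∞ Φ D) (k : ℕ) {e z : ℝ} (hz : (e, z) ∈ D) :
    iteratedDeriv k (fun z => Φ (e, z)) z = partialSnd Φ k (e, z) := by
  induction k generalizing z with
  | zero => simp [partialSnd]
  | succ k ih =>
    rw [iteratedDeriv_succ]
    have hev : iteratedDeriv k (fun z => Φ (e, z)) =ᶠ[𝓝 z] fun z => partialSnd Φ k (e, z) := by
      filter_upwards [(hD.preimage (by fun_prop : Continuous fun z : ℝ => (e, z))).mem_nhds hz] with y hy
      exact ih hy
    rw [hev.deriv_eq]
    have hd : DifferentiableAt ℝ (partialSnd Φ k) (e, z) :=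
      ((contDiffOn_partialSnd hD hΦ k).differentiableOn (by norm_num)).differentiableAt
        (hD.mem_nhds hz)
    exact (hd.hasFDerivAt.comp_hasDerivAt z ((hasDerivAt_const z e).prodMk (hasDerivAt_id' z))).deriv

/-- The partial derivatives are jointly continuous, and the tube lemma provides a neighbourhood of
`e₀` whose product with `K` lies in `D`; compactness makes the convergence uniform. -/
lemma tendstoUniformlyOn_iteratedDeriv_param {Φ : ℝ × ℝ → ℝ} {D : Set (ℝ × ℝ)} (hD : IsOpen D)
    (hΦ : ContDiffOn ℝ ∞ Φ D) {K : Set ℝ} (hK : IsCompact K) {e₀ : ℝ}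
    (hKD : ∀ z ∈ K, (e₀, z) ∈ D) (k : ℕ) :
    TendstoUniformlyOn (fun e => iteratedDeriv k (fun z => Φ (e, z)))
      (iteratedDeriv k (fun z => Φ (e₀, z))) (𝓝 e₀) K := by
  obtain ⟨V, W, hV, -, heV, hKW, hVW⟩ := generalized_tube_lemma isCompact_singleton hK hD
    (show {e₀} ×ˢ K ⊆ D by rintro ⟨e, z⟩ ⟨rfl, hz⟩; exact hKD z hz)
  have heV' : e₀ ∈ V := heV rfl
  have hsub : V ×ˢ K ⊆ D := (prod_mono_right hKW).trans hVW
  intro u hu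
  obtain ⟨v, hv, h⟩ := hK.mem_uniformity_of_prod (f := fun e z => partialSnd Φ k (e, z)) (s := V)
    ((contDiffOn_partialSnd hD hΦ k).continuousOn.mono hsub) heV' (symm_le_uniformity hu)
  rw [hV.nhdsWithin_eq heV'] at hv
  filter_upwards [hv, hV.mem_nhds heV'] with e he heV z hz
  rw [iteratedDeriv_eq_partialSnd hD hΦ k (hKD z hz),
    iteratedDeriv_eq_partialSnd hD hΦ k (hsub ⟨heV, hz⟩)]
  exact h e he z hz

/-! ### The inverse branch of the profile -/

/-- Half of the period of the profile: the first positive point where it attains its maximum. -/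
def halfPeriod (z₀ : ℝ) : ℝ :=
  if h : z₀ ∈ Ioo (0 : ℝ) 1 then ((isProfile_profile h).exists_halfPeriod h).choose else 1

lemma halfPeriod_spec {z₀ : ℝ} (hz₀ : z₀ ∈ Ioo (0 : ℝ) 1) :
    0 < halfPeriod z₀ ∧ (∀ x ∈ Ioo 0 (halfPeriod z₀), 0 < deriv (profile z₀) x) ∧
      deriv (profile z₀) (halfPeriod z₀) = 0 ∧ profile z₀ (halfPeriod z₀) = topHeight z₀ := by
  rw [halfPeriod, dif_pos hz₀]
  exact ((isProfile_profile hz₀).exists_halfPeriod hz₀).choose_spec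

/-- The inverse function of the profile on `[0, x₁]`, `x₁` half of the period. -/
def sheet (z₀ : ℝ) : ℝ → ℝ := Function.invFunOn (profile z₀) (Icc 0 (halfPeriod z₀))

lemma strictMonoOn_profile {z₀ : ℝ} (hz₀ : z₀ ∈ Ioo (0 : ℝ) 1) : StrictMonoOn (profile z₀) (Icc 0 (halfPeriod z₀)) :=
  (isProfile_profile hz₀).strictMonoOn (halfPeriod_spec hz₀).2.1

lemma surjOn_profile {z₀ : ℝ} (hz₀ : z₀ ∈ Ioo (0 : ℝ) 1) :
    SurjOn (profile z₀) (Icc 0 (halfPeriod z₀)) (Icc z₀ (topHeight z₀)) := by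
  have h := intermediate_value_Icc (halfPeriod_spec hz₀).1.le
    (isProfile_profile hz₀).continuous_u.continuousOn
  rwa [(isProfile_profile hz₀).u_zero, (halfPeriod_spec hz₀).2.2.2] at h

lemma sheet_mem {z₀ : ℝ} (hz₀ : z₀ ∈ Ioo (0 : ℝ) 1)
    {z : ℝ} (hz : z ∈ Icc z₀ (topHeight z₀)) : sheet z₀ z ∈ Icc 0 (halfPeriod z₀) :=
  Function.invFunOn_mem (surjOn_profile hz₀ hz)

lemma profile_sheet {z₀ : ℝ} (hz₀ : z₀ ∈ Ioo (0 : ℝ) 1)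
    {z : ℝ} (hz : z ∈ Icc z₀ (topHeight z₀)) : profile z₀ (sheet z₀ z) = z :=
  Function.invFunOn_eq (surjOn_profile hz₀ hz)

lemma sheet_profile {z₀ : ℝ} (hz₀ : z₀ ∈ Ioo (0 : ℝ) 1)
    {x : ℝ} (hx : x ∈ Icc 0 (halfPeriod z₀)) : sheet z₀ (profile z₀ x) = x := by
  have h := (isProfile_profile hz₀).mem_Icc hz₀ x
  exact (strictMonoOn_profile hz₀).injOn (sheet_mem hz₀ h) hx (profile_sheet hz₀ h)

lemma sheet_mem_Ioo {z₀ : ℝ} (hz₀ : z₀ ∈ Ioo (0 : ℝ) 1)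
    {z : ℝ} (hz : z ∈ Ioo z₀ (topHeight z₀)) :
    sheet z₀ z ∈ Ioo 0 (halfPeriod z₀) := by
  have h := sheet_mem hz₀ (Ioo_subset_Icc_self hz)
  have h2 := profile_sheet hz₀ (Ioo_subset_Icc_self hz)
  refine ⟨lt_of_le_of_ne h.1 fun h' => ?_, lt_of_le_of_ne h.2 fun h' => ?_⟩
  · rw [← h', (isProfile_profile hz₀).u_zero] at h2
    exact hz.1.ne h2
  · rw [h', (halfPeriod_spec hz₀).2.2.2] at h2
    exact hz.2.ne h2.symm

lemma profile_mem_Ioo {z₀ : ℝ} (hz₀ : z₀ ∈ Ioo (0 : ℝ) 1)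
    {x : ℝ} (hx : x ∈ Ioo 0 (halfPeriod z₀)) :
    profile z₀ x ∈ Ioo z₀ (topHeight z₀) := by
  have hm := strictMonoOn_profile hz₀
  have h0 := (halfPeriod_spec hz₀).1.le
  constructor
  · have := hm (left_mem_Icc.2 h0) (Ioo_subset_Icc_self hx) hx.1
    rwa [(isProfile_profile hz₀).u_zero] at this
  · have := hm (Ioo_subset_Icc_self hx) (right_mem_Icc.2 h0) hx.2
    rwa [(halfPeriod_spec hz₀).2.2.2] at this

lemma strictMonoOn_sheet {z₀ : ℝ} (hz₀ : z₀ ∈ Ioo (0 : ℝ) 1) : StrictMonoOn (sheet z₀) (Icc z₀ (topHeight z₀)) := by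
  intro a ha b hb hab
  rw [← (strictMonoOn_profile hz₀).lt_iff_lt (sheet_mem hz₀ ha) (sheet_mem hz₀ hb),
    profile_sheet hz₀ ha, profile_sheet hz₀ hb]
  exact hab

lemma hasDerivAt_sheet {z₀ : ℝ} (hz₀ : z₀ ∈ Ioo (0 : ℝ) 1)
    {z : ℝ} (hz : z ∈ Ioo z₀ (topHeight z₀)) :
    HasDerivAt (sheet z₀) (deriv (profile z₀) (sheet z₀ z))⁻¹ z := by
  have hn : Ioo z₀ (topHeight z₀) ∈ 𝓝 z := isOpen_Ioo.mem_nhds hz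
  have hs := sheet_mem_Ioo hz₀ hz
  have hc : ContinuousAt (sheet z₀) z := by
    refine ((strictMonoOn_sheet hz₀).mono Ioo_subset_Icc_self).continuousAt_of_image_mem_nhds hn ?_
    filter_upwards [isOpen_Ioo.mem_nhds hs] with x hx
    exact ⟨profile z₀ x, profile_mem_Ioo hz₀ hx, sheet_profile hz₀ (Ioo_subset_Icc_self hx)⟩
  refine HasDerivAt.of_local_left_inverse hc ((isProfile_profile hz₀).hu _)
    ((halfPeriod_spec hz₀).2.1 _ hs).ne' ?_
  filter_upwards [hn] with y hy
  exact profile_sheet hz₀ (Ioo_subset_Icc_self hy)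

/-- The slope `dx/dz` of the generating curve at height `z`, for `e = 1 / weight z₀`. -/
def sheetSlope (q : ℝ × ℝ) : ℝ := q.1 * weight q.2 / √(1 - (q.1 * weight q.2) ^ 2)

/-- The domain of `sheetSlope`. -/
def slopeDomain : Set (ℝ × ℝ) := {q | 0 < q.2 ∧ (q.1 * weight q.2) ^ 2 < 1}

lemma contDiffOn_fst_mul_weight :
    ContDiffOn ℝ ∞ (fun q : ℝ × ℝ => q.1 * weight q.2) {q | 0 < q.2} :=
  contDiffOn_fst.mul (contDiffOn_weight.comp contDiffOn_snd fun _ hq => hq)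

lemma isOpen_slopeDomain : IsOpen slopeDomain := by
  have ho : IsOpen {q : ℝ × ℝ | 0 < q.2} := isOpen_lt continuous_const continuous_snd
  exact (contDiffOn_fst_mul_weight.continuousOn.pow 2).isOpen_inter_preimage ho isOpen_Iio

lemma contDiffOn_sheetSlope : ContDiffOn ℝ ∞ sheetSlope slopeDomain := by
  have h : ContDiffOn ℝ ∞ (fun q : ℝ × ℝ => q.1 * weight q.2) slopeDomain :=
    contDiffOn_fst_mul_weight.mono fun q hq => hq.1
  exact h.div ((contDiffOn_const.sub (h.pow 2)).sqrt fun q hq => (sub_pos.2 hq.2).ne')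
    fun q hq => (Real.sqrt_pos.2 (sub_pos.2 hq.2)).ne'

lemma mem_slopeDomain {z₀ z : ℝ} (hz₀ : z₀ ∈ Ioo (0 : ℝ) 1) (hz : z ∈ Ioo z₀ (topHeight z₀)) :
    ((weight z₀)⁻¹, z) ∈ slopeDomain := by
  have h0 : 0 < z := hz₀.1.trans hz.1
  have hw := weight_pos h0
  have hw0 := weight_pos hz₀.1
  have h1 := (weight_lt_iff hz₀ h0).2 hz
  refine ⟨h0, ?_⟩
  have h2 : (weight z₀)⁻¹ * weight z < 1 := by rw [inv_mul_lt_iff₀ hw0]; linarith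
  exact pow_lt_one₀ (by positivity) h2 two_ne_zero

/-- The energy identity with positive slope gives `dz/dx = √(1 - (eW)²) / (eW)` for `W = weight z`,
`e = 1 / weight z₀`. The parameter `z₀` enters the slope of the branch only through `e`. -/
lemma hasDerivAt_sheet' {z₀ z : ℝ} (hz₀ : z₀ ∈ Ioo (0 : ℝ) 1) (hz : z ∈ Ioo z₀ (topHeight z₀)) :
    HasDerivAt (sheet z₀) (sheetSlope ((weight z₀)⁻¹, z)) z := by
  refine (hasDerivAt_sheet hz₀ hz).congr_deriv ?_
  have hE := (isProfile_profile hz₀).energy (sheet z₀ z)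
  have hp := (halfPeriod_spec hz₀).2.1 _ (sheet_mem_Ioo hz₀ hz)
  rw [profile_sheet hz₀ (Ioo_subset_Icc_self hz)] at hE
  have hw := weight_pos (hz₀.1.trans hz.1)
  have hw0 := weight_pos hz₀.1
  set p := deriv (profile z₀) (sheet z₀ z)
  have h1 : 1 - ((weight z₀)⁻¹ * weight z) ^ 2 = (p * ((weight z₀)⁻¹ * weight z)) ^ 2 := by
    field_simp
    linarith
  rw [sheetSlope]
  simp only
  rw [h1, Real.sqrt_sq (by positivity)]
  field_simp

lemma tendsto_inv_weight : Tendsto (fun z₀ => (weight z₀)⁻¹) (𝓝[>] 0) (𝓝 0) :=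
  tendsto_inv_atTop_zero.comp tendsto_weight_zero

lemma eventually_Icc_subset {a : ℝ} (ha : 0 < a) (b : ℝ) :
    ∀ᶠ z₀ in 𝓝[>] (0 : ℝ), z₀ ∈ Ioo (0 : ℝ) 1 ∧ Icc a b ⊆ Ioo z₀ (topHeight z₀) := by
  filter_upwards [Ioo_mem_nhdsGT (zero_lt_one' ℝ), Ioo_mem_nhdsGT ha,
    tendsto_topHeight_zero.eventually (eventually_gt_atTop b)] with z₀ h1 h2 h3
  exact ⟨h1, fun z hz => ⟨h2.2.trans_le hz.1, hz.2.trans_lt h3⟩⟩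

lemma tendstoUniformlyOn_iteratedDeriv_succ_sheet {a : ℝ} (ha : 0 < a) (b : ℝ) (k : ℕ) :
    TendstoUniformlyOn (fun z₀ => iteratedDeriv (k + 1) (sheet z₀)) (fun _ => 0)
      (𝓝[>] (0 : ℝ)) (Icc a b) := by
  have h := tendstoUniformlyOn_iteratedDeriv_param isOpen_slopeDomain contDiffOn_sheetSlope
    (isCompact_Icc (a := a) (b := b)) (e₀ := 0)
    -- The limit parameter `e = 0` is interior to the domain of `sheetSlope`, which vanishes
    -- identically there.
    (fun z hz => ⟨ha.trans_le hz.1, by norm_num⟩) k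
  have h0 : iteratedDeriv k (fun z => sheetSlope (0, z)) = fun _ => 0 := by
    have : (fun z => sheetSlope (0, z)) = fun _ => (0 : ℝ) := by ext z; simp [sheetSlope]
    rw [this]
    ext x
    simp
  rw [h0] at h
  intro u hu
  filter_upwards [tendsto_inv_weight.eventually (h u hu), eventually_Icc_subset ha b]
    with z₀ h1 h2 z hz
  have hev : deriv (sheet z₀) =ᶠ[𝓝 z] fun z => sheetSlope ((weight z₀)⁻¹, z) := by
    filter_upwards [isOpen_Ioo.mem_nhds (h2.2 hz)] with y hy
    exact (hasDerivAt_sheet' h2.1 hy).deriv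
  rw [iteratedDeriv_succ', hev.iteratedDeriv_eq]
  exact h1 z hz

lemma contDiffOn_sheet {z₀ : ℝ} (hz₀ : z₀ ∈ Ioo (0 : ℝ) 1) :
    ContDiffOn ℝ ∞ (sheet z₀) (Ioo z₀ (topHeight z₀)) := by
  rw [contDiffOn_infty_iff_deriv_of_isOpen isOpen_Ioo]
  refine ⟨fun z hz => (hasDerivAt_sheet hz₀ hz).differentiableAt.differentiableWithinAt, ?_⟩
  have h : ContDiffOn ℝ ∞ (fun z => sheetSlope ((weight z₀)⁻¹, z)) (Ioo z₀ (topHeight z₀)) :=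
    contDiffOn_sheetSlope.comp (by fun_prop) fun z hz => mem_slopeDomain hz₀ hz
  exact h.congr fun z hz => (hasDerivAt_sheet' hz₀ hz).deriv

/-- Near the ideal boundary the curve is nearly vertical. -/
lemma sheet_le {z₀ δ : ℝ} (hz₀ : z₀ ∈ Ioo (0 : ℝ) 1) (hδ : z₀ < δ) (hδ2 : δ ≤ 1 / 2) :
    sheet z₀ δ ≤ Real.pi / 2 * δ ^ 2 := by
  have hP := isProfile_profile hz₀
  have hδ0 : 0 < δ := hz₀.1.trans hδ
  have hmem : δ ∈ Icc z₀ (topHeight z₀) :=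
    ⟨hδ.le, by linarith [one_lt_topHeight hz₀]⟩
  have hs := sheet_mem hz₀ hmem
  have hd : ∀ x, HasDerivAt (fun x => Real.arctan (deriv (profile z₀) x))
      (2 * (1 - profile z₀ x) / profile z₀ x ^ 2) x := by
    intro x
    refine ((hP.hp x).arctan).congr_deriv ?_
    have := (hP.pos x).ne'
    field_simp
  have hbound : ∀ x ∈ Icc 0 (sheet z₀ δ), profile z₀ x ≤ δ := by
    intro x hx
    rw [← profile_sheet hz₀ hmem]
    exact (strictMonoOn_profile hz₀).monotoneOn ⟨hx.1, hx.2.trans hs.2⟩ hs hx.2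
  -- The tangent angle `arctan p` has derivative `2 (1 - u) / u²`, at least `1 / δ²` while `u ≤ δ ≤
  -- 1/2`. As the angle stays below `π/2`, the interval has length at most `π δ² / 2`.
  have key := (convex_Icc 0 (sheet z₀ δ)).mul_sub_le_image_sub_of_le_deriv
    (f := fun x => Real.arctan (deriv (profile z₀) x)) (C := 1 / δ ^ 2)
    (fun x _ => (hd x).continuousAt.continuousWithinAt)
    (fun x _ => (hd x).differentiableAt.differentiableWithinAt)
    (fun x hx => by
      rw [(hd x).deriv]
      have h1 := hbound x (interior_subset hx)
      have h2 := hP.pos x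
      rw [div_le_div_iff₀ (by positivity) (by positivity)]
      nlinarith)
    0 (left_mem_Icc.2 hs.1) _ (right_mem_Icc.2 hs.1) hs.1
  rw [hP.p_zero, Real.arctan_zero, sub_zero, sub_zero] at key
  have h3 := key.trans (Real.arctan_lt_pi_div_two _).le
  rw [one_div, inv_mul_le_iff₀ (by positivity)] at h3
  linarith

/-- Convergence of the slope is uniform only away from height 0. Up to a small height `δ` the branch
is bounded by `sheet_le`, and from `δ` to `b` by the mean value inequality. -/
lemma tendsto_sheet {b : ℝ} (hb : 0 < b) : Tendsto (fun z₀ => sheet z₀ b) (𝓝[>] 0) (𝓝 0) := by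
  rw [Metric.tendsto_nhds]
  intro η hη
  obtain ⟨δ, hδ0, hδ1, hδb, hδη⟩ : ∃ δ : ℝ, 0 < δ ∧ δ ≤ 1 / 2 ∧ δ < b ∧
      Real.pi / 2 * δ ^ 2 < η / 2 := by
    have h1 : Tendsto (fun δ : ℝ => Real.pi / 2 * δ ^ 2) (𝓝[>] 0) (𝓝 0) := by
      have : Tendsto (fun δ : ℝ => Real.pi / 2 * δ ^ 2) (𝓝 0) (𝓝 (Real.pi / 2 * 0 ^ 2)) :=
        (Continuous.tendsto (by fun_prop) 0)
      simpa using this.mono_left nhdsWithin_le_nhds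
    obtain ⟨δ, h2, h3, h4⟩ := ((h1.eventually (eventually_lt_nhds (half_pos hη))).and
      ((eventually_mem_set.2 (Ioo_mem_nhdsGT (by norm_num : (0 : ℝ) < 1 / 2))).and
        (eventually_mem_set.2 (Ioo_mem_nhdsGT hb)))).exists
    exact ⟨δ, h3.1, h3.2.le, h4.2, h2⟩
  have hbδ : 0 < b - δ := by linarith
  have hU := Metric.tendstoUniformlyOn_iff.1
    (tendstoUniformlyOn_iteratedDeriv_succ_sheet hδ0 b 0) (η / 2 / (b - δ)) (by positivity)
  filter_upwards [hU, eventually_Icc_subset hδ0 b] with z₀ h1 h2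
  obtain ⟨hz₀, hsub⟩ := h2
  have hδm := hsub (left_mem_Icc.2 hδb.le)
  have hbm := hsub (right_mem_Icc.2 hδb.le)
  have key := Convex.norm_image_sub_le_of_norm_deriv_le (f := sheet z₀) (s := Icc δ b)
    (C := η / 2 / (b - δ)) (fun z hz => (hasDerivAt_sheet hz₀ (hsub hz)).differentiableAt)
    (fun z hz => by
      have := h1 z hz
      rw [zero_add, iteratedDeriv_one, dist_zero_left] at this
      exact this.le)
    (convex_Icc δ b) (left_mem_Icc.2 hδb.le) (right_mem_Icc.2 hδb.le)
  rw [Real.norm_eq_abs, Real.norm_eq_abs, abs_of_pos hbδ, div_mul_cancel₀ _ hbδ.ne'] at key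
  have h3 := sheet_le hz₀ hδm.1 hδ1
  have h4 := (sheet_mem_Ioo hz₀ hbm).1
  rw [Real.dist_eq, sub_zero, abs_of_pos h4]
  linarith [(abs_le.1 key).2]

/-- Since `u² ≤ weight u` and `p · weight u ≤ weight z₀`, the derivative of `u³` is at most `3
weight z₀`. The latter equals `3 weight(z₀*) ≤ 9 (z₀*)²` once `z₀* ≥ 2`, so climbing to `z₀*` takes
a length comparable to `z₀*`. Thus the period tends to infinity as `z₀ → 0`. -/
lemma topHeight_le_halfPeriod {z₀ : ℝ} (hz₀ : z₀ ∈ Ioo (0 : ℝ) 1) (h2 : 2 ≤ topHeight z₀) :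
    topHeight z₀ ≤ 18 * halfPeriod z₀ := by
  have hP := isProfile_profile hz₀
  obtain ⟨hx, hpos, -, htop⟩ := halfPeriod_spec hz₀
  set Z := topHeight z₀
  have hw0 := weight_pos hz₀.1
  have key := (convex_Icc 0 (halfPeriod z₀)).image_sub_le_mul_sub_of_deriv_le
    (f := fun x => profile z₀ x ^ 3) (C := 3 * weight z₀)
    (fun x _ => ((hP.hu x).pow 3).continuousAt.continuousWithinAt)
    (fun x _ => ((hP.hu x).pow 3).differentiableAt.differentiableWithinAt)
    (fun x hx => by
      rw [interior_Icc] at hx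
      rw [((hP.hu x).fun_pow 3).deriv]
      have hp := hpos x hx
      have hw := weight_pos (hP.pos x)
      have hE := hP.energy x
      have h3 := sq_le_weight (hP.pos x)
      have h4 : deriv (profile z₀) x * weight (profile z₀ x) ≤ weight z₀ := by
        refine le_of_sq_le_sq ?_ hw0.le
        nlinarith [sq_nonneg (weight (profile z₀ x))]
      have h5 := mul_le_mul_of_nonneg_left h3 hp.le
      push_cast
      linarith)
    0 (left_mem_Icc.2 hx.le) _ (right_mem_Icc.2 hx.le) hx.le
  simp only [htop, hP.u_zero, sub_zero] at key
  have hZ0 : 0 < Z := by linarith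
  have h6 : weight z₀ ≤ 3 * Z ^ 2 := by
    rw [← weight_topHeight hz₀, weight, mul_comm]
    refine mul_le_mul_of_nonneg_right ?_ (by positivity)
    have h7 : Real.exp (2 / Z) ≤ Real.exp 1 :=
      Real.exp_le_exp.2 (by rw [div_le_one hZ0]; exact h2)
    linarith [Real.exp_one_lt_d9]
  have h8 : z₀ ^ 3 ≤ 1 := pow_le_one₀ hz₀.1.le hz₀.2.le
  have h9 : Z ^ 3 ≤ 18 * Z ^ 2 * halfPeriod z₀ := by
    have h10 : 2 ≤ Z ^ 3 := by nlinarith [mul_pos hZ0 hZ0]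
    have h11 := mul_le_mul_of_nonneg_right h6 hx.le
    nlinarith
  have hZ2 : 0 < Z ^ 2 := by positivity
  nlinarith

lemma convergesToDoubleVertical_profile : ConvergesToDoubleVertical profile := by
  refine ⟨sheet, fun a b R ha hab hR => ⟨?_, fun k => ?_⟩⟩
  · filter_upwards [eventually_Icc_subset ha b,
      -- This makes half of the period at least `R`, so that `[-R, R]` meets only the two branches
      -- next to the minimum at 0.
      tendsto_topHeight_zero.eventually (eventually_ge_atTop (max 2 (18 * R)))] with z₀ h1 h2
    obtain ⟨hz₀, hsub⟩ := h1
    have hP := isProfile_profile hz₀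
    have hRx : R ≤ halfPeriod z₀ := by
      have h3 := topHeight_le_halfPeriod hz₀ ((le_max_left _ _).trans h2)
      linarith [(le_max_right 2 (18 * R)).trans h2]
    refine ⟨⟨_, isOpen_Ioo, hsub, contDiffOn_sheet hz₀⟩,
      fun z hz => (sheet_mem_Ioo hz₀ (hsub hz)).1, fun x hx z hz => ?_⟩
    have hx' : |x| ∈ Icc 0 (halfPeriod z₀) :=
      ⟨abs_nonneg x, (abs_le.2 ⟨hx.1, hx.2⟩).trans hRx⟩
    have hxu : profile z₀ |x| = profile z₀ x := by
      rcases abs_choice x with h | h <;> rw [h]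
      exact (hP.even hz₀ x).1
    have hs0 := (sheet_mem_Ioo hz₀ (hsub hz)).1
    rw [← abs_eq hs0.le, ← hxu]
    constructor
    · rintro rfl
      exact (sheet_profile hz₀ hx').symm
    · intro h
      rw [h, profile_sheet hz₀ (Ioo_subset_Icc_self (hsub hz))]
  · cases k with
    | zero =>
      simp only [iteratedDeriv_zero]
      rw [Metric.tendstoUniformlyOn_iff]
      intro ε hε
      filter_upwards [eventually_Icc_subset ha b,
        (Metric.tendsto_nhds.1 (tendsto_sheet (ha.trans hab))) ε hε] with z₀ h1 h2 z hz
      obtain ⟨hz₀, hsub⟩ := h1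
      rw [dist_comm]
      refine lt_of_le_of_lt ?_ h2
      have hbm := right_mem_Icc.2 (hz.1.trans hz.2)
      have hs := (sheet_mem_Ioo hz₀ (hsub hz)).1
      have hs' := (sheet_mem_Ioo hz₀ (hsub hbm)).1
      rw [Real.dist_eq, Real.dist_eq, sub_zero, sub_zero, abs_of_pos hs, abs_of_pos hs']
      exact (strictMonoOn_sheet hz₀).monotoneOn (Ioo_subset_Icc_self (hsub hz))
        (Ioo_subset_Icc_self (hsub hbm)) hz.2
    | succ k => exact tendstoUniformlyOn_iteratedDeriv_succ_sheet ha b k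

/-! ### Mean curvature of parametrized surfaces -/

lemma inner_dz_right (a : E3) : (inner ℝ a dz : ℝ) = a 2 := by
  simp [dz, EuclideanSpace.inner_single_right]

lemma inner_dz_left (a : E3) : (inner ℝ dz a : ℝ) = a 2 := by
  rw [real_inner_comm, inner_dz_right]

lemma dz_two : dz 2 = 1 := by simp [dz]

/-- Two of the three terms of the symbol are tangential; only the `∂_z` term survives against a
normal vector, and it is a multiple of the first form. Hence the correction `n₂ / z` in
`meanCurvature_eq`. -/
lemma inner_christoffel {q a b n : E3} (ha : (inner ℝ a n : ℝ) = 0) (hb : (inner ℝ b n : ℝ) = 0) :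
    (inner ℝ (christoffel q a b) n : ℝ) = (q 2)⁻¹ * (inner ℝ a b * n 2) := by
  simp only [christoffel, inner_neg_left, inner_smul_left, inner_sub_left, inner_add_left,
    ha, hb, inner_dz_left]
  simp

/-- The mean curvature in terms of the Euclidean first and second fundamental forms. -/
lemma meanCurvature_eq {X : E2 → E3} {x : E2} {n : E3} (hz : X x 2 ≠ 0)
    (h0 : (inner ℝ (pd X 0 x) n : ℝ) = 0) (h1 : (inner ℝ (pd X 1 x) n : ℝ) = 0)
    (hdet : (inner ℝ (pd X 0 x) (pd X 0 x) * inner ℝ (pd X 1 x) (pd X 1 x) -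
      inner ℝ (pd X 0 x) (pd X 1 x) ^ 2 : ℝ) ≠ 0) :
    meanCurvature X x n = 1 / 2 * ((inner ℝ (pd X 1 x) (pd X 1 x) * inner ℝ (pd (pd X 0) 0 x) n -
      inner ℝ (pd X 0 x) (pd X 1 x) * (inner ℝ (pd (pd X 0) 1 x) n + inner ℝ (pd (pd X 1) 0 x) n) +
      inner ℝ (pd X 0 x) (pd X 0 x) * inner ℝ (pd (pd X 1) 1 x) n) /
      (inner ℝ (pd X 0 x) (pd X 0 x) * inner ℝ (pd X 1 x) (pd X 1 x) -
      inner ℝ (pd X 0 x) (pd X 1 x) ^ 2)) + n 2 / X x 2 := by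
  have hc : (inner ℝ (pd X 1 x) (pd X 0 x) : ℝ) = inner ℝ (pd X 0 x) (pd X 1 x) :=
    real_inner_comm _ _
  simp only [meanCurvature, Matrix.inv_def, Matrix.det_fin_two, Matrix.adjugate_fin_two,
    Ring.inverse_eq_inv', Matrix.trace_fin_two, Matrix.mul_apply, Fin.sum_univ_two, firstForm,
    secondForm, Matrix.of_apply, Matrix.smul_apply, hypInner, inner_add_left,
    inner_christoffel h0 h0, inner_christoffel h0 h1, inner_christoffel h1 h0,
    inner_christoffel h1 h1, hc]
  simp only [Matrix.cons_val', Matrix.cons_val_zero, Matrix.cons_val_one, Matrix.cons_val_fin_one,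
    smul_eq_mul]
  generalize (inner ℝ (pd X 0 x) (pd X 0 x) : ℝ) = E at *
  generalize (inner ℝ (pd X 0 x) (pd X 1 x) : ℝ) = F at *
  generalize (inner ℝ (pd X 1 x) (pd X 1 x) : ℝ) = G at *
  generalize X x 2 = z at *
  have hdet' : E / z ^ 2 * (G / z ^ 2) - F / z ^ 2 * (F / z ^ 2) = (E * G - F ^ 2) / z ^ 4 := by
    field_simp
  rw [hdet']
  field_simp
  ring

/-! ### Horizontal orthonormal frames -/

/-- An orthonormal pair of horizontal vectors. -/
structure IsHorizontalFrame (v w : E3) : Prop where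
  v_two : v 2 = 0
  w_two : w 2 = 0
  norm_v : ‖v‖ = 1
  norm_w : ‖w‖ = 1
  orth : (inner ℝ v w : ℝ) = 0

lemma inner_eq_sum (a b : E3) : (inner ℝ a b : ℝ) = a 0 * b 0 + a 1 * b 1 + a 2 * b 2 := by
  simp [PiLp.inner_apply, Fin.sum_univ_three, mul_comm]

lemma IsHorizontalNormal.frame {v w : E3} (hv2 : v 2 = 0) (hv : v ≠ 0) (h : IsHorizontalNormal v w) :
    IsHorizontalFrame (‖v‖⁻¹ • v) w where
  v_two := by simp [hv2]
  w_two := h.1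
  norm_v := by rw [norm_smul, norm_inv, norm_norm, inv_mul_cancel₀ (norm_ne_zero_iff.2 hv)]
  norm_w := h.2.1
  orth := by rw [inner_smul_left, h.2.2, mul_zero]

namespace IsHorizontalFrame

variable {v w : E3}

lemma inner_v (h : IsHorizontalFrame v w) : (inner ℝ v v : ℝ) = 1 := by
  rw [real_inner_self_eq_norm_sq, h.norm_v, one_pow]

lemma inner_w (h : IsHorizontalFrame v w) : (inner ℝ w w : ℝ) = 1 := by
  rw [real_inner_self_eq_norm_sq, h.norm_w, one_pow]

lemma orth' (h : IsHorizontalFrame v w) : (inner ℝ w v : ℝ) = 0 := by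
  rw [real_inner_comm, h.orth]

lemma eq_sum (h : IsHorizontalFrame v w) (q : E3) :
    q = (inner ℝ v q : ℝ) • v + (inner ℝ w q : ℝ) • w + q 2 • dz := by
  have hv := h.inner_v
  have hw := h.inner_w
  have ho := h.orth
  rw [inner_eq_sum, h.v_two] at hv
  rw [inner_eq_sum, h.w_two] at hw
  rw [inner_eq_sum, h.v_two] at ho
  -- In the horizontal plane `w` is `D = ±1` times the quarter turn of `v`; the determinant `D`
  -- allows for both orientations of the frame.
  have h0 : w 0 = -v 1 * (v 0 * w 1 - v 1 * w 0) := by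
    linear_combination (-w 0) * hv + v 0 * ho
  have h1 : w 1 = v 0 * (v 0 * w 1 - v 1 * w 0) := by
    linear_combination (-w 1) * hv + v 1 * ho
  have hD : (v 0 * w 1 - v 1 * w 0) ^ 2 = 1 := by
    linear_combination hv * (w 0 * w 0 + w 1 * w 1) + hw - ho * (v 0 * w 0 + v 1 * w 1)
  generalize v 0 * w 1 - v 1 * w 0 = D at *
  ext i
  fin_cases i
  · simp [inner_eq_sum, h.v_two, h.w_two, dz]
    rw [h0, h1]
    linear_combination (-q 0) * hv + (-q 0 * v 1 ^ 2 + q 1 * v 0 * v 1) * hD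
  · simp [inner_eq_sum, h.v_two, h.w_two, dz]
    rw [h0, h1]
    linear_combination (-q 1) * hv + (-q 1 * v 0 ^ 2 + q 0 * v 0 * v 1) * hD
  · simp [h.v_two, h.w_two, dz]

lemma inner_dz_v (h : IsHorizontalFrame v w) : (inner ℝ v dz : ℝ) = 0 := by
  rw [inner_dz_right, h.v_two]

lemma inner_dz_w (h : IsHorizontalFrame v w) : (inner ℝ w dz : ℝ) = 0 := by
  rw [inner_dz_right, h.w_two]

lemma inner_eq (h : IsHorizontalFrame v w) (a b : E3) :
    (inner ℝ a b : ℝ) = inner ℝ v a * inner ℝ v b + inner ℝ w a * inner ℝ w b + a 2 * b 2 := by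
  conv_lhs => rw [h.eq_sum a]
  simp only [inner_add_left, inner_smul_left, inner_dz_left]
  simp

lemma ext (h : IsHorizontalFrame v w) {a b : E3} (h1 : (inner ℝ v a : ℝ) = inner ℝ v b)
    (h2 : (inner ℝ w a : ℝ) = inner ℝ w b) (h3 : a 2 = b 2) : a = b := by
  rw [h.eq_sum a, h.eq_sum b, h1, h2, h3]

end IsHorizontalFrame

/-! ### Ruled surfaces over a plane curve -/

/-- The surface with rulings parallel to `v` over the curve `(X, Z)` of the plane spanned by `w`
and `∂_z`. -/
def ruled (v w : E3) (X Z : ℝ → ℝ) (x : E2) : E3 := x 0 • v + X (x 1) • w + Z (x 1) • dz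

section ruled

variable {v w : E3} {X Z : ℝ → ℝ}

lemma inner_v_ruled (h : IsHorizontalFrame v w) (x : E2) :
    (inner ℝ v (ruled v w X Z x) : ℝ) = x 0 := by
  simp only [ruled, inner_add_right, inner_smul_right, h.inner_v, h.orth, h.inner_dz_v]
  ring

lemma inner_w_ruled (h : IsHorizontalFrame v w) (x : E2) :
    (inner ℝ w (ruled v w X Z x) : ℝ) = X (x 1) := by
  simp only [ruled, inner_add_right, inner_smul_right, h.inner_w, h.orth', h.inner_dz_w]
  ring

lemma ruled_two (h : IsHorizontalFrame v w) (x : E2) : ruled v w X Z x 2 = Z (x 1) := by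
  simp [ruled, h.v_two, h.w_two, dz_two]

lemma range_ruled (h : IsHorizontalFrame v w) :
    range (ruled v w X Z) = {q | ∃ s, (inner ℝ w q : ℝ) = X s ∧ q 2 = Z s} := by
  ext q
  constructor
  · rintro ⟨x, rfl⟩
    exact ⟨x 1, inner_w_ruled h x, ruled_two h x⟩
  · rintro ⟨s, h1, h2⟩
    refine ⟨!₂[(inner ℝ v q : ℝ), s], h.ext ?_ ?_ ?_⟩
    · rw [inner_v_ruled h]; simp
    · rw [inner_w_ruled h, h1]; simp
    · rw [ruled_two h, h2]; simp

lemma contDiff_ruled {n : WithTop ℕ∞} (hX : ContDiff ℝ n X) (hZ : ContDiff ℝ n Z) :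
    ContDiff ℝ n (ruled v w X Z) := by
  have h0 : ContDiff ℝ n fun x : E2 => x 0 := (EuclideanSpace.proj (𝕜 := ℝ) (0 : Fin 2)).contDiff
  have h1 : ContDiff ℝ n fun x : E2 => x 1 := (EuclideanSpace.proj (𝕜 := ℝ) (1 : Fin 2)).contDiff
  exact ((h0.smul contDiff_const).add ((hX.comp h1).smul contDiff_const)).add
    ((hZ.comp h1).smul contDiff_const)

lemma hasFDerivAt_comp_proj {f : ℝ → ℝ} {f' : ℝ} {x : E2} (hf : HasDerivAt f f' (x 1)) :
    HasFDerivAt (fun x : E2 => f (x 1)) (f' • (EuclideanSpace.proj 1 : E2 →L[ℝ] ℝ)) x :=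
  hf.comp_hasFDerivAt x (EuclideanSpace.proj (𝕜 := ℝ) (1 : Fin 2)).hasFDerivAt

lemma hasFDerivAt_ruled {x : E2} {X' Z' : ℝ} (hX : HasDerivAt X X' (x 1))
    (hZ : HasDerivAt Z Z' (x 1)) :
    HasFDerivAt (ruled v w X Z) ((EuclideanSpace.proj 0 : E2 →L[ℝ] ℝ).smulRight v +
      (X' • (EuclideanSpace.proj 1 : E2 →L[ℝ] ℝ)).smulRight w +
      (Z' • (EuclideanSpace.proj 1 : E2 →L[ℝ] ℝ)).smulRight dz) x :=
  (((EuclideanSpace.proj (𝕜 := ℝ) (0 : Fin 2)).hasFDerivAt.smul_const v).add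
    ((hasFDerivAt_comp_proj hX).smul_const w)).add ((hasFDerivAt_comp_proj hZ).smul_const dz)

lemma pd_zero_ruled {x : E2} {X' Z' : ℝ} (hX : HasDerivAt X X' (x 1))
    (hZ : HasDerivAt Z Z' (x 1)) : pd (ruled v w X Z) 0 x = v := by
  simp [pd, (hasFDerivAt_ruled hX hZ).fderiv]

lemma pd_one_ruled {x : E2} {X' Z' : ℝ} (hX : HasDerivAt X X' (x 1))
    (hZ : HasDerivAt Z Z' (x 1)) : pd (ruled v w X Z) 1 x = X' • w + Z' • dz := by
  simp [pd, (hasFDerivAt_ruled hX hZ).fderiv]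

lemma meanCurvature_ruled (h : IsHorizontalFrame v w) {X' X'' Z' Z'' : ℝ → ℝ}
    (hX : ∀ s, HasDerivAt X (X' s) s) (hX' : ∀ s, HasDerivAt X' (X'' s) s)
    (hZ : ∀ s, HasDerivAt Z (Z' s) s) (hZ' : ∀ s, HasDerivAt Z' (Z'' s) s)
    (x : E2) (hpos : 0 < Z (x 1)) (hne : X' (x 1) ^ 2 + Z' (x 1) ^ 2 ≠ 0) (r : ℝ) :
    meanCurvature (ruled v w X Z) x (r • (-Z' (x 1) • w + X' (x 1) • dz)) =
      r / 2 * ((X' (x 1) * Z'' (x 1) - Z' (x 1) * X'' (x 1)) / (X' (x 1) ^ 2 + Z' (x 1) ^ 2)) +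
        r * X' (x 1) / Z (x 1) := by
  have hp0 : pd (ruled v w X Z) 0 = fun _ => v := funext fun y => pd_zero_ruled (hX _) (hZ _)
  have hp1 : pd (ruled v w X Z) 1 = fun y => X' (y 1) • w + Z' (y 1) • dz :=
    funext fun y => pd_one_ruled (hX _) (hZ _)
  have hp0' : ∀ i, pd (pd (ruled v w X Z) 0) i x = 0 := by
    intro i
    rw [hp0]
    simp [pd]
  have hd1 : HasFDerivAt (pd (ruled v w X Z) 1)
      ((X'' (x 1) • (EuclideanSpace.proj 1 : E2 →L[ℝ] ℝ)).smulRight w +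
        (Z'' (x 1) • (EuclideanSpace.proj 1 : E2 →L[ℝ] ℝ)).smulRight dz) x := by
    rw [hp1]
    exact ((hasFDerivAt_comp_proj (hX' _)).smul_const w).add
      ((hasFDerivAt_comp_proj (hZ' _)).smul_const dz)
  have hp10 : pd (pd (ruled v w X Z) 1) 0 x = 0 := by
    rw [pd, hd1.fderiv]
    simp
  have hp11 : pd (pd (ruled v w X Z) 1) 1 x = X'' (x 1) • w + Z'' (x 1) • dz := by
    rw [pd, hd1.fderiv]
    simp
  have e00 : (inner ℝ (pd (ruled v w X Z) 0 x) (pd (ruled v w X Z) 0 x) : ℝ) = 1 := by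
    rw [hp0, h.inner_v]
  have e01 : (inner ℝ (pd (ruled v w X Z) 0 x) (pd (ruled v w X Z) 1 x) : ℝ) = 0 := by
    rw [hp0, hp1]
    simp [inner_add_right, inner_smul_right, h.orth, h.inner_dz_v]
  have e11 : (inner ℝ (pd (ruled v w X Z) 1 x) (pd (ruled v w X Z) 1 x) : ℝ) =
      X' (x 1) ^ 2 + Z' (x 1) ^ 2 := by
    rw [hp1]
    simp only [inner_add_right, inner_add_left, inner_smul_right, inner_smul_left, h.inner_w,
      h.inner_dz_w, inner_dz_left, h.w_two, dz_two]
    simp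
    ring
  rw [meanCurvature_eq, e00, e01, e11, hp0', hp0', hp10, hp11, ruled_two h]
  · simp only [inner_add_right, inner_add_left, inner_smul_right, inner_smul_left, h.inner_w,
      h.inner_dz_w, inner_dz_left, h.w_two, dz_two]
    simp [h.w_two, dz_two]
    ring
  · rw [ruled_two h]; exact hpos.ne'
  · rw [hp0]
    simp [inner_add_right, inner_smul_right, h.orth, h.inner_dz_v]
  · rw [hp1]
    simp only [inner_add_right, inner_add_left, inner_smul_right, inner_smul_left, h.inner_w,
      h.inner_dz_w, inner_dz_left, h.w_two, dz_two]
    simp only [RCLike.conj_to_real]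
    ring
  · rw [e00, e01, e11]
    simpa using hne

/-- The hypothesis `heq` is the horo-shrinker equation for the generating curve in an arbitrary
regular parameter, which lets one computation serve all three models. -/
lemma isHoroShrinker_ruled (h : IsHorizontalFrame v w) {X' X'' Z' Z'' : ℝ → ℝ}
    (hX : ∀ s, HasDerivAt X (X' s) s) (hX' : ∀ s, HasDerivAt X' (X'' s) s)
    (hZ : ∀ s, HasDerivAt Z (Z' s) s) (hZ' : ∀ s, HasDerivAt Z' (Z'' s) s)
    (hXc : ContDiff ℝ ∞ X) (hZc : ContDiff ℝ ∞ Z) (hpos : ∀ s, 0 < Z s)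
    (hne : ∀ s, X' s ^ 2 + Z' s ^ 2 ≠ 0)
    (heq : ∀ s, (X' s * Z'' s - Z' s * X'' s) * Z s ^ 2 =
      2 * X' s * (1 - Z s) * (X' s ^ 2 + Z' s ^ 2)) :
    IsHoroShrinker (ruled v w X Z) := by
  have hX'c : ContDiff ℝ ∞ X' := by
    rw [← show deriv X = X' from funext fun s => (hX s).deriv]
    exact (contDiff_infty_iff_deriv.1 hXc).2
  have hZ'c : ContDiff ℝ ∞ Z' := by
    rw [← show deriv Z = Z' from funext fun s => (hZ s).deriv]
    exact (contDiff_infty_iff_deriv.1 hZc).2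
  -- A hyperbolic unit vector at height `Z` has Euclidean length `Z`, whence this factor.
  set r : ℝ → ℝ := fun s => Z s / √(X' s ^ 2 + Z' s ^ 2) with hr
  have hposn : ∀ s, 0 < X' s ^ 2 + Z' s ^ 2 := fun s =>
    lt_of_le_of_ne (by positivity) (hne s).symm
  have hr2 : ∀ s, r s ^ 2 * (X' s ^ 2 + Z' s ^ 2) = Z s ^ 2 := by
    intro s
    simp only [hr, div_pow, Real.sq_sqrt (hposn s).le]
    rw [div_mul_cancel₀ _ (hne s)]
  have hrc : ContDiff ℝ ∞ r :=
    hZc.div (((hX'c.pow 2).add (hZ'c.pow 2)).sqrt hne) fun s => (Real.sqrt_pos.2 (hposn s)).ne'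
  have h1 : ContDiff ℝ ∞ fun x : E2 => x 1 := (EuclideanSpace.proj (𝕜 := ℝ) (1 : Fin 2)).contDiff
  have hfd : ∀ (x : E2) (ξ : E2), fderiv ℝ (ruled v w X Z) x ξ =
      ξ 0 • v + (X' (x 1) * ξ 1) • w + (Z' (x 1) * ξ 1) • dz := by
    intro x ξ
    simp [(hasFDerivAt_ruled (hX _) (hZ _)).fderiv]
  have hiv : ∀ (a b c : ℝ), (inner ℝ v (a • v + b • w + c • dz) : ℝ) = a := fun a b c => by
    rw [inner_add_right, inner_add_right, inner_smul_right, inner_smul_right, inner_smul_right,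
      h.inner_v, h.orth, h.inner_dz_v]
    ring
  have hiw : ∀ (a b c : ℝ), (inner ℝ w (a • v + b • w + c • dz) : ℝ) = b := fun a b c => by
    rw [inner_add_right, inner_add_right, inner_smul_right, inner_smul_right, inner_smul_right,
      h.inner_w, h.orth', h.inner_dz_w]
    ring
  have hiz : ∀ (a b c : ℝ), (a • v + b • w + c • dz) 2 = c := fun a b c => by
    simp [h.v_two, h.w_two, dz_two]
  refine ⟨fun x => ?_, contMDiff_iff_contDiff.2 (contDiff_ruled hXc hZc), fun x => ?_,
    fun x => r (x 1) • (-Z' (x 1) • w + X' (x 1) • dz), ?_, fun x => ?_, fun x ξ => ?_, ?_⟩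
  · simp only [upperHalfSpace, mem_ofPred_eq, ruled_two h]
    exact hpos _
  · rw [mfderiv_eq_fderiv]
    change Function.Injective (fderiv ℝ (ruled v w X Z) x)
    rw [injective_iff_map_eq_zero]
    intro ξ hξ
    rw [hfd] at hξ
    have e0 : ξ 0 = 0 := by rw [← hiv (ξ 0) (X' (x 1) * ξ 1) (Z' (x 1) * ξ 1), hξ, inner_zero_right]
    have e1 : X' (x 1) * ξ 1 = 0 := by
      rw [← hiw (ξ 0) (X' (x 1) * ξ 1) (Z' (x 1) * ξ 1), hξ, inner_zero_right]
    have e2 : Z' (x 1) * ξ 1 = 0 := by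
      rw [← hiz (ξ 0) (X' (x 1) * ξ 1) (Z' (x 1) * ξ 1), hξ]; rfl
    have e3 : ξ 1 = 0 := by
      have : (X' (x 1) ^ 2 + Z' (x 1) ^ 2) * ξ 1 = 0 := by
        linear_combination X' (x 1) * e1 + Z' (x 1) * e2
      exact (mul_eq_zero.1 this).resolve_left (hne _)
    ext i
    fin_cases i
    · exact e0
    · exact e3
  · refine contMDiff_iff_contDiff.2 ((hrc.comp h1).smul ?_)
    exact (((hZ'c.comp h1).neg).smul contDiff_const).add ((hX'c.comp h1).smul contDiff_const)
  · simp only [hypInner, ruled_two h]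
    rw [div_eq_one_iff_eq (pow_pos (hpos _) 2).ne', ← hr2 (x 1)]
    simp only [inner_add_right, inner_add_left, inner_smul_right, inner_smul_left, h.inner_w,
      h.inner_dz_w, inner_dz_left, h.w_two, dz_two]
    simp
    ring
  · rw [mfderiv_eq_fderiv]
    change hypInner _ (fderiv ℝ (ruled v w X Z) x (id ξ : E2)) _ = 0
    rw [hfd x (id ξ : E2), hypInner, h.inner_eq, hiv, hiw, hiz]
    simp only [inner_add_right, inner_smul_right, h.inner_w, h.orth, h.inner_dz_w, h.inner_dz_v]
    simp [h.w_two, dz_two]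
    left
    ring
  · intro e he x _
    rw [chartedSpaceSelf_atlas] at he
    subst he
    change meanCurvature (ruled v w X Z) x _ = _
    rw [meanCurvature_ruled h hX hX' hZ hZ' x (hpos _) (hne _), hypInner, inner_dz_right,
      ruled_two h]
    have hz := (hpos (x 1)).ne'
    have hn := hne (x 1)
    have hq := heq (x 1)
    simp only [PiLp.smul_apply, PiLp.add_apply, h.w_two, dz_two, smul_eq_mul]
    generalize r (x 1) = ρ
    field_simp
    linear_combination ρ * hq

end ruled

/-! ### Completeness and embeddedness of the models -/

/-- The derivative is integrable near 1, so `f` is the primitive of an integrable function there.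
The bound is only required after `t₀`, because the constant for the ruling coordinate depends on a
height bound that holds only near the end. -/
lemma exists_tendsto_of_abs_deriv_le {f G : ℝ → ℝ} {t₀ C : ℝ} (ht₀ : t₀ ∈ Ico (0 : ℝ) 1)
    (hC : 0 ≤ C) (hf : ContDiffOn ℝ 1 f (Ico 0 1)) (hb : ∀ t ∈ Ioo t₀ 1, |deriv f t| ≤ C * G t)
    (hG : (∫⁻ t in Ico (0 : ℝ) 1, ENNReal.ofReal (G t)) < ⊤) :
    ∃ l, Tendsto f (𝓝[<] 1) (𝓝 l) := by
  have hf' : ContDiffOn ℝ 1 f (Ioo 0 1) := hf.mono Ioo_subset_Ico_self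
  have hdc : ContinuousOn (deriv f) (Ioo 0 1) := hf'.continuousOn_deriv_of_isOpen isOpen_Ioo le_rfl
  have hsub : Ioo t₀ 1 ⊆ Ioo 0 1 := Ioo_subset_Ioo_left ht₀.1
  have hint : IntegrableOn (deriv f) (Ioo t₀ 1) := by
    refine ⟨(hdc.mono hsub).aestronglyMeasurable measurableSet_Ioo, ?_⟩
    calc ∫⁻ t in Ioo t₀ 1, ‖deriv f t‖ₑ
        ≤ ∫⁻ t in Ioo t₀ 1, ENNReal.ofReal C * ENNReal.ofReal (G t) := by
          refine setLIntegral_mono' measurableSet_Ioo fun t ht => ?_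
          rw [← ENNReal.ofReal_mul hC, Real.enorm_eq_ofReal_abs]
          exact ENNReal.ofReal_le_ofReal (hb t ht)
      _ ≤ ∫⁻ t in Ico 0 1, ENNReal.ofReal C * ENNReal.ofReal (G t) :=
          lintegral_mono_set (hsub.trans Ioo_subset_Ico_self)
      _ = ENNReal.ofReal C * ∫⁻ t in Ico 0 1, ENNReal.ofReal (G t) :=
          lintegral_const_mul' _ _ ENNReal.ofReal_ne_top
      _ < ⊤ := ENNReal.mul_lt_top ENNReal.ofReal_lt_top hG
  set t₁ := (t₀ + 1) / 2 with ht₁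
  have h01 : t₀ < t₁ := by rw [ht₁]; linarith [ht₀.2]
  have h11 : t₁ < 1 := by rw [ht₁]; linarith [ht₀.2]
  have hint' : IntegrableOn (deriv f) (uIcc t₁ 1) := by
    rw [uIcc_of_le h11.le, integrableOn_Icc_iff_integrableOn_Ioo]
    exact hint.mono_set (Ioo_subset_Ioo_left h01.le)
  have hF := intervalIntegral.continuousOn_primitive_interval hint'
  rw [uIcc_of_le h11.le] at hF
  have hF1 : Tendsto (fun x => f t₁ + ∫ t in t₁..x, deriv f t) (𝓝[<] 1)
      (𝓝 (f t₁ + ∫ t in t₁..1, deriv f t)) := by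
    refine Tendsto.const_add _ ?_
    have h := (hF 1 (right_mem_Icc.2 h11.le)).mono_left
      (nhdsWithin_mono 1 (Ioo_subset_Icc_self : Ioo t₁ 1 ⊆ _))
    rwa [nhdsWithin_Ioo_eq_nhdsLT h11] at h
  refine ⟨_, hF1.congr' ?_⟩
  filter_upwards [Ioo_mem_nhdsLT h11] with t ht
  have hs : uIcc t₁ t ⊆ Ioo 0 1 := by
    rw [uIcc_of_le ht.1.le]
    exact fun r hr => ⟨by linarith [ht₀.1, hr.1], hr.2.trans_lt ht.2⟩
  rw [intervalIntegral.integral_eq_sub_of_hasDerivAt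
    (fun r hr => ((hf'.differentiableOn one_ne_zero).differentiableAt
      (isOpen_Ioo.mem_nhds (hs hr))).hasDerivAt) ((hdc.mono hs).intervalIntegrable)]
  ring

section ruled

variable {v w : E3} {X Z : ℝ → ℝ}

/-- Hyperbolic length controls the profile parameter through `hspeed`, so that coordinate converges
first. The height is then bounded near the end of the curve, and this bounds the derivative of the
coordinate along the rulings. -/
lemma isCompleteImmersion_ruled (h : IsHorizontalFrame v w) {X' Z' : ℝ → ℝ}
    (hX : ∀ s, HasDerivAt X (X' s) s) (hZ : ∀ s, HasDerivAt Z (Z' s) s) (hpos : ∀ s, 0 < Z s)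
    {c : ℝ} (hc : 0 < c) (hspeed : ∀ s, (c * Z s) ^ 2 ≤ X' s ^ 2 + Z' s ^ 2) :
    IsCompleteImmersion (ruled v w X Z) := by
  intro γ hγ hfin
  rw [contMDiffOn_iff_contDiffOn] at hγ
  set G : ℝ → ℝ := fun t => ‖deriv (ruled v w X Z ∘ γ) t‖ / (ruled v w X Z (γ t)) 2 with hG
  have hγi : ∀ i : Fin 2, ContDiffOn ℝ 1 (fun t => γ t i) (Ico 0 1) := fun i =>
    (EuclideanSpace.proj (𝕜 := ℝ) i).contDiff.comp_contDiffOn hγ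
  have hd : ∀ t ∈ Ioo (0 : ℝ) 1, ∀ i : Fin 2, HasDerivAt (fun t => γ t i)
      (deriv (fun t => γ t i) t) t := fun t ht i =>
    ((((hγi i).differentiableOn one_ne_zero).mono Ioo_subset_Ico_self).differentiableAt
      (isOpen_Ioo.mem_nhds ht)).hasDerivAt
  have hdΨ : ∀ t ∈ Ioo (0 : ℝ) 1, deriv (ruled v w X Z ∘ γ) t =
      deriv (fun t => γ t 0) t • v + (X' (γ t 1) * deriv (fun t => γ t 1) t) • w +
        (Z' (γ t 1) * deriv (fun t => γ t 1) t) • dz := by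
    intro t ht
    exact ((((hd t ht 0).smul_const v).add (((hX _).comp t (hd t ht 1)).smul_const w)).add
      (((hZ _).comp t (hd t ht 1)).smul_const dz)).deriv
  have hnorm : ∀ t ∈ Ioo (0 : ℝ) 1, (G t * Z (γ t 1)) ^ 2 = deriv (fun t => γ t 0) t ^ 2 +
      (X' (γ t 1) ^ 2 + Z' (γ t 1) ^ 2) * deriv (fun t => γ t 1) t ^ 2 := by
    intro t ht
    simp only [hG, ruled_two h]
    rw [div_mul_cancel₀ _ (hpos _).ne', ← real_inner_self_eq_norm_sq, hdΨ t ht, h.inner_eq]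
    simp only [inner_add_right, inner_smul_right, h.inner_w, h.inner_v, h.orth, h.orth',
      h.inner_dz_w, h.inner_dz_v, PiLp.add_apply, PiLp.smul_apply, h.w_two, h.v_two, dz_two,
      smul_eq_mul]
    ring
  have hG0 : ∀ t, 0 ≤ G t := fun t => by
    simp only [hG, ruled_two h]
    exact div_nonneg (norm_nonneg _) (hpos _).le
  obtain ⟨l, hl⟩ : ∃ l, Tendsto (fun t => γ t 1) (𝓝[<] 1) (𝓝 l) := by
    refine exists_tendsto_of_abs_deriv_le (t₀ := 0) (C := c⁻¹) (by simp) (by positivity) (hγi 1)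
      (fun t ht => ?_) hfin
    have hz := hpos (γ t 1)
    have h1 := hnorm t ht
    have h2 := mul_le_mul_of_nonneg_right (hspeed (γ t 1)) (sq_nonneg (deriv (fun t => γ t 1) t))
    have h3 : (c * deriv (fun t => γ t 1) t) ^ 2 ≤ G t ^ 2 := by
      have : (c * deriv (fun t => γ t 1) t) ^ 2 * Z (γ t 1) ^ 2 ≤ G t ^ 2 * Z (γ t 1) ^ 2 := by
        nlinarith [sq_nonneg (deriv (fun t => γ t 0) t)]
      exact le_of_mul_le_mul_right this (by positivity)
    have h4 := abs_le_of_sq_le_sq h3 (hG0 t)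
    rw [le_inv_mul_iff₀ hc, ← abs_of_pos hc, ← abs_mul]
    exact h4
  obtain ⟨t₀, ht₀, hB⟩ : ∃ t₀ ∈ Ico (0 : ℝ) 1, ∀ t ∈ Ioo t₀ 1, Z (γ t 1) < Z l + 1 := by
    have h1 : ∀ᶠ t in 𝓝[<] (1 : ℝ), Z (γ t 1) < Z l + 1 :=
      ((hZ l).continuousAt.tendsto.comp hl).eventually (eventually_lt_nhds (lt_add_one _))
    obtain ⟨t, ht, ht'⟩ := (mem_nhdsLT_iff_exists_mem_Ico_Ioo_subset (zero_lt_one' ℝ)).1 h1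
    exact ⟨t, ht, ht'⟩
  obtain ⟨m, hm⟩ : ∃ m, Tendsto (fun t => γ t 0) (𝓝[<] 1) (𝓝 m) := by
    refine exists_tendsto_of_abs_deriv_le (C := Z l + 1) ht₀ (by linarith [hpos l]) (hγi 0)
      (fun t ht => ?_) hfin
    have ht' : t ∈ Ioo (0 : ℝ) 1 := ⟨ht₀.1.trans_lt ht.1, ht.2⟩
    have h3 : deriv (fun t => γ t 0) t ^ 2 ≤ (G t * Z (γ t 1)) ^ 2 := by
      rw [hnorm t ht']
      nlinarith [mul_nonneg (add_nonneg (sq_nonneg (X' (γ t 1))) (sq_nonneg (Z' (γ t 1))))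
        (sq_nonneg (deriv (fun t => γ t 1) t))]
    refine (abs_le_of_sq_le_sq h3 (mul_nonneg (hG0 t) (hpos _).le)).trans ?_
    rw [mul_comm]
    exact mul_le_mul_of_nonneg_right (hB t ht).le (hG0 t)
  refine ⟨m • EuclideanSpace.single 0 1 + l • EuclideanSpace.single 1 1, ?_⟩
  refine ((hm.smul_const (EuclideanSpace.single (0 : Fin 2) (1 : ℝ))).add
    (hl.smul_const (EuclideanSpace.single (1 : Fin 2) (1 : ℝ)))).congr fun t => ?_
  ext i
  fin_cases i <;> simp

/-- A function `g` that recovers the parameter of the curve gives a left inverse of the surface;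
continuity of the left inverse at the points of the image is enough. -/
lemma isEmbedding_ruled (h : IsHorizontalFrame v w) (hX : Continuous X) (hZ : Continuous Z)
    {g : ℝ × ℝ → ℝ} (hg : ∀ s, ContinuousAt g (X s, Z s)) (hgs : ∀ s, g (X s, Z s) = s) :
    IsEmbedding (ruled v w X Z) := by
  set L : E3 → E2 := fun q => (inner ℝ v q : ℝ) • EuclideanSpace.single 0 1 +
    g (inner ℝ w q, q 2) • EuclideanSpace.single 1 1 with hL
  have hLl : ∀ x, L (ruled v w X Z x) = x := by
    intro x
    simp only [hL, inner_v_ruled h, inner_w_ruled h, ruled_two h, hgs]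
    ext i
    fin_cases i <;> simp
  have hLc : ∀ x, ContinuousAt L (ruled v w X Z x) := by
    intro x
    have h1 : ContinuousAt (fun q : E3 => ((inner ℝ w q : ℝ), q 2)) (ruled v w X Z x) := by
      fun_prop
    have h2 : ContinuousAt (fun q : E3 => g (inner ℝ w q, q 2)) (ruled v w X Z x) := by
      refine ContinuousAt.comp (g := g) ?_ h1
      rw [inner_w_ruled h, ruled_two h]
      exact hg _
    have h3 : ContinuousAt (fun q : E3 => (inner ℝ v q : ℝ)) (ruled v w X Z x) := by fun_prop
    exact (h3.smul continuousAt_const).add (h2.smul continuousAt_const)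
  have hc : Continuous (ruled v w X Z) :=
    contDiff_zero.1 (contDiff_ruled (contDiff_zero.2 hX) (contDiff_zero.2 hZ))
  refine ⟨isInducing_iff_nhds.2 fun x => le_antisymm (hc.tendsto x).le_comap ?_,
    (show Function.LeftInverse L _ from hLl).injective⟩
  have h1 : Tendsto L (𝓝 (ruled v w X Z x)) (𝓝 x) := by
    have := (hLc x).tendsto
    rwa [hLl] at this
  have h2 : Tendsto (L ∘ ruled v w X Z) (comap (ruled v w X Z) (𝓝 (ruled v w X Z x))) (𝓝 x) :=
    h1.comp tendsto_comap
  rwa [show L ∘ ruled v w X Z = id from funext hLl, tendsto_id'] at h2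

end ruled

lemma isInvariantUnder_parabolicInfty {M : Type u} {Ψ : M → E3} {v : E3}
    (h : ∀ (t : ℝ), ∀ q ∈ range Ψ, q + t • v ∈ range Ψ) : IsInvariantUnder Ψ (parabolicInfty v) := by
  intro t
  refine Subset.antisymm ?_ fun q hq => ⟨q + (-t) • v, h _ q hq, by simp [parabolicInfty]⟩
  rintro _ ⟨q, hq, rfl⟩
  exact h t q hq

lemma isInvariantUnder_ruled {v v' w : E3} {X Z : ℝ → ℝ} (h : IsHorizontalFrame v w)
    (hv2 : v' 2 = 0) (hvw : (inner ℝ v' w : ℝ) = 0) :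
    IsInvariantUnder (ruled v w X Z) (parabolicInfty v') := by
  refine isInvariantUnder_parabolicInfty fun t q hq => ?_
  rw [range_ruled h] at hq ⊢
  obtain ⟨s, h1, h2⟩ := hq
  refine ⟨s, ?_, ?_⟩
  · rw [inner_add_right, inner_smul_right, real_inner_comm v' w, hvw, mul_zero, add_zero, h1]
  · simp [hv2, h2]

/-! ### The three models as ruled surfaces -/

lemma range_ruled_verticalPlane {v w : E3} (h : IsHorizontalFrame v w) (c : ℝ) :
    range (ruled v w (fun _ => c) Real.exp) = verticalPlane w c := by
  rw [range_ruled h]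
  ext q
  constructor
  · rintro ⟨s, h1, h2⟩
    exact ⟨by simp only [upperHalfSpace, mem_ofPred_eq, h2, Real.exp_pos], h1⟩
  · rintro ⟨h1, h2⟩
    exact ⟨Real.log (q 2), h2, (Real.exp_log h1).symm⟩

lemma range_ruled_horosphereOne {v w : E3} (h : IsHorizontalFrame v w) :
    range (ruled v w (fun s => s) fun _ => 1) = horosphereOne := by
  rw [range_ruled h]
  ext q
  exact ⟨fun ⟨s, _, h2⟩ => h2, fun hq => ⟨_, rfl, hq⟩⟩

lemma range_ruled_grimReaper {v w : E3} (h : IsHorizontalFrame v w) (c : ℝ) {z₀ : ℝ}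
    (hz₀ : z₀ ∈ Ioo (0 : ℝ) 1) :
    range (ruled v w (fun s => s + c) (profile z₀)) = grimReaper w c z₀ := by
  rw [range_ruled h]
  ext q
  rw [grimReaper, mem_ofPred_eq, mem_ofPred_eq, (isProfile_profile hz₀).generatingCurve_eq hz₀,
    mem_ofPred_eq]
  constructor
  · rintro ⟨s, h1, h2⟩
    simp only [h1, h2, add_sub_cancel_right]
  · exact fun hq => ⟨_, by ring, hq⟩

lemma isHoroShrinker_verticalPlane {v w : E3} (h : IsHorizontalFrame v w) (c : ℝ) :
    IsHoroShrinker (ruled v w (fun _ => c) Real.exp) ∧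
      IsCompleteImmersion (ruled v w (fun _ => c) Real.exp) ∧
      IsEmbedding (ruled v w (fun _ => c) Real.exp) := by
  refine ⟨isHoroShrinker_ruled h (fun s => hasDerivAt_const s c) (fun s => hasDerivAt_const s 0)
    Real.hasDerivAt_exp Real.hasDerivAt_exp contDiff_const Real.contDiff_exp Real.exp_pos
    (fun s => by positivity) fun s => by ring, ?_, ?_⟩
  · exact isCompleteImmersion_ruled h (fun s => hasDerivAt_const s c) Real.hasDerivAt_exp
      Real.exp_pos one_pos fun s => by norm_num
  · exact isEmbedding_ruled h continuous_const Real.continuous_exp (g := fun y => Real.log y.2)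
      (fun s => (continuousAt_snd).log (Real.exp_pos s).ne') fun s => Real.log_exp s

lemma isHoroShrinker_horosphereOne {v w : E3} (h : IsHorizontalFrame v w) :
    IsHoroShrinker (ruled v w (fun s => s) fun _ => 1) ∧
      IsCompleteImmersion (ruled v w (fun s => s) fun _ => 1) ∧
      IsEmbedding (ruled v w (fun s => s) fun _ => 1) := by
  refine ⟨isHoroShrinker_ruled h hasDerivAt_id' (fun s => hasDerivAt_const s 1)
    (fun s => hasDerivAt_const s 1) (fun s => hasDerivAt_const s 0) contDiff_id contDiff_const
    (fun _ => one_pos) (fun s => by norm_num) fun s => by ring, ?_, ?_⟩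
  · exact isCompleteImmersion_ruled h hasDerivAt_id' (fun s => hasDerivAt_const s 1)
      (fun _ => one_pos) one_pos fun s => by norm_num
  · exact isEmbedding_ruled h continuous_id continuous_const (g := Prod.fst)
      (fun s => continuousAt_fst) fun s => rfl

lemma isHoroShrinker_grimReaper {v w : E3} (h : IsHorizontalFrame v w) (c : ℝ) {z₀ : ℝ}
    (hz₀ : z₀ ∈ Ioo (0 : ℝ) 1) :
    IsHoroShrinker (ruled v w (fun s => s + c) (profile z₀)) ∧
      IsCompleteImmersion (ruled v w (fun s => s + c) (profile z₀)) ∧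
      IsEmbedding (ruled v w (fun s => s + c) (profile z₀)) := by
  have hP := isProfile_profile hz₀
  have hZ : 0 < topHeight z₀ := one_pos.trans (one_lt_topHeight hz₀)
  have hX : ∀ s : ℝ, HasDerivAt (fun s => s + c) 1 s := fun s => (hasDerivAt_id' s).add_const c
  refine ⟨isHoroShrinker_ruled h hX (fun s => hasDerivAt_const s 1)
    hP.hu hP.hp (contDiff_id.add contDiff_const) hP.contDiff
    hP.pos (fun s => by positivity) fun s => ?_, ?_, ?_⟩
  · have := (hP.pos s).ne'
    field_simp
    ring
  -- The horizontal Euclidean speed is 1 and the height is at most `z₀*`, so `1 / z₀*` is a valid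
  -- speed constant.
  · refine isCompleteImmersion_ruled h hX hP.hu hP.pos (inv_pos.2 hZ) fun s => ?_
    have h1 : (topHeight z₀)⁻¹ * profile z₀ s ≤ 1 := by
      rw [inv_mul_le_iff₀ hZ, mul_one]
      exact (hP.mem_Icc hz₀ s).2
    have h2 := pow_le_one₀ (n := 2) (mul_nonneg (inv_pos.2 hZ).le (hP.pos s).le) h1
    nlinarith [sq_nonneg (deriv (profile z₀) s)]
  · exact isEmbedding_ruled h (by fun_prop) hP.continuous_u (g := fun y => y.1 - c)
      (fun s => by fun_prop) fun s => by ring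

lemma exists_isHorizontalNormal {v : E3} (hv2 : v 2 = 0) (hv : v ≠ 0) :
    ∃ w, IsHorizontalNormal v w := by
  set u : E3 := !₂[-v 1, v 0, 0] with hu
  have hn : ‖u‖ = ‖v‖ := by
    rw [EuclideanSpace.norm_eq, EuclideanSpace.norm_eq]
    simp [hu, Fin.sum_univ_three, hv2, add_comm]
  have hv' : ‖v‖ ≠ 0 := norm_ne_zero_iff.2 hv
  refine ⟨‖v‖⁻¹ • u, by simp [hu], ?_, ?_⟩
  · rw [norm_smul, hn, norm_inv, norm_norm, inv_mul_cancel₀ hv']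
  · rw [inner_smul_right, inner_eq_sum]
    simp only [hu, hv2]
    simp
    right
    ring

lemma exists_horoShrinker_of_model {v : E3} (hv2 : v 2 = 0) (hv : v ≠ 0) {S : Set E3}
    (hS : IsGrimReaperModel v S) :
    ∃ Ψ : E2 → E3, IsHoroShrinker Ψ ∧ IsCompleteImmersion Ψ ∧ IsEmbedding Ψ ∧
      range Ψ = S ∧ IsInvariantUnder Ψ (parabolicInfty v) := by
  rcases hS with ⟨w, c, hw, rfl⟩ | rfl | ⟨w, c, z₀, hw, hz₀, rfl⟩
  · have hF := hw.frame hv2 hv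
    obtain ⟨h1, h2, h3⟩ := isHoroShrinker_verticalPlane hF c
    exact ⟨_, h1, h2, h3, range_ruled_verticalPlane hF c, isInvariantUnder_ruled hF hv2 hw.2.2⟩
  · obtain ⟨w, hw⟩ := exists_isHorizontalNormal hv2 hv
    have hF := hw.frame hv2 hv
    obtain ⟨h1, h2, h3⟩ := isHoroShrinker_horosphereOne hF
    exact ⟨_, h1, h2, h3, range_ruled_horosphereOne hF, isInvariantUnder_ruled hF hv2 hw.2.2⟩
  · have hF := hw.frame hv2 hv
    obtain ⟨h1, h2, h3⟩ := isHoroShrinker_grimReaper hF c hz₀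
    exact ⟨_, h1, h2, h3, range_ruled_grimReaper hF c hz₀, isInvariantUnder_ruled hF hv2 hw.2.2⟩

/-! ### Vertical planes through a finite fixed point -/

lemma parabolicAt_neg (p v : E3) (t : ℝ) (q : E3) :
    parabolicAt p v t (parabolicAt p v (-t) q) = q := by
  simp [parabolicAt, parabolicInfty, EuclideanGeometry.inversion_inversion]

lemma inversion_eq (p q : E3) :
    EuclideanGeometry.inversion p 1 q = (‖q - p‖ ^ 2)⁻¹ • (q - p) + p := by
  simp [EuclideanGeometry.inversion, dist_eq_norm]

lemma inversion_two {p q : E3} (hp : p 2 = 0) :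
    EuclideanGeometry.inversion p 1 q 2 = (‖q - p‖ ^ 2)⁻¹ * q 2 := by
  simp [inversion_eq, hp]

lemma sub_ne_zero_of_mem_upperHalfSpace {p q : E3} (hp : p 2 = 0) (hq : q ∈ upperHalfSpace) :
    q - p ≠ 0 := by
  intro h
  rw [sub_eq_zero] at h
  rw [h] at hq
  exact hp.not_gt hq

lemma inversion_mem_upperHalfSpace {p q : E3} (hp : p 2 = 0) (hq : q ∈ upperHalfSpace) :
    EuclideanGeometry.inversion p 1 q ∈ upperHalfSpace := by
  have h := norm_pos_iff.2 (sub_ne_zero_of_mem_upperHalfSpace hp hq)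
  have hq' : 0 < q 2 := hq
  change 0 < EuclideanGeometry.inversion p 1 q 2
  rw [inversion_two hp]
  positivity

/-- The inversion moves a point along its ray from `p`, and the plane contains `p` in its boundary.
-/
lemma inversion_mem_verticalPlane {p w q : E3} (hp : p 2 = 0)
    (hq : q ∈ verticalPlane w (inner ℝ w p)) :
    EuclideanGeometry.inversion p 1 q ∈ verticalPlane w (inner ℝ w p) := by
  refine ⟨inversion_mem_upperHalfSpace hp hq.1, ?_⟩
  rw [inversion_eq, inner_add_right, inner_smul_right, inner_sub_right, hq.2]
  ring

lemma exists_horoShrinker_verticalPlane_parabolicAt {p v w : E3} (hp : p 2 = 0) (hv2 : v 2 = 0)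
    (hv : v ≠ 0) (hw : IsHorizontalNormal v w) :
    ∃ Ψ : E2 → E3, IsHoroShrinker Ψ ∧ IsCompleteImmersion Ψ ∧ IsEmbedding Ψ ∧
      range Ψ = verticalPlane w (inner ℝ w p) ∧ IsInvariantUnder Ψ (parabolicAt p v) := by
  have hF := hw.frame hv2 hv
  obtain ⟨h1, h2, h3⟩ := isHoroShrinker_verticalPlane hF (inner ℝ w p)
  have hr := range_ruled_verticalPlane hF (inner ℝ w p)
  refine ⟨_, h1, h2, h3, hr, fun t => ?_⟩
  rw [hr]
  have key : ∀ t, ∀ q ∈ verticalPlane w (inner ℝ w p),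
      parabolicAt p v t q ∈ verticalPlane w (inner ℝ w p) := by
    intro t q hq
    refine inversion_mem_verticalPlane hp ?_
    obtain ⟨h4, h5⟩ := inversion_mem_verticalPlane hp hq
    refine ⟨?_, ?_⟩
    · change 0 < parabolicInfty v t (EuclideanGeometry.inversion p 1 q) 2
      have h6 : 0 < EuclideanGeometry.inversion p 1 q 2 := h4
      simpa [parabolicInfty, hv2] using h6
    · rw [parabolicInfty, inner_add_right, inner_smul_right, real_inner_comm v w, hw.2.2, mul_zero,
        add_zero, h5]
  refine Subset.antisymm ?_ fun q hq => ⟨_, key (-t) q hq, parabolicAt_neg p v t q⟩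
  rintro _ ⟨q, hq, rfl⟩
  exact key t q hq

/-! ### Immersed surfaces in charts -/

lemma isManifold_one {M : Type u} [TopologicalSpace M] [ChartedSpace E2 M]
    [IsManifold (𝓡 2) ∞ M] : IsManifold (𝓡 2) 1 M :=
  IsManifold.of_le (n := ∞) (by norm_num)

section charts

variable {M : Type u} [TopologicalSpace M] [ChartedSpace E2 M] [IsManifold (𝓡 2) ∞ M]
  {F : Type*} [NormedAddCommGroup F] [NormedSpace ℝ F] {Y : M → F}

lemma contDiffOn_comp_chart_symm (hY : ContMDiff (𝓡 2) 𝓘(ℝ, F) ∞ Y) (m : M) :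
    ContDiffOn ℝ ∞ (Y ∘ (chartAt E2 m).symm) (chartAt E2 m).target :=
  contMDiffOn_iff_contDiffOn.1 (hY.comp_contMDiffOn contMDiffOn_chart_symm)

lemma fderiv_comp_chart_symm (hY : ContMDiff (𝓡 2) 𝓘(ℝ, F) ∞ Y) (m : M) {x : E2}
    (hx : x ∈ (chartAt E2 m).target) (ξ : E2) :
    fderiv ℝ (Y ∘ (chartAt E2 m).symm) x ξ =
      mfderiv (𝓡 2) 𝓘(ℝ, F) Y ((chartAt E2 m).symm x)
        (mfderiv (𝓡 2) (𝓡 2) (chartAt E2 m).symm x ξ) := by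
  have : IsManifold (𝓡 2) 1 M := isManifold_one
  have h1 : MDifferentiableAt (𝓡 2) 𝓘(ℝ, F) Y ((chartAt E2 m).symm x) :=
    (hY _).mdifferentiableAt (by norm_num)
  have h2 : MDifferentiableAt (𝓡 2) (𝓡 2) (chartAt E2 m).symm x :=
    (mdifferentiable_chart m).mdifferentiableAt_symm hx
  rw [← mfderiv_eq_fderiv, mfderiv_comp x h1 h2]
  rfl

lemma injective_fderiv_comp_chart_symm (hY : ContMDiff (𝓡 2) 𝓘(ℝ, F) ∞ Y)
    (hinj : ∀ p, Function.Injective (mfderiv (𝓡 2) 𝓘(ℝ, F) Y p)) (m : M) {x : E2}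
    (hx : x ∈ (chartAt E2 m).target) :
    Function.Injective (fderiv ℝ (Y ∘ (chartAt E2 m).symm) x) := by
  have : IsManifold (𝓡 2) 1 M := isManifold_one
  have h3 : Function.Injective (mfderiv (𝓡 2) (𝓡 2) (chartAt E2 m).symm x) :=
    (mdifferentiable_chart m).symm.mfderiv_injective hx
  intro ξ η hξη
  rw [fderiv_comp_chart_symm hY m hx, fderiv_comp_chart_symm hY m hx] at hξη
  exact h3 (hinj _ hξη)

/-- Countably many charts suffice, and in each the map is locally Lipschitz, so it does not raise
the dimension 2 of the parameter domain. -/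
lemma dimH_range_le_two [SecondCountableTopology M] (hY : ContMDiff (𝓡 2) 𝓘(ℝ, F) ∞ Y) :
    dimH (range Y) ≤ 2 := by
  obtain ⟨s, hs, hcov⟩ := countable_cover_nhds fun m : M => chart_source_mem_nhds E2 m
  have hsub : range Y ⊆ ⋃ m ∈ s, (Y ∘ (chartAt E2 m).symm) '' (chartAt E2 m).target := by
    rintro _ ⟨p, rfl⟩
    have hp : p ∈ ⋃ m ∈ s, (chartAt E2 m).source := by rw [hcov]; trivial
    obtain ⟨m, hm, hpm⟩ := mem_iUnion₂.1 hp
    exact mem_iUnion₂.2 ⟨m, hm, chartAt E2 m p, (chartAt E2 m).map_source hpm, by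
      simp [(chartAt E2 m).left_inv hpm]⟩
  refine (dimH_mono hsub).trans ?_
  rw [dimH_bUnion hs]
  refine iSup₂_le fun m _ => ?_
  have h1 : dimH ((Y ∘ (chartAt E2 m).symm) '' (chartAt E2 m).target) ≤
      dimH (chartAt E2 m).target := by
    refine dimH_image_le_of_locally_lipschitzOn fun x hx => ?_
    have hc : ContDiffAt ℝ 1 (Y ∘ (chartAt E2 m).symm) x :=
      (((contDiffOn_comp_chart_symm hY m).of_le (by norm_num)).contDiffAt
        ((chartAt E2 m).open_target.mem_nhds hx))
    obtain ⟨K, t, ht, hK⟩ := hc.exists_lipschitzOnWith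
    exact ⟨K, t, nhdsWithin_le_nhds ht, hK⟩
  refine h1.trans ((dimH_mono (subset_univ _)).trans ?_)
  rw [Real.dimH_univ_eq_finrank]
  simp

/-- The direction of the translations is tangent to a translation invariant surface: otherwise the
image of the surface would have interior points. -/
lemma exists_fderiv_eq_of_invariant [SecondCountableTopology M] {Y : M → E3}
    (hY : ContMDiff (𝓡 2) 𝓘(ℝ, E3) ∞ Y)
    (hinj : ∀ p, Function.Injective (mfderiv (𝓡 2) 𝓘(ℝ, E3) Y p)) {v : E3}
    (hinv : ∀ t : ℝ, ∀ q ∈ range Y, q + t • v ∈ range Y) (m : M) {x : E2}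
    (hx : x ∈ (chartAt E2 m).target) :
    ∃ ξ, fderiv ℝ (Y ∘ (chartAt E2 m).symm) x ξ = v := by
  by_contra! hne
  set X := Y ∘ (chartAt E2 m).symm with hX
  have hinjX := injective_fderiv_comp_chart_symm hY hinj m hx
  have hXs : HasStrictFDerivAt X (fderiv ℝ X x) x :=
    ((contDiffOn_comp_chart_symm hY m).contDiffAt
      ((chartAt E2 m).open_target.mem_nhds hx)).hasStrictFDerivAt (by norm_num)
  -- Sweeping the surface along `v` remains inside the range by invariance. If `v` is transverse,
  -- the derivative of `Φ` is injective between spaces of dimension 3, so `Φ` is open at this point.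
  set Φ : E2 × ℝ → E3 := fun y => X y.1 + y.2 • v with hΦ
  set Φ' : E2 × ℝ →L[ℝ] E3 := (fderiv ℝ X x).comp (ContinuousLinearMap.fst ℝ E2 ℝ) +
    (ContinuousLinearMap.snd ℝ E2 ℝ).smulRight v with hΦ'
  have hd : HasStrictFDerivAt Φ Φ' (x, 0) :=
    HasStrictFDerivAt.add (HasStrictFDerivAt.comp (x, (0 : ℝ)) (f := Prod.fst) (g := X) hXs
      hasStrictFDerivAt_fst) ((hasStrictFDerivAt_snd).smul_const v)
  have hinj' : Function.Injective Φ' := by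
    rw [injective_iff_map_eq_zero]
    rintro ⟨ξ, t⟩ h0
    have h1 : fderiv ℝ X x ξ + t • v = 0 := h0
    have ht : t = 0 := by
      by_contra ht
      refine hne (-t⁻¹ • ξ) ?_
      rw [map_smul, eq_neg_of_add_eq_zero_left h1, smul_neg, neg_smul, neg_neg, smul_smul,
        inv_mul_cancel₀ ht, one_smul]
    rw [ht, zero_smul, add_zero] at h1
    rw [hinjX (h1.trans (map_zero _).symm), ht]
    rfl
  have hsurj : Function.Surjective Φ' := by
    have hdim : Module.finrank ℝ (E2 × ℝ) = Module.finrank ℝ E3 := by simp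
    exact (LinearMap.injective_iff_surjective_of_finrank_eq_finrank (f := Φ'.toLinearMap) hdim).1
      hinj'
  have hmap := hd.map_nhds_eq_of_surj (LinearMap.range_eq_top.2 hsurj)
  have hmem : range Y ∈ 𝓝 (Φ (x, 0)) := by
    rw [← hmap, mem_map]
    filter_upwards with y
    exact hinv _ _ ⟨_, rfl⟩
  have h3 := Real.dimH_of_mem_nhds hmem
  have h2 := dimH_range_le_two hY
  rw [h3] at h2
  simp at h2
  norm_cast at h2

end charts

/-! ### The structure of immersed surfaces with horizontal rulings -/

/-- A parametrized piece of surface `X`, with Euclidean unit normal `n`, to which the horizontal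
unit vector `v` is tangent. -/
structure IsRuledPatch (v : E3) (O : Set E2) (X n : E2 → E3) : Prop where
  isOpen : IsOpen O
  smooth : ContDiffOn ℝ ∞ X O
  smooth_n : ContDiffOn ℝ ∞ n O
  pos : ∀ x ∈ O, 0 < X x 2
  inj : ∀ x ∈ O, Function.Injective (fderiv ℝ X x)
  unit : ∀ x ∈ O, (inner ℝ (n x) (n x) : ℝ) = 1
  normal : ∀ x ∈ O, ∀ ξ, (inner ℝ (fderiv ℝ X x ξ) (n x) : ℝ) = 0
  tangent : ∀ x ∈ O, ∃ ξ, fderiv ℝ X x ξ = v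

namespace IsRuledPatch

variable {v w : E3} {O : Set E2} {X n : E2 → E3}

lemma inner_v_n (h : IsRuledPatch v O X n) {x : E2} (hx : x ∈ O) : (inner ℝ v (n x) : ℝ) = 0 := by
  obtain ⟨ξ, hξ⟩ := h.tangent x hx
  rw [← hξ]
  exact h.normal x hx ξ

lemma sq_add_sq (h : IsRuledPatch v O X n) (hF : IsHorizontalFrame v w) {x : E2} (hx : x ∈ O) :
    n x 2 ^ 2 + (inner ℝ w (n x) : ℝ) ^ 2 = 1 := by
  have h1 := h.unit x hx
  rw [hF.inner_eq (n x) (n x), h.inner_v_n hx] at h1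
  linear_combination h1

/-- Here `σ` is the arc-length form of the generating curve, `(n₂, -⟨w, n⟩)` its unit tangent and
`k` its Euclidean curvature. No reparametrization by ruling coordinates is needed. -/
lemma exists_structure (h : IsRuledPatch v O X n) (hF : IsHorizontalFrame v w) {x : E2}
    (hx : x ∈ O) : ∃ (σ : E2 →L[ℝ] ℝ) (k : ℝ), σ ≠ 0 ∧
      HasFDerivAt (fun y => (inner ℝ w (X y) : ℝ)) (n x 2 • σ) x ∧
      HasFDerivAt (fun y => X y 2) ((-inner ℝ w (n x) : ℝ) • σ) x ∧
      HasFDerivAt (fun y => n y 2) ((k * inner ℝ w (n x) : ℝ) • σ) x ∧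
      HasFDerivAt (fun y => (-inner ℝ w (n y) : ℝ)) ((k * n x 2) • σ) x ∧
      meanCurvature X x (X x 2 • n x) = (X x 2 * k + 2 * n x 2) / 2 := by
  have hO := h.isOpen.mem_nhds hx
  have hXc : ContDiffAt ℝ ∞ X x := h.smooth.contDiffAt hO
  have hX : HasFDerivAt X (fderiv ℝ X x) x := (hXc.differentiableAt (by norm_num)).hasFDerivAt
  have hX2 : HasFDerivAt (fderiv ℝ X) (fderiv ℝ (fderiv ℝ X) x) x :=
    ((hXc.fderiv_right (m := ∞) (by norm_num)).differentiableAt (by norm_num)).hasFDerivAt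
  have hn : HasFDerivAt n (fderiv ℝ n x) x :=
    ((h.smooth_n.contDiffAt hO).differentiableAt (by norm_num)).hasFDerivAt
  have hsymm : ∀ ξ η, fderiv ℝ (fderiv ℝ X) x ξ η = fderiv ℝ (fderiv ℝ X) x η ξ :=
    (hXc.isSymmSndFDerivAt (by
      rw [minSmoothness_of_isRCLikeNormedField]
      exact WithTop.coe_le_coe.2 (le_top : (2 : ℕ∞) ≤ ⊤))).eq
  set D := fderiv ℝ X x with hD
  set D2 := fderiv ℝ (fderiv ℝ X) x with hD2
  set Dn := fderiv ℝ n x with hDn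
  set C := n x 2 with hC
  set S : ℝ := -inner ℝ w (n x) with hS
  have hCS : C ^ 2 + S ^ 2 = 1 := by rw [hS, neg_sq]; exact h.sq_add_sq hF hx
  have hvn := h.inner_v_n hx
  set z := X x 2 with hz
  have hzpos : 0 < z := h.pos x hx
  set prz : E3 →L[ℝ] ℝ := EuclideanSpace.proj 2 with hprz
  set σ : E2 →L[ℝ] ℝ := C • (innerSL ℝ w).comp D + S • prz.comp D with hσ
  have hprz' : ∀ q : E3, prz q = q 2 := fun q => rfl
  have hσa : ∀ ξ, σ ξ = C * inner ℝ w (D ξ) + S * D ξ 2 := fun ξ => by simp [hσ, hprz']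
  have hperp : ∀ ξ, C * D ξ 2 - S * inner ℝ w (D ξ) = 0 := by
    intro ξ
    have h1 := h.normal x hx ξ
    rw [hF.inner_eq, hvn] at h1
    rw [hS]
    linear_combination h1
  have hA : ∀ ξ, (inner ℝ w (D ξ) : ℝ) = C * σ ξ := by
    intro ξ
    rw [hσa]
    linear_combination (-(inner ℝ w (D ξ) : ℝ)) * hCS - S * hperp ξ
  have hZ : ∀ ξ, D ξ 2 = S * σ ξ := by
    intro ξ
    rw [hσa]
    linear_combination (-(D ξ 2)) * hCS + C * hperp ξ
  have hmetric : ∀ ξ η, (inner ℝ (D ξ) (D η) : ℝ) =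
      inner ℝ v (D ξ) * inner ℝ v (D η) + σ ξ * σ η := by
    intro ξ η
    rw [hF.inner_eq, hA, hA, hZ, hZ]
    linear_combination σ ξ * σ η * hCS
  have hzero : ∀ ξ, (inner ℝ v (D ξ) : ℝ) = 0 → σ ξ = 0 → ξ = 0 := by
    intro ξ h1 h2
    have h3 : D ξ = 0 := by
      rw [hF.eq_sum (D ξ), h1, hA, hZ, h2]
      simp
    exact h.inj x hx (h3.trans (map_zero _).symm)
  -- the derivative of the normal
  have hvDn : ∀ ξ, (inner ℝ v (Dn ξ) : ℝ) = 0 := by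
    intro ξ
    have h1 : HasFDerivAt (fun y => (inner ℝ v (n y) : ℝ)) ((innerSL ℝ v).comp Dn) x :=
      (innerSL ℝ v).hasFDerivAt.comp x hn
    have h2 : HasFDerivAt (fun y => (inner ℝ v (n y) : ℝ)) (0 : E2 →L[ℝ] ℝ) x :=
      (hasFDerivAt_const (0 : ℝ) x).congr_of_eventuallyEq (by
        filter_upwards [hO] with y hy
        exact h.inner_v_n hy)
    exact DFunLike.congr_fun (h1.unique h2) ξ
  have hunit : ∀ ξ, C * Dn ξ 2 - S * inner ℝ w (Dn ξ) = 0 := by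
    intro ξ
    have h1 : HasFDerivAt (fun y => (inner ℝ (n y) (n y) : ℝ)) _ x := hn.inner ℝ hn
    have h2 : HasFDerivAt (fun y => (inner ℝ (n y) (n y) : ℝ)) (0 : E2 →L[ℝ] ℝ) x :=
      (hasFDerivAt_const (1 : ℝ) x).congr_of_eventuallyEq (by
        filter_upwards [hO] with y hy
        exact h.unit y hy)
    have h3 := DFunLike.congr_fun (h1.unique h2) ξ
    simp only [ContinuousLinearMap.comp_apply, ContinuousLinearMap.prod_apply, fderivInnerCLM_apply,
      zero_apply] at h3
    rw [real_inner_comm (n x) (Dn ξ), hF.inner_eq, hvn] at h3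
    rw [hS]
    linear_combination h3 / 2
  -- `μ` is the differential of the tangent angle: `dC = -S μ` and `dS = C μ`.
  set μ : E2 →L[ℝ] ℝ := -(C • (innerSL ℝ w).comp Dn) - S • prz.comp Dn with hμ
  have hμa : ∀ ξ, μ ξ = -(C * inner ℝ w (Dn ξ)) - S * Dn ξ 2 := fun ξ => by simp [hμ, hprz']
  have hwDn : ∀ ξ, -(inner ℝ w (Dn ξ) : ℝ) = C * μ ξ := by
    intro ξ
    rw [hμa]
    linear_combination (inner ℝ w (Dn ξ) : ℝ) * hCS + S * hunit ξ
  have hzDn : ∀ ξ, Dn ξ 2 = -S * μ ξ := by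
    intro ξ
    rw [hμa]
    linear_combination -(Dn ξ 2) * hCS + C * hunit ξ
  have hII : ∀ ξ η, (inner ℝ (D2 ξ η) (n x) : ℝ) = σ η * μ ξ := by
    intro ξ η
    have h0 : HasFDerivAt (fun y => fderiv ℝ X y η) (D2.flip η) x :=
      (hX2.clm_apply (hasFDerivAt_const η x)).congr_fderiv (by ext1; simp)
    have h1 : HasFDerivAt (fun y => (inner ℝ (fderiv ℝ X y η) (n y) : ℝ)) _ x := h0.inner ℝ hn
    have h2 : HasFDerivAt (fun y => (inner ℝ (fderiv ℝ X y η) (n y) : ℝ)) (0 : E2 →L[ℝ] ℝ) x :=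
      (hasFDerivAt_const (0 : ℝ) x).congr_of_eventuallyEq (by
        filter_upwards [hO] with y hy
        exact h.normal y hy η)
    have h3 := DFunLike.congr_fun (h1.unique h2) ξ
    simp only [ContinuousLinearMap.comp_apply, ContinuousLinearMap.prod_apply, fderivInnerCLM_apply,
      zero_apply, ContinuousLinearMap.flip_apply] at h3
    rw [hF.inner_eq (fderiv ℝ X x η), hvDn, hzDn, ← hD, hA, hZ] at h3
    linear_combination h3 + C * σ η * hwDn ξ + σ η * μ ξ * hCS
  -- The second form is `σ ⊗ μ`. Its symmetry makes `μ` proportional to `σ`, and the factor is the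
  -- curvature `k`.
  have hσμ : ∀ ξ η, σ η * μ ξ = σ ξ * μ η := by
    intro ξ η
    rw [← hII, ← hII, hsymm]
  have hσ0 : σ ≠ 0 := by
    intro h0
    set e0 : E2 := EuclideanSpace.single 0 1
    set e1 : E2 := EuclideanSpace.single 1 1
    have h1 : ∀ ξ, σ ξ = 0 := fun ξ => by rw [h0]; rfl
    -- This combination of the basis vectors is killed by `⟨v, D ·⟩`. If `σ` were zero it would be
    -- zero, so `e0` itself would be killed by both forms.
    have h2 := hzero ((inner ℝ v (D e1) : ℝ) • e0 - (inner ℝ v (D e0) : ℝ) • e1)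
      (by rw [map_sub, map_smul, map_smul, inner_sub_right, inner_smul_right, inner_smul_right]; ring)
      (h1 _)
    have h3 : (inner ℝ v (D e0) : ℝ) = 0 := by
      have := congrArg (fun q : E2 => q 1) h2
      simpa [e0, e1] using this
    have h4 := congrArg (fun q : E2 => q 0) (hzero e0 h3 (h1 _))
    simp [e0] at h4
  obtain ⟨ζ, hζ⟩ : ∃ ζ, σ ζ ≠ 0 := by
    by_contra! h0
    exact hσ0 (ContinuousLinearMap.ext h0)
  obtain ⟨k, hk⟩ : ∃ k, ∀ ξ, μ ξ = k * σ ξ := by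
    refine ⟨μ ζ / σ ζ, fun ξ => ?_⟩
    field_simp
    linear_combination hσμ ξ ζ
  refine ⟨σ, k, hσ0, ?_, ?_, ?_, ?_, ?_⟩
  · refine ((innerSL ℝ w).hasFDerivAt.comp x hX).congr_fderiv ?_
    ext1 ξ
    simpa using hA ξ
  · refine (prz.hasFDerivAt.comp x hX).congr_fderiv ?_
    ext1 ξ
    exact hZ ξ
  · refine (prz.hasFDerivAt.comp x hn).congr_fderiv ?_
    ext1 ξ
    have := hzDn ξ
    rw [hk, hS] at this
    simp only [ContinuousLinearMap.comp_apply, hprz', smul_apply, smul_eq_mul]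
    linear_combination this
  · refine ((innerSL ℝ w).hasFDerivAt.comp x hn).neg.congr_fderiv ?_
    ext1 ξ
    have := hwDn ξ
    rw [hk] at this
    simp only [ContinuousLinearMap.comp_apply, smul_apply, smul_eq_mul,
      neg_apply, innerSL_apply_apply]
    linear_combination this
  · set e0 : E2 := EuclideanSpace.single 0 1 with he0
    set e1 : E2 := EuclideanSpace.single 1 1 with he1
    have hpd0 : pd X 0 x = D e0 := rfl
    have hpd1 : pd X 1 x = D e1 := rfl
    have hpd2 : ∀ i j : Fin 2, pd (pd X j) i x =
        D2 (EuclideanSpace.single i 1) (EuclideanSpace.single j 1) := by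
      intro i j
      have h0 : HasFDerivAt (pd X j) (D2.flip (EuclideanSpace.single j 1)) x :=
        (hX2.clm_apply (hasFDerivAt_const _ x)).congr_fderiv (by ext1; simp)
      rw [pd, h0.fderiv]
      rfl
    set ω0 : ℝ := inner ℝ v (D e0)
    set ω1 : ℝ := inner ℝ v (D e1)
    have hdet : ω0 * σ e1 - ω1 * σ e0 ≠ 0 := by
      intro h0
      have h1 := hzero (σ e1 • e0 - σ e0 • e1)
        (by rw [map_sub, map_smul, map_smul, inner_sub_right, inner_smul_right, inner_smul_right]
            linear_combination h0)
        (by rw [map_sub, map_smul, map_smul, smul_eq_mul, smul_eq_mul]; ring)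
      have h2 : σ e1 = 0 := by simpa [e0, e1] using congrArg (fun q : E2 => q 0) h1
      have h3 : σ e0 = 0 := by simpa [e0, e1] using congrArg (fun q : E2 => q 1) h1
      refine hζ ?_
      have : ζ = ζ 0 • e0 + ζ 1 • e1 := by
        ext i
        fin_cases i <;> simp [e0, e1]
      rw [this, map_add, map_smul, map_smul, h2, h3]
      simp
    have hdet' : (ω0 * ω0 + σ e0 * σ e0) * (ω1 * ω1 + σ e1 * σ e1) -
        (ω0 * ω1 + σ e0 * σ e1) ^ 2 = (ω0 * σ e1 - ω1 * σ e0) ^ 2 := by ring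
    have hperp' : ∀ ξ, (inner ℝ (D ξ) (z • n x) : ℝ) = 0 := by
      intro ξ
      rw [inner_smul_right, h.normal x hx ξ, mul_zero]
    rw [meanCurvature_eq hzpos.ne' (hperp' _) (hperp' _)]
    · rw [hpd0, hpd1, hpd2, hpd2, hpd2, hpd2, hmetric, hmetric, hmetric, ← he0, ← he1]
      simp only [inner_smul_right, hII, hk, PiLp.smul_apply, smul_eq_mul]
      change 1 / 2 * (((ω1 * ω1 + σ e1 * σ e1) * (z * (σ e0 * (k * σ e0))) -
        (ω0 * ω1 + σ e0 * σ e1) * (z * (σ e0 * (k * σ e1)) + z * (σ e1 * (k * σ e0))) +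
        (ω0 * ω0 + σ e0 * σ e0) * (z * (σ e1 * (k * σ e1)))) /
        ((ω0 * ω0 + σ e0 * σ e0) * (ω1 * ω1 + σ e1 * σ e1) - (ω0 * ω1 + σ e0 * σ e1) ^ 2)) +
        z * C / z = _
      rw [hdet', mul_div_cancel_left₀ C hzpos.ne',
        show (ω1 * ω1 + σ e1 * σ e1) * (z * (σ e0 * (k * σ e0))) -
        (ω0 * ω1 + σ e0 * σ e1) * (z * (σ e0 * (k * σ e1)) + z * (σ e1 * (k * σ e0))) +
        (ω0 * ω0 + σ e0 * σ e0) * (z * (σ e1 * (k * σ e1))) =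
        z * k * (ω0 * σ e1 - ω1 * σ e0) ^ 2 by ring,
        mul_div_cancel_right₀ _ (pow_ne_zero 2 hdet)]
      ring
    · rw [hpd0, hpd1, hmetric, hmetric, hmetric]
      change (ω0 * ω0 + σ e0 * σ e0) * (ω1 * ω1 + σ e1 * σ e1) -
        (ω0 * ω1 + σ e0 * σ e1) ^ 2 ≠ 0
      rw [hdet']
      exact pow_ne_zero 2 hdet

end IsRuledPatch

/-! ### Surfaces with horizontal rulings: reduction to a plane curve -/

section frame

variable {M : Type u} [TopologicalSpace M] [ChartedSpace E2 M]

/-- A property that propagates in balls of charts holds everywhere on a connected surface. -/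
lemma forall_of_chart_ball [ConnectedSpace M] {P : M → Prop}
    (h : ∀ (m : M) (r : ℝ), Metric.ball (chartAt E2 m m) r ⊆ (chartAt E2 m).target →
      ∀ x ∈ Metric.ball (chartAt E2 m m) r, ∀ y ∈ Metric.ball (chartAt E2 m m) r,
      P ((chartAt E2 m).symm x) → P ((chartAt E2 m).symm y)) {m₀ : M} (h₀ : P m₀) (m : M) :
    P m := by
  have hloc : IsLocallyConstant P := by
    rw [IsLocallyConstant.iff_eventually_eq]
    intro m
    obtain ⟨r, hr, hball⟩ := Metric.isOpen_iff.1 (chartAt E2 m).open_target _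
      (mem_chart_target E2 m)
    have hcont : ContinuousAt (chartAt E2 m) m :=
      (chartAt E2 m).continuousAt (mem_chart_source E2 m)
    filter_upwards [chart_source_mem_nhds E2 m, hcont (Metric.ball_mem_nhds _ hr)] with y hy hyb
    have h1 := h m r hball _ hyb _ (Metric.mem_ball_self hr)
    have h2 := h m r hball _ (Metric.mem_ball_self hr) _ hyb
    rw [(chartAt E2 m).left_inv hy, (chartAt E2 m).left_inv (mem_chart_source E2 m)] at h1 h2
    exact propext ⟨h1, h2⟩
  rw [hloc.apply_eq_of_preconnectedSpace m m₀]
  exact h₀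

lemma eq_of_hasFDerivAt_zero [ConnectedSpace M] {f : M → ℝ}
    (h : ∀ m, ∀ x ∈ (chartAt E2 m).target, HasFDerivAt (f ∘ (chartAt E2 m).symm) (0 : E2 →L[ℝ] ℝ) x)
    (p q : M) : f p = f q := by
  refine forall_of_chart_ball (P := fun p => f p = f q) (fun m r hball x hx y hy hxq => ?_) rfl p
  have h1 : (f ∘ (chartAt E2 m).symm) y = (f ∘ (chartAt E2 m).symm) x :=
    (convex_ball _ r).is_const_of_fderivWithin_eq_zero
      (fun z hz => (h m z (hball hz)).differentiableAt.differentiableWithinAt)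
      (fun z hz => by
        rw [fderivWithin_of_isOpen Metric.isOpen_ball hz]
        exact (h m z (hball hz)).fderiv) hy hx
  exact h1.trans hxq

/-- The functions `A`, `Z` are locally the coordinates of a regular plane curve with tangent
`(C, S)` and curvature `K`. -/
structure IsGeneratingFrame (A Z C S K : M → ℝ) : Prop where
  smooth : ContMDiff (𝓡 2) 𝓘(ℝ, ℝ) ∞ A
  sq_add_sq : ∀ p, C p ^ 2 + S p ^ 2 = 1
  exists_deriv : ∀ m, ∀ x ∈ (chartAt E2 m).target, ∃ σ : E2 →L[ℝ] ℝ, σ ≠ 0 ∧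
    HasFDerivAt (A ∘ (chartAt E2 m).symm) (C ((chartAt E2 m).symm x) • σ) x ∧
    HasFDerivAt (Z ∘ (chartAt E2 m).symm) (S ((chartAt E2 m).symm x) • σ) x ∧
    HasFDerivAt (C ∘ (chartAt E2 m).symm)
      ((-(K ((chartAt E2 m).symm x) * S ((chartAt E2 m).symm x))) • σ) x ∧
    HasFDerivAt (S ∘ (chartAt E2 m).symm)
      ((K ((chartAt E2 m).symm x) * C ((chartAt E2 m).symm x)) • σ) x

namespace IsGeneratingFrame

variable [ConnectedSpace M] {A Z C S K : M → ℝ}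

lemma eq_of_forall_eq_zero (h : IsGeneratingFrame A Z C S K) (hC : ∀ p, C p = 0) (p q : M) :
    A p = A q := by
  refine eq_of_hasFDerivAt_zero (fun m x hx => ?_) p q
  obtain ⟨σ, -, hA, -⟩ := h.exists_deriv m x hx
  simpa [hC] using hA

/-- This is the conservation law of the generating curves, now on the surface: the logarithmic
derivatives of `C` and of `weight Z` are both `2 (Z - 1) S σ / Z²`, and the formulation with `C`
itself also covers `C = 0`. -/
lemma div_weight_eq (h : IsGeneratingFrame A Z C S fun p => 2 * C p * (1 - Z p) / Z p ^ 2)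
    (hZ : ∀ p, 0 < Z p) (p q : M) : C p / weight (Z p) = C q / weight (Z q) := by
  refine eq_of_hasFDerivAt_zero (f := fun p => C p / weight (Z p)) (fun m x hx => ?_) p q
  obtain ⟨σ, -, -, hdZ, hdC, -⟩ := h.exists_deriv m x hx
  have hz := hZ ((chartAt E2 m).symm x)
  have hw := weight_pos hz
  have h1 := (hasDerivAt_weight hz.ne').comp_hasFDerivAt x hdZ
  have h2 := (hdC.mul ((hasDerivAt_inv hw.ne').comp_hasFDerivAt x h1)).congr_fderiv
    (g' := 0) (by
      ext1 ξ
      simp only [Function.comp, add_apply, smul_apply, smul_eq_mul, zero_apply]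
      field_simp
      ring)
  simpa only [Function.comp_def, div_eq_mul_inv] using! h2

lemma eq_profile [IsManifold (𝓡 2) ∞ M]
    (h : IsGeneratingFrame A Z C S fun p => 2 * C p * (1 - Z p) / Z p ^ 2)
    (hZ : ∀ p, 0 < Z p) (hC : ∀ p, C p ≠ 0) {z₀ : ℝ} (hz₀ : z₀ ∈ Ioo (0 : ℝ) 1)
    (hw : ∀ p, weight (Z p) = |C p| * weight z₀) : ∃ c, ∀ p, Z p = profile z₀ (A p - c) := by
  have hu := isProfile_profile hz₀
  have hen : ∀ p, (1 + (S p / C p) ^ 2) * weight (Z p) ^ 2 = weight z₀ ^ 2 := by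
    intro p
    have := hC p
    rw [hw, mul_pow, sq_abs]
    field_simp
    linear_combination weight z₀ ^ 2 * h.sq_add_sq p
  obtain ⟨m₀⟩ : Nonempty M := inferInstance
  -- The height determines a point of the rising half of the profile, and the energy determines the
  -- slope up to sign; evenness corrects the sign by passing to `-x`.
  obtain ⟨x₀, hx₀, hp₀⟩ : ∃ x₀, Z m₀ = profile z₀ x₀ ∧
      S m₀ / C m₀ = deriv (profile z₀) x₀ := by
    have hmem : Z m₀ ∈ Icc z₀ (topHeight z₀) := by
      rw [← weight_le_iff hz₀ (hZ m₀), hw]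
      have := weight_pos hz₀.1
      have h1 : |C m₀| ≤ 1 := abs_le_one_iff_mul_self_le_one.2 (by
        nlinarith [h.sq_add_sq m₀, sq_nonneg (S m₀)])
      nlinarith
    obtain ⟨x, -, hx⟩ := surjOn_profile hz₀ hmem
    have h1 := hen m₀
    have h2 := hu.energy x
    rw [hx, ← h1] at h2
    have h3 := mul_right_cancel₀ (pow_ne_zero 2 (weight_pos (hZ m₀)).ne') h2
    rcases sq_eq_sq_iff_eq_or_eq_neg.1 (add_left_cancel h3) with h4 | h4
    · exact ⟨x, hx.symm, h4.symm⟩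
    · exact ⟨-x, by rw [(hu.even hz₀ x).1, hx], by rw [(hu.even hz₀ x).2, h4, neg_neg]⟩
  refine ⟨A m₀ - x₀, fun p => ?_⟩
  -- Height and slope are propagated together, since the profile equation is of second order. Within
  -- a chart ball they are compared along segments, with `A` as the possibly non-monotone parameter.
  refine (forall_of_chart_ball (P := fun p => Z p = profile z₀ (A p - (A m₀ - x₀)) ∧
    S p / C p = deriv (profile z₀) (A p - (A m₀ - x₀))) (fun m r hball x hx y hy hxP => ?_)
    (m₀ := m₀) (by rw [sub_sub_cancel]; exact ⟨hx₀, hp₀⟩) p).1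
  set e := chartAt E2 m with he
  set c := A m₀ - x₀
  have hγ : ∀ t ∈ Icc (0 : ℝ) 1, x + t • (y - x) ∈ e.target := fun t ht =>
    hball ((convex_ball _ r).add_smul_sub_mem hx hy ht)
  have hγd : ∀ t : ℝ, HasDerivAt (fun t : ℝ => x + t • (y - x)) (y - x) t := fun t => by
    simpa using ((hasDerivAt_id t).smul_const (y - x)).const_add x
  have hAs := contDiffOn_comp_chart_symm h.smooth m
  have key := hu.eq_of_reparam hz₀ (a := fun t => A (e.symm (x + t • (y - x))) - c)
    (a' := fun t => fderiv ℝ (A ∘ e.symm) (x + t • (y - x)) (y - x))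
    (Z := fun t => Z (e.symm (x + t • (y - x))))
    (q := fun t => S (e.symm (x + t • (y - x))) / C (e.symm (x + t • (y - x))))
    ?_ ?_ ?_ ?_ ?_ ?_ ?_ ?_
  · simpa using key
  · refine ContinuousOn.clm_apply ?_ continuousOn_const
    exact (hAs.continuousOn_fderiv_of_isOpen e.open_target (by norm_num)).comp
      (by fun_prop) hγ
  · intro t ht
    have h1 := ((hAs.contDiffAt (e.open_target.mem_nhds (hγ t ht))).differentiableAt
      (by norm_num)).hasFDerivAt
    exact (h1.comp_hasDerivAt t (hγd t)).sub_const c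
  · intro t ht
    obtain ⟨σ, -, hdA, hdZ, -⟩ := h.exists_deriv m _ (hγ t ht)
    refine (hdZ.comp_hasDerivAt t (hγd t)).congr_deriv ?_
    rw [hdA.fderiv]
    have := hC (e.symm (x + t • (y - x)))
    simp only [smul_apply, smul_eq_mul, ← he]
    field_simp
  · intro t ht
    obtain ⟨σ, -, hdA, hdZ, hdC, hdS⟩ := h.exists_deriv m _ (hγ t ht)
    have hC0 := hC (e.symm (x + t • (y - x)))
    have hZ0 := hZ (e.symm (x + t • (y - x)))
    have h1 := hdS.comp_hasDerivAt t (hγd t)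
    have h2 := hdC.comp_hasDerivAt t (hγd t)
    refine (h1.div h2 hC0).congr_deriv ?_
    rw [hdA.fderiv]
    simp only [smul_apply, smul_eq_mul, Function.comp, ← he]
    field_simp
    ring
  · exact fun t ht => hZ _
  · exact fun t ht => hen _
  · simpa using hxP.1
  · simpa using hxP.2

/-- The generating curve of a horo-shrinker with horizontal rulings. -/
lemma classification [IsManifold (𝓡 2) ∞ M]
    (h : IsGeneratingFrame A Z C S fun p => 2 * C p * (1 - Z p) / Z p ^ 2)
    (hZ : ∀ p, 0 < Z p) : (∃ c, ∀ p, A p = c) ∨ (∀ p, Z p = 1) ∨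
      ∃ z₀ ∈ Ioo (0 : ℝ) 1, ∃ c, ∀ p, Z p = profile z₀ (A p - c) := by
  obtain ⟨m₀⟩ : Nonempty M := inferInstance
  have hc := fun p => h.div_weight_eq hZ p m₀
  set b := C m₀ / weight (Z m₀) with hb
  have hCb : ∀ p, C p = b * weight (Z p) := fun p => by
    rw [← hc p, div_mul_cancel₀ _ (weight_pos (hZ p)).ne']
  by_cases hb0 : b = 0
  · exact Or.inl ⟨A m₀, fun p => h.eq_of_forall_eq_zero (fun p => by rw [hCb, hb0, zero_mul]) p m₀⟩
  have hbpos : 0 < |b| := abs_pos.2 hb0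
  have hwC : ∀ p, weight (Z p) = |C p| * |b|⁻¹ := fun p => by
    rw [hCb p, abs_mul, abs_of_pos (weight_pos (hZ p))]
    field_simp
  have hC1 : ∀ p, |C p| ≤ 1 := fun p => abs_le_one_iff_mul_self_le_one.2 (by
    nlinarith [h.sq_add_sq p, sq_nonneg (S p)])
  -- As `|C| ≤ 1`, the number `|b|⁻¹` bounds `weight Z` from above. If it is at most the minimum of
  -- the weight, the height is 1; otherwise it equals `weight z₀` for some `z₀ < 1`.
  rcases le_or_gt |b|⁻¹ (weight 1) with hle | hlt
  · refine Or.inr (Or.inl fun p => eq_one_of_weight_le (hZ p) ?_)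
    rw [hwC]
    have := inv_pos.2 hbpos
    nlinarith [hC1 p]
  · obtain ⟨z₀, hz₀, hzb⟩ := exists_weight_eq_of_lt_one hlt
    refine Or.inr (Or.inr ⟨z₀, hz₀, h.eq_profile hZ (fun p => ?_) hz₀ fun p => by rw [hzb, hwC]⟩)
    rw [hCb]
    exact mul_ne_zero hb0 (weight_pos (hZ p)).ne'

end IsGeneratingFrame

/-- The generating frame of an immersion that is invariant under horizontal translations. -/
lemma isGeneratingFrame_of_invariant [IsManifold (𝓡 2) ∞ M] [SecondCountableTopology M]
    {Y N : M → E3} {H : M → ℝ} (hpos : ∀ p, 0 < Y p 2)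
    (hY : ContMDiff (𝓡 2) 𝓘(ℝ, E3) ∞ Y)
    (hinj : ∀ p, Function.Injective (mfderiv (𝓡 2) 𝓘(ℝ, E3) Y p))
    (hN : ContMDiff (𝓡 2) 𝓘(ℝ, E3) ∞ N) (hunit : ∀ p, hypInner (Y p) (N p) (N p) = 1)
    (hnormal : ∀ p (w : TangentSpace (𝓡 2) p),
      hypInner (Y p) (mfderiv (𝓡 2) 𝓘(ℝ, E3) Y p w) (N p) = 0)
    (hH : ∀ m, ∀ x ∈ (chartAt E2 m).target, meanCurvature (Y ∘ (chartAt E2 m).symm) x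
      (N ((chartAt E2 m).symm x)) = H ((chartAt E2 m).symm x))
    {v w : E3} (hF : IsHorizontalFrame v w) (hinv : ∀ t : ℝ, ∀ q ∈ range Y, q + t • v ∈ range Y) :
    IsGeneratingFrame (fun p => (inner ℝ w (Y p) : ℝ)) (fun p => Y p 2) (fun p => N p 2 / Y p 2)
      (fun p => -inner ℝ w (N p) / Y p 2)
      (fun p => (2 * H p - 2 * (N p 2 / Y p 2)) / Y p 2) := by
  have hpatch : ∀ m, IsRuledPatch v (chartAt E2 m).target (Y ∘ (chartAt E2 m).symm)
      ((fun p => (Y p 2)⁻¹ • N p) ∘ (chartAt E2 m).symm) := by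
    intro m
    have hYs := contDiffOn_comp_chart_symm hY m
    have hNs := contDiffOn_comp_chart_symm hN m
    refine ⟨(chartAt E2 m).open_target, hYs, ?_, fun x _ => hpos _,
      fun x hx => injective_fderiv_comp_chart_symm hY hinj m hx, fun x _ => ?_, fun x hx ξ => ?_,
      fun x hx => exists_fderiv_eq_of_invariant hY hinj hinv m hx⟩
    · have h2 : ContDiffOn ℝ ∞ (fun x => (Y ((chartAt E2 m).symm x)) 2) (chartAt E2 m).target :=
        (EuclideanSpace.proj (𝕜 := ℝ) (2 : Fin 3)).contDiff.comp_contDiffOn hYs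
      exact (h2.inv fun x _ => (hpos _).ne').smul hNs
    · have h1 := hunit ((chartAt E2 m).symm x)
      have h2 := hpos ((chartAt E2 m).symm x)
      simp only [hypInner] at h1
      simp only [Function.comp, inner_smul_left, inner_smul_right, map_inv₀, conj_trivial]
      field_simp at h1 ⊢
      exact h1
    · have h2 := hpos ((chartAt E2 m).symm x)
      have h1 := hnormal ((chartAt E2 m).symm x) (mfderiv (𝓡 2) (𝓡 2) (chartAt E2 m).symm x ξ)
      rw [← fderiv_comp_chart_symm hY m hx, hypInner, div_eq_zero_iff] at h1
      rw [Function.comp_apply, inner_smul_right, h1.resolve_right (pow_ne_zero 2 h2.ne'), mul_zero]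
  have hC : ∀ p, ((Y p 2)⁻¹ • N p) 2 = N p 2 / Y p 2 := fun p => by
    rw [PiLp.smul_apply, smul_eq_mul, inv_mul_eq_div]
  have hS : ∀ p, -(inner ℝ w ((Y p 2)⁻¹ • N p) : ℝ) = -inner ℝ w (N p) / Y p 2 := fun p => by
    rw [inner_smul_right, neg_div, inv_mul_eq_div]
  refine ⟨(innerSL ℝ w).contDiff.contMDiff.comp hY, fun p => ?_, fun m x hx => ?_⟩
  · have h1 := (hpatch p).sq_add_sq hF (mem_chart_target E2 p)
    simp only [Function.comp, (chartAt E2 p).left_inv (mem_chart_source E2 p)] at h1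
    rw [← hC, ← hS, neg_sq]
    exact h1
  · obtain ⟨σ, k, hσ, h1, h2, h3, h4, h5⟩ := (hpatch m).exists_structure hF hx
    have hz := hpos ((chartAt E2 m).symm x)
    have hk : k = (2 * H ((chartAt E2 m).symm x) - 2 * (N ((chartAt E2 m).symm x) 2 /
        Y ((chartAt E2 m).symm x) 2)) / Y ((chartAt E2 m).symm x) 2 := by
      simp only [Function.comp, hC, smul_smul, mul_inv_cancel₀ hz.ne', one_smul, hH m x hx] at h5
      rw [h5]
      field_simp
      ring
    beta_reduce
    rw [← hk]
    simp only [← hS, ← hC]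
    refine ⟨σ, hσ, h1, h2, ?_, h4⟩
    rw [mul_neg, neg_neg]
    exact h3

end frame

/-- Horo-shrinkers invariant under horizontal translations lie on the model surfaces. -/
lemma IsHoroShrinker.classification {M : Type u} [TopologicalSpace M] [ChartedSpace E2 M]
    [IsManifold (𝓡 2) ∞ M] [SecondCountableTopology M] [ConnectedSpace M] {Ψ : M → E3}
    (hΨ : IsHoroShrinker Ψ) {v w : E3} (hF : IsHorizontalFrame v w)
    (hinv : ∀ t : ℝ, ∀ q ∈ range Ψ, q + t • v ∈ range Ψ) :
    (∃ c, ∀ p, (inner ℝ w (Ψ p) : ℝ) = c) ∨ (∀ p, Ψ p 2 = 1) ∨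
      ∃ z₀ ∈ Ioo (0 : ℝ) 1, ∃ c, ∀ p, Ψ p 2 = profile z₀ (inner ℝ w (Ψ p) - c) := by
  obtain ⟨hpos, hs, hinj, N, hN, hunit, hnormal, hH⟩ := hΨ
  have h := isGeneratingFrame_of_invariant hpos hs hinj hN hunit hnormal
    (H := fun p => hypInner (Ψ p) (N p) dz) (fun m x hx => by
      have := hH _ (chart_mem_atlas E2 m) _ ((chartAt E2 m).map_target hx)
      rwa [(chartAt E2 m).right_inv hx] at this) hF hinv
  refine IsGeneratingFrame.classification (A := fun p => (inner ℝ w (Ψ p) : ℝ)) ?_ hpos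
    (C := fun p => N p 2 / Ψ p 2) (S := fun p => -inner ℝ w (N p) / Ψ p 2)
  convert h using 2 with p
  have := (hpos p : 0 < Ψ p 2)
  rw [hypInner, inner_dz_right]
  field_simp

/-! ### Lifting segments to complete surfaces -/

/-- A path has a lift through a local homeomorphism, provided that partial lifts have limits. -/
lemma exists_lift_of_tendsto {X Y : Type*} [TopologicalSpace X] [T2Space X] [TopologicalSpace Y]
    [T2Space Y] {Q : X → Y} (hQ : IsLocalHomeomorph Q) {ℓ : ℝ → Y} (hℓ : Continuous ℓ) {m₀ : X}
    (h₀ : Q m₀ = ℓ 0) (hlim : ∀ T ∈ Ioc (0 : ℝ) 1, ∀ γ : ℝ → X, ContinuousOn γ (Ico 0 T) →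
      (∀ t ∈ Ico 0 T, Q (γ t) = ℓ t) → ∃ p, Tendsto γ (𝓝[<] T) (𝓝 p)) : ∃ p, Q p = ℓ 1 := by
  set P : Set ℝ := {T | ∃ γ : ℝ → X, γ 0 = m₀ ∧ ContinuousOn γ (Icc 0 T) ∧
    ∀ t ∈ Icc 0 T, Q (γ t) = ℓ t} with hP
  have hmono : ∀ T ∈ P, ∀ T' ≤ T, T' ∈ P := by
    rintro T ⟨γ, h0, hc, hl⟩ T' hT'
    exact ⟨γ, h0, hc.mono (Icc_subset_Icc_right hT'), fun t ht => hl t ⟨ht.1, ht.2.trans hT'⟩⟩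
  have hP0 : (0 : ℝ) ∈ P := ⟨fun _ => m₀, rfl, continuousOn_const, fun t ht => by
    rw [le_antisymm ht.2 ht.1, h₀]⟩
  have hext : ∀ T ∈ P, ∀ y, T < y → (P ∩ Ioc T y).Nonempty := by
    rintro T ⟨γ, h0, hc, hl⟩ y hy
    rcases lt_or_ge T 0 with hT | hT
    · exact ⟨min 0 y, hmono 0 hP0 _ (min_le_left _ _), lt_min hT hy, min_le_right _ _⟩
    obtain ⟨e, he, rfl⟩ := hQ (γ T)
    have hT' : T ∈ Icc 0 T := right_mem_Icc.2 hT
    have htgt : ℓ ⁻¹' e.target ∈ 𝓝 T := by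
      refine hℓ.continuousAt (e.open_target.mem_nhds ?_)
      rw [← hl T hT']
      exact e.map_source he
    obtain ⟨ε, hε, hball⟩ := Metric.mem_nhds_iff.1 htgt
    -- The local inverse of `Q` at the endpoint continues the lift past `T`, as long as the path
    -- stays in its target.
    set T' := min y (T + ε / 2) with hT'def
    have hTT' : T < T' := lt_min hy (by linarith)
    have hsub : ∀ t ∈ Icc T T', ℓ t ∈ e.target := fun t ht => hball (by
      rw [Metric.mem_ball, Real.dist_eq, abs_of_nonneg (by linarith [ht.1])]
      linarith [ht.2, min_le_right y (T + ε / 2)])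
    set γ' : ℝ → X := fun t => if t ≤ T then γ t else e.symm (ℓ t) with hγ'
    have hγ1 : EqOn γ' γ (Icc 0 T) := fun t ht => if_pos ht.2
    have hγ2 : EqOn γ' (e.symm ∘ ℓ) (Icc T T') := by
      intro t ht
      rcases ht.1.eq_or_lt with rfl | h
      · simp only [hγ', le_refl, if_true, Function.comp]
        rw [← hl _ hT', e.left_inv he]
      · exact if_neg h.not_ge
    refine ⟨T', ⟨γ', by simp [hγ', hT, h0], ?_, fun t ht => ?_⟩, hTT', min_le_left _ _⟩
    · rw [← Icc_union_Icc_eq_Icc hT hTT'.le]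
      exact (hc.congr hγ1).union_of_isClosed
        ((e.continuousOn_symm.comp hℓ.continuousOn hsub).congr hγ2) isClosed_Icc isClosed_Icc
    · rcases le_or_gt t T with h | h
      · rw [hγ1 ⟨ht.1, h⟩, hl t ⟨ht.1, h⟩]
      · rw [hγ2 ⟨h.le, ht.2⟩]
        exact e.right_inv (hsub t ⟨h.le, ht.2⟩)
  have hcl : IsClosed (P ∩ Icc 0 1) := by
    refine isClosed_of_closure_subset fun T hT => ?_
    have hT01 : T ∈ Icc (0 : ℝ) 1 := closure_minimal inter_subset_right isClosed_Icc hT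
    refine ⟨?_, hT01⟩
    by_contra hTP
    have hlt : ∀ t < T, t ∈ P := by
      intro t ht
      obtain ⟨s, hs, hsP⟩ := mem_closure_iff.1 hT (Ioi t) isOpen_Ioi ht
      exact hmono s hsP.1 t (le_of_lt hs)
    have hTpos : 0 < T := hT01.1.lt_of_ne (by rintro rfl; exact hTP hP0)
    have : Nonempty X := ⟨m₀⟩
    -- Each time below `T` has its own lift. Lifts with the same start agree on common intervals, so
    -- the diagonal `t ↦ L t t` is a lift on `[0, T)`.
    choose! L hL0 hLc hLl using hlt
    have heq : ∀ s < T, 0 ≤ s → EqOn (fun t => L t t) (L s) (Icc 0 s) := by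
      intro s hs hs0 t ht
      have hts : t < T := ht.2.trans_lt hs
      exact (T2Space.isSeparatedMap Q).eqOn_of_comp_eqOn hQ.isLocallyInjective
        (isPreconnected_Icc (a := (0 : ℝ)) (b := t)) (hLc t hts)
        ((hLc s hs).mono (Icc_subset_Icc_right ht.2))
        (fun r hr => (hLl t hts r hr).trans (hLl s hs r ⟨hr.1, hr.2.trans ht.2⟩).symm)
        (left_mem_Icc.2 ht.1) ((hL0 t hts).trans (hL0 s hs).symm) (right_mem_Icc.2 ht.1)
    have hγl : ∀ t ∈ Ico 0 T, Q (L t t) = ℓ t := fun t ht => hLl t ht.2 t (right_mem_Icc.2 ht.1)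
    have hγc : ContinuousOn (fun t => L t t) (Ico 0 T) := by
      intro t ht
      obtain ⟨s, hts, hsT⟩ := exists_between ht.2
      have h1 : ContinuousWithinAt (fun t => L t t) (Icc 0 s) t :=
        ((hLc s hsT).congr (heq s hsT (ht.1.trans hts.le))) t ⟨ht.1, hts.le⟩
      refine h1.mono_of_mem_nhdsWithin ?_
      filter_upwards [self_mem_nhdsWithin, nhdsWithin_le_nhds (Iio_mem_nhds hts)] with r hr hr'
      exact ⟨hr.1, le_of_lt hr'⟩
    obtain ⟨p, hp⟩ := hlim T ⟨hTpos, hT01.2⟩ _ hγc hγl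
    have hQp : Q p = ℓ T := by
      have h1 : Tendsto (fun t => Q (L t t)) (𝓝[<] T) (𝓝 (Q p)) :=
        (hQ.continuous.tendsto p).comp hp
      have h2 : Tendsto ℓ (𝓝[<] T) (𝓝 (ℓ T)) := (hℓ.tendsto T).mono_left nhdsWithin_le_nhds
      refine tendsto_nhds_unique (h1.congr' ?_) h2
      filter_upwards [Ioo_mem_nhdsLT hTpos] with t ht using hγl t ⟨ht.1.le, ht.2⟩
    refine hTP ⟨Function.update (fun t => L t t) T p, ?_, ?_, fun t ht => ?_⟩
    · rw [Function.update_of_ne hTpos.ne]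
      exact hL0 0 hTpos
    · rw [continuousOn_update_iff, Icc_sdiff_right]
      exact ⟨hγc, fun _ => hp.mono_left (nhdsWithin_mono _ fun t ht => ht.2)⟩
    · rcases eq_or_ne t T with rfl | h
      · rw [Function.update_self, hQp]
      · rw [Function.update_of_ne h]
        exact hγl t ⟨ht.1, ht.2.lt_of_ne h⟩
  obtain ⟨γ, -, -, hl⟩ : (1 : ℝ) ∈ P :=
    hcl.Icc_subset_of_forall_exists_gt hP0 (fun T hT y hy => hext T hT.1 y hy)
      (right_mem_Icc.2 zero_le_one)
  exact ⟨γ 1, hl 1 (right_mem_Icc.2 zero_le_one)⟩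

section complete

variable {M : Type u} [TopologicalSpace M] [ChartedSpace E2 M] [IsManifold (𝓡 2) ∞ M]

/-- The inverse function theorem for maps of a surface to the plane. -/
lemma exists_openPartialHomeomorph {Q : M → E2} (hQ : ContMDiff (𝓡 2) 𝓘(ℝ, E2) ∞ Q)
    (hinj : ∀ p, Function.Injective (mfderiv (𝓡 2) 𝓘(ℝ, E2) Q p)) (m : M) :
    ∃ e : OpenPartialHomeomorph M E2, m ∈ e.source ∧ EqOn Q e e.source ∧
      ContMDiffOn 𝓘(ℝ, E2) (𝓡 2) 1 e.symm e.target := by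
  set c := chartAt E2 m with hc
  set X := Q ∘ c.symm with hX
  have hXs : ContDiffOn ℝ ∞ X c.target := contDiffOn_comp_chart_symm hQ m
  have hequiv : ∀ x ∈ c.target, ∃ f : E2 ≃L[ℝ] E2, HasFDerivAt X (f : E2 →L[ℝ] E2) x := by
    intro x hx
    have h1 := injective_fderiv_comp_chart_symm hQ hinj m hx
    refine ⟨(LinearEquiv.ofInjectiveEndo (fderiv ℝ X x).toLinearMap h1).toContinuousLinearEquiv, ?_⟩
    refine (((hXs.contDiffAt (c.open_target.mem_nhds hx)).differentiableAt
      (by norm_num)).hasFDerivAt).congr_fderiv ?_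
    ext1 ξ
    rfl
  have hm := mem_chart_target E2 m
  obtain ⟨f, hf⟩ := hequiv _ hm
  have hXm : ContDiffAt ℝ ∞ X (c m) := hXs.contDiffAt (c.open_target.mem_nhds hm)
  set g := hXm.toOpenPartialHomeomorph X hf (by norm_num) with hg
  have hgX : ∀ x, g x = X x := fun x => rfl
  have hmg : c m ∈ g.source := hXm.mem_toOpenPartialHomeomorph_source hf (by norm_num)
  refine ⟨c.trans g, ?_, fun p hp => ?_, ?_⟩
  · rw [OpenPartialHomeomorph.trans_source]
    exact ⟨mem_chart_source E2 m, hmg⟩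
  · rw [OpenPartialHomeomorph.trans_source] at hp
    rw [OpenPartialHomeomorph.coe_trans, Function.comp_apply, hgX, hX, Function.comp_apply,
      c.left_inv hp.1]
  · rw [OpenPartialHomeomorph.trans_target]
    have h1 : ContMDiffOn 𝓘(ℝ, E2) 𝓘(ℝ, E2) 1 g.symm (g.target ∩ g.symm ⁻¹' c.target) := by
      rw [contMDiffOn_iff_contDiffOn]
      intro y hy
      obtain ⟨f', hf'⟩ := hequiv _ hy.2
      exact (g.contDiffAt_symm hy.1 hf' ((hXs.contDiffAt (c.open_target.mem_nhds hy.2)).of_le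
        (by norm_num))).contDiffWithinAt
    have : IsManifold (𝓡 2) 1 M := isManifold_one
    exact (contMDiffOn_chart_symm (I := 𝓡 2) (n := 1) (x := m)).comp h1 fun y hy => hy.2

/-- A complete surface `Ψ₀ ∘ Q` covers the whole surface `Ψ₀`. -/
lemma surjective_of_isCompleteImmersion [T2Space M] [Nonempty M] {Ψ : M → E3} {Ψ₀ : E2 → E3}
    {Q : M → E2} (hcomp : IsCompleteImmersion Ψ) (hQ : ContMDiff (𝓡 2) 𝓘(ℝ, E2) ∞ Q)
    (hΨ : ∀ p, Ψ p = Ψ₀ (Q p)) (hΨ₀ : ContDiff ℝ ∞ Ψ₀) (hpos : ∀ x, 0 < Ψ₀ x 2)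
    (hinj : ∀ p, Function.Injective (mfderiv (𝓡 2) 𝓘(ℝ, E3) Ψ p)) : Function.Surjective Q := by
  have hinjQ : ∀ p, Function.Injective (mfderiv (𝓡 2) 𝓘(ℝ, E2) Q p) := by
    intro p
    have h1 : mfderiv (𝓡 2) 𝓘(ℝ, E3) Ψ p =
        (mfderiv 𝓘(ℝ, E2) 𝓘(ℝ, E3) Ψ₀ (Q p)).comp (mfderiv (𝓡 2) 𝓘(ℝ, E2) Q p) := by
      rw [show Ψ = Ψ₀ ∘ Q from funext hΨ]
      exact mfderiv_comp p (hΨ₀.contMDiff.mdifferentiableAt (by norm_num))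
        (hQ.mdifferentiableAt (by norm_num))
    intro a b hab
    refine hinj p ?_
    rw [h1]
    exact congrArg (mfderiv 𝓘(ℝ, E2) 𝓘(ℝ, E3) Ψ₀ (Q p)) hab
  choose e hme heq hsymm using exists_openPartialHomeomorph hQ hinjQ
  have hloc : IsLocalHomeomorph Q := IsLocalHomeomorph.mk Q fun m => ⟨e m, hme m, heq m⟩
  obtain ⟨m₀⟩ : Nonempty M := inferInstance
  intro q
  set ℓ : ℝ → E2 := fun t => Q m₀ + t • (q - Q m₀) with hℓ
  have hℓs : ContDiff ℝ ∞ ℓ := by fun_prop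
  -- The lift `γ` of a segment has the same image curve `Ψ₀ ∘ ℓ` in space, smooth on the closed
  -- interval. Its hyperbolic length is therefore finite, and completeness provides the limit.
  have key := exists_lift_of_tendsto hloc (ℓ := ℓ) hℓs.continuous (m₀ := m₀) (by simp [hℓ]) ?_
  · simpa [hℓ] using key
  intro T hT γ hγ hγl
  have hmaps : MapsTo (fun s => T * s) (Ico (0 : ℝ) 1) (Ico 0 T) := fun s hs =>
    ⟨mul_nonneg hT.1.le hs.1, by nlinarith [hs.2, hT.1]⟩
  have hγs : ContMDiffOn 𝓘(ℝ, ℝ) (𝓡 2) 1 γ (Ico 0 T) := by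
    intro t ht
    have h1 : ∀ᶠ s in 𝓝[Ico 0 T] t, γ s ∈ (e (γ t)).source :=
      hγ t ht ((e (γ t)).open_source.mem_nhds (hme _))
    have htgt : ℓ t ∈ (e (γ t)).target := by
      rw [← hγl t ht, heq _ (hme _)]
      exact (e (γ t)).map_source (hme _)
    have h2 : ContMDiffAt 𝓘(ℝ, ℝ) (𝓡 2) 1 ((e (γ t)).symm ∘ ℓ) t :=
      ((hsymm (γ t)).contMDiffAt ((e (γ t)).open_target.mem_nhds htgt)).comp t
        ((hℓs.of_le (by norm_num)).contMDiff t)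
    refine h2.contMDiffWithinAt.congr_of_eventuallyEq_of_mem ?_ ht
    filter_upwards [h1, self_mem_nhdsWithin] with s hs hs'
    rw [Function.comp_apply, ← hγl s hs', heq _ hs, (e (γ t)).left_inv hs]
  have hresc : ContDiff ℝ ∞ fun s : ℝ => T * s := by fun_prop
  set β : ℝ → E3 := fun s => Ψ₀ (ℓ (T * s)) with hβ
  have hβs : ContDiff ℝ ∞ β := hΨ₀.comp (hℓs.comp hresc)
  have hg : Continuous fun s => ‖deriv β s‖ / β s 2 := by
    have h1 : Continuous fun s => β s 2 :=
      (EuclideanSpace.proj (𝕜 := ℝ) (2 : Fin 3)).continuous.comp hβs.continuous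
    exact (hβs.continuous_deriv (by norm_num)).norm.div h1 fun s => (hpos _).ne'
  obtain ⟨B, hB⟩ := (isCompact_Icc (a := (0 : ℝ)) (b := 1)).bddAbove_image hg.continuousOn
  obtain ⟨p, hp⟩ := hcomp (fun s => γ (T * s))
    (hγs.comp ((hresc.of_le (by norm_num)).contMDiff.contMDiffOn) hmaps) (by
    -- At the endpoint 0 the two-sided derivative need not be that of the segment; the endpoint is a
    -- null set.
    rw [← setLIntegral_congr Ioo_ae_eq_Ico]
    have h1 : ∀ s ∈ Ioo (0 : ℝ) 1, ENNReal.ofReal (‖deriv (Ψ ∘ fun s => γ (T * s)) s‖ /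
        (Ψ (γ (T * s))) 2) ≤ ENNReal.ofReal B := by
      intro s hs
      have h2 : (Ψ ∘ fun s => γ (T * s)) =ᶠ[𝓝 s] β := by
        filter_upwards [Ioo_mem_nhds hs.1 hs.2] with r hr
        rw [Function.comp_apply, hΨ, hγl _ (hmaps ⟨hr.1.le, hr.2⟩)]
      rw [h2.deriv_eq, show Ψ (γ (T * s)) = β s from h2.eq_of_nhds]
      exact ENNReal.ofReal_le_ofReal (hB ⟨s, Ioo_subset_Icc_self hs, rfl⟩)
    refine (setLIntegral_mono measurable_const h1).trans_lt ?_
    simp)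
  refine ⟨p, ?_⟩
  have h1 : Tendsto (fun t => t / T) (𝓝[<] T) (𝓝[<] 1) := by
    refine tendsto_nhdsWithin_iff.2 ⟨?_, ?_⟩
    · have : Tendsto (fun t => t / T) (𝓝 T) (𝓝 (T / T)) :=
        (continuous_id.div_const T).tendsto T
      rw [div_self hT.1.ne'] at this
      exact this.mono_left nhdsWithin_le_nhds
    · filter_upwards [self_mem_nhdsWithin] with t ht using (div_lt_one hT.1).2 ht
  refine (hp.comp h1).congr fun t => ?_
  rw [Function.comp_apply, mul_div_cancel₀ _ hT.1.ne']

end complete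

/-! ### Complete ruled surfaces -/

lemma contMDiff_comp_of_mem_upperHalfSpace {M : Type u} [TopologicalSpace M] [ChartedSpace E2 M]
    {F : Type*} [NormedAddCommGroup F] [NormedSpace ℝ F]
    {Ψ : M → E3} {G : E3 → F} (hpos : ∀ p, Ψ p ∈ upperHalfSpace)
    (hs : ContMDiff (𝓡 2) 𝓘(ℝ, E3) ∞ Ψ) (hG : ∀ q ∈ upperHalfSpace, ContDiffAt ℝ ∞ G q) :
    ContMDiff (𝓡 2) 𝓘(ℝ, F) ∞ fun p => G (Ψ p) :=
  fun p => (hG _ (hpos p)).contMDiffAt.comp p (hs p)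

section ruled

variable {M : Type u} [TopologicalSpace M] [ChartedSpace E2 M] [IsManifold (𝓡 2) ∞ M]

/-- The function `s` recovers the profile parameter from a point of space, so `q ↦ (⟨v, q⟩, s q)`
factors `Ψ` through the ruled surface, and the lifting argument makes this factor surjective. -/
lemma range_eq_range_ruled [T2Space M] [Nonempty M] {Ψ : M → E3} (hcomp : IsCompleteImmersion Ψ)
    (hpos : ∀ p, Ψ p ∈ upperHalfSpace) (hs : ContMDiff (𝓡 2) 𝓘(ℝ, E3) ∞ Ψ)
    (hinj : ∀ p, Function.Injective (mfderiv (𝓡 2) 𝓘(ℝ, E3) Ψ p)) {v w : E3}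
    (hF : IsHorizontalFrame v w) {X Z : ℝ → ℝ} (hX : ContDiff ℝ ∞ X) (hZ : ContDiff ℝ ∞ Z)
    (hZpos : ∀ s, 0 < Z s) {s : E3 → ℝ} (hsm : ∀ q ∈ upperHalfSpace, ContDiffAt ℝ ∞ s q)
    (hw : ∀ p, (inner ℝ w (Ψ p) : ℝ) = X (s (Ψ p))) (h2 : ∀ p, Ψ p 2 = Z (s (Ψ p))) :
    range Ψ = range (ruled v w X Z) := by
  set G : E3 → E2 := fun q => !₂[(inner ℝ v q : ℝ), s q] with hG
  have hΨ : ∀ p, Ψ p = ruled v w X Z (G (Ψ p)) := fun p => hF.ext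
    (by rw [inner_v_ruled hF]; rfl) (by rw [inner_w_ruled hF]; exact hw p)
    (by rw [ruled_two hF]; exact h2 p)
  have hGs : ∀ q ∈ upperHalfSpace, ContDiffAt ℝ ∞ G q := fun q hq => by
    rw [contDiffAt_piLp]
    intro i
    fin_cases i
    · exact (innerSL ℝ v).contDiff.contDiffAt
    · exact hsm q hq
  have hsurj := surjective_of_isCompleteImmersion hcomp
    (contMDiff_comp_of_mem_upperHalfSpace hpos hs hGs) hΨ (contDiff_ruled hX hZ)
    (fun x => by rw [ruled_two hF]; exact hZpos _) hinj
  rw [← hsurj.range_comp]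
  exact congrArg range (funext hΨ)

lemma range_eq_verticalPlane [T2Space M] [Nonempty M] {Ψ : M → E3} (hΨ : IsHoroShrinker Ψ)
    (hcomp : IsCompleteImmersion Ψ) {v w : E3} (hF : IsHorizontalFrame v w) {c : ℝ}
    (h : ∀ p, (inner ℝ w (Ψ p) : ℝ) = c) : range Ψ = verticalPlane w c := by
  obtain ⟨hpos, hs, hinj, -⟩ := hΨ
  rw [← range_ruled_verticalPlane hF c]
  exact range_eq_range_ruled hcomp hpos hs hinj hF contDiff_const Real.contDiff_exp Real.exp_pos
    (s := fun q => Real.log (q 2))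
    (fun q hq => (EuclideanSpace.proj (𝕜 := ℝ) (2 : Fin 3)).contDiff.contDiffAt.log (ne_of_gt hq))
    h fun p => (Real.exp_log (hpos p)).symm

/-- Horo-shrinkers invariant under parabolic translations fixing `∞`. -/
lemma exists_model_of_invariant [T2Space M] [SecondCountableTopology M] [ConnectedSpace M]
    {Ψ : M → E3} (hΨ : IsHoroShrinker Ψ) {v : E3} (hv2 : v 2 = 0) (hv : v ≠ 0)
    (hinv : IsInvariantUnder Ψ (parabolicInfty v)) :
    ∃ S, IsGrimReaperModel v S ∧ range Ψ ⊆ S ∧ (IsCompleteImmersion Ψ → range Ψ = S) := by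
  obtain ⟨w, hw⟩ := exists_isHorizontalNormal hv2 hv
  have hF := hw.frame hv2 hv
  have hinner : ContDiff ℝ ∞ fun q : E3 => (inner ℝ w q : ℝ) := (innerSL ℝ w).contDiff
  have hinv' : ∀ t : ℝ, ∀ q ∈ range Ψ, q + t • (‖v‖⁻¹ • v) ∈ range Ψ := by
    intro t q hq
    rw [← hinv (t * ‖v‖⁻¹), smul_smul]
    exact ⟨q, hq, rfl⟩
  rcases hΨ.classification hF hinv' with ⟨c, h⟩ | h | ⟨z₀, hz₀, c, h⟩
  · refine ⟨verticalPlane w c, Or.inl ⟨w, c, hw, rfl⟩, ?_,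
      fun hc => range_eq_verticalPlane hΨ hc hF h⟩
    rintro _ ⟨p, rfl⟩
    exact ⟨hΨ.1 p, h p⟩
  · refine ⟨horosphereOne, Or.inr (Or.inl rfl), ?_, fun hc => ?_⟩
    · rintro _ ⟨p, rfl⟩
      exact h p
    · rw [← range_ruled_horosphereOne hF]
      exact range_eq_range_ruled hc hΨ.1 hΨ.2.1 hΨ.2.2.1 hF contDiff_id contDiff_const
        (fun _ => one_pos) (fun _ _ => hinner.contDiffAt) (fun p => rfl) h
  · rw [← forall_mem_range (p := fun q : E3 => q 2 = profile z₀ (inner ℝ w q - c))] at h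
    refine ⟨grimReaper w c z₀, Or.inr (Or.inr ⟨w, c, z₀, hw, hz₀, rfl⟩), fun q hq => ?_,
      fun hc => ?_⟩
    · rw [grimReaper, mem_ofPred_eq, (isProfile_profile hz₀).generatingCurve_eq hz₀]
      exact h q hq
    · rw [← range_ruled_grimReaper hF c hz₀]
      exact range_eq_range_ruled hc hΨ.1 hΨ.2.1 hΨ.2.2.1 hF (contDiff_id.add contDiff_const)
        (isProfile_profile hz₀).contDiff (isProfile_profile hz₀).pos
        (s := fun q => inner ℝ w q - c) (fun _ _ => (hinner.sub contDiff_const).contDiffAt)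
        (fun p => (sub_add_cancel _ _).symm) fun p => h _ ⟨p, rfl⟩

end ruled

/-! ### The inversion as an isometry of the hyperbolic space -/

/-- The derivative at the point `p + r` of the inversion in the unit sphere centred at `p`. -/
def inversionDeriv (r a : E3) : E3 :=
  (inner ℝ r r : ℝ)⁻¹ • a - (2 * inner ℝ r a * ((inner ℝ r r : ℝ)⁻¹) ^ 2) • r

/-- The derivative is `1 / |r|²` times the reflection in the hyperplane orthogonal to `r`. The
height is multiplied by the same factor, which makes the inversion a hyperbolic isometry. -/
lemma inner_inversionDeriv {r : E3} (hr : r ≠ 0) (a b : E3) :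
    (inner ℝ (inversionDeriv r a) (inversionDeriv r b) : ℝ) =
      ((inner ℝ r r : ℝ)⁻¹) ^ 2 * inner ℝ a b := by
  have h : (inner ℝ r r : ℝ) ≠ 0 := inner_self_ne_zero.2 hr
  simp only [inversionDeriv, inner_sub_left, inner_sub_right, inner_smul_left, inner_smul_right,
    conj_trivial, real_inner_comm r a]
  field_simp
  ring

section inversion

variable {p : E3}

lemma inversion_eq' (p q : E3) : EuclideanGeometry.inversion p 1 q =
    (inner ℝ (q - p) (q - p) : ℝ)⁻¹ • (q - p) + p := by
  rw [inversion_eq, real_inner_self_eq_norm_sq]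

lemma inversion_two' (hp : p 2 = 0) (q : E3) :
    EuclideanGeometry.inversion p 1 q 2 = (inner ℝ (q - p) (q - p) : ℝ)⁻¹ * q 2 := by
  rw [inversion_two hp, real_inner_self_eq_norm_sq]

lemma hypInner_inversion (hp : p 2 = 0) {q : E3} (hq : q ∈ upperHalfSpace) (a b : E3) :
    hypInner (EuclideanGeometry.inversion p 1 q) (inversionDeriv (q - p) a)
      (inversionDeriv (q - p) b) = hypInner q a b := by
  have hr := sub_ne_zero_of_mem_upperHalfSpace hp hq
  have h : (inner ℝ (q - p) (q - p) : ℝ) ≠ 0 := inner_self_ne_zero.2 hr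
  have hq' : q 2 ≠ 0 := ne_of_gt hq
  rw [hypInner, hypInner, inner_inversionDeriv hr, inversion_two' hp]
  field_simp

lemma contDiffAt_inversion (hp : p 2 = 0) {q : E3} (hq : q ∈ upperHalfSpace) :
    ContDiffAt ℝ ∞ (EuclideanGeometry.inversion p 1) q := by
  have h : (inner ℝ (q - p) (q - p) : ℝ) ≠ 0 :=
    inner_self_ne_zero.2 (sub_ne_zero_of_mem_upperHalfSpace hp hq)
  rw [show EuclideanGeometry.inversion p 1 = _ from funext (inversion_eq' p)]
  have h1 : ContDiffAt ℝ ∞ (fun q : E3 => q - p) q := contDiffAt_id.sub contDiffAt_const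
  exact (((h1.inner ℝ h1).inv h).smul h1).add contDiffAt_const

lemma hasDerivAt_inversion {γ : ℝ → E3} {γ' : E3} {t : ℝ} (hγ : HasDerivAt γ γ' t)
    (h : γ t - p ≠ 0) :
    HasDerivAt (fun t => EuclideanGeometry.inversion p 1 (γ t))
      (inversionDeriv (γ t - p) γ') t := by
  have h' : (inner ℝ (γ t - p) (γ t - p) : ℝ) ≠ 0 := inner_self_ne_zero.2 h
  simp only [inversion_eq']
  have h1 := hγ.sub_const p
  refine ((((h1.inner ℝ h1).inv h').smul h1).add_const p).congr_deriv ?_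
  rw [inversionDeriv, sub_eq_add_neg _ ((_ : ℝ) • (γ t - p)), ← neg_smul,
    real_inner_comm (γ t - p) γ', Pi.inv_apply]
  congr 2
  field_simp
  ring

lemma hasDerivAt_inversionDeriv {r a : ℝ → E3} {r' a' : E3} {t : ℝ} (hr : HasDerivAt r r' t)
    (ha : HasDerivAt a a' t) (h : r t ≠ 0) :
    HasDerivAt (fun t => inversionDeriv (r t) (a t))
      (inversionDeriv (r t) a' - (2 * inner ℝ (r t) r' * ((inner ℝ (r t) (r t) : ℝ)⁻¹) ^ 2) • a t -
        (2 * inner ℝ (r t) (a t) * ((inner ℝ (r t) (r t) : ℝ)⁻¹) ^ 2) • r' -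
        (2 * inner ℝ (a t) r' * ((inner ℝ (r t) (r t) : ℝ)⁻¹) ^ 2) • r t +
        (8 * inner ℝ (r t) (a t) * inner ℝ (r t) r' * ((inner ℝ (r t) (r t) : ℝ)⁻¹) ^ 3) • r t)
      t := by
  have h' : (inner ℝ (r t) (r t) : ℝ) ≠ 0 := inner_self_ne_zero.2 h
  have h1 := (hr.inner ℝ hr).inv h'
  refine ((h1.smul ha).sub ((((hr.inner ℝ ha).const_mul 2).mul (h1.pow 2)).smul hr)).congr_deriv ?_
  simp only [inversionDeriv, real_inner_comm (r t) r', real_inner_comm r' (a t), Pi.inv_apply,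
    Pi.mul_apply, Pi.pow_apply, Nat.add_one_sub_one, pow_one]
  ext i
  simp only [PiLp.add_apply, PiLp.sub_apply, PiLp.smul_apply, smul_eq_mul]
  generalize (inner ℝ (r t) (r t) : ℝ) = ρ at *
  field_simp
  ring

/-- The inversion preserves the Levi-Civita connection of the hyperbolic space. -/
lemma christoffel_inversion (hp : p 2 = 0) {q : E3} (hq : q ∈ upperHalfSpace) (a b d : E3) :
    inversionDeriv (q - p) d - (2 * inner ℝ (q - p) b * ((inner ℝ (q - p) (q - p) : ℝ)⁻¹) ^ 2) • a -
        (2 * inner ℝ (q - p) a * ((inner ℝ (q - p) (q - p) : ℝ)⁻¹) ^ 2) • b -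
        (2 * inner ℝ a b * ((inner ℝ (q - p) (q - p) : ℝ)⁻¹) ^ 2) • (q - p) +
        (8 * inner ℝ (q - p) a * inner ℝ (q - p) b * ((inner ℝ (q - p) (q - p) : ℝ)⁻¹) ^ 3) •
          (q - p) + christoffel (EuclideanGeometry.inversion p 1 q) (inversionDeriv (q - p) b)
            (inversionDeriv (q - p) a) =
      inversionDeriv (q - p) (d + christoffel q b a) := by
  have hr := sub_ne_zero_of_mem_upperHalfSpace hp hq
  have h : (inner ℝ (q - p) (q - p) : ℝ) ≠ 0 := inner_self_ne_zero.2 hr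
  have hq' : q 2 ≠ 0 := ne_of_gt hq
  have hr2 : (q - p) 2 = q 2 := by simp [hp]
  rw [christoffel, christoffel, inner_inversionDeriv hr, inversion_two' hp, real_inner_comm a b]
  generalize q - p = r at *
  ext i
  simp only [inversionDeriv, inner_sub_right, inner_add_right, inner_neg_right, inner_smul_right,
    inner_dz_right, PiLp.add_apply, PiLp.sub_apply, PiLp.smul_apply, PiLp.neg_apply, smul_eq_mul,
    hr2]
  generalize (inner ℝ r r : ℝ) = ρ at *
  field_simp
  ring

end inversion

/-! ### Invariance of the mean curvature under inversions -/

section meanCurvature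

variable {p : E3} {O : Set E2} {X : E2 → E3}

lemma contDiffOn_inversion (hp : p 2 = 0) (hX : ContDiffOn ℝ ∞ X O)
    (hpos : ∀ x ∈ O, X x ∈ upperHalfSpace) :
    ContDiffOn ℝ ∞ (fun x => EuclideanGeometry.inversion p 1 (X x)) O :=
  fun x hx => (contDiffAt_inversion hp (hpos x hx)).comp_contDiffWithinAt x (hX x hx)

lemma pd_inversion (hp : p 2 = 0) (hO : IsOpen O) (hX : ContDiffOn ℝ ∞ X O)
    (hpos : ∀ x ∈ O, X x ∈ upperHalfSpace) {x : E2} (hx : x ∈ O) (ξ : E2) :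
    fderiv ℝ (fun x => EuclideanGeometry.inversion p 1 (X x)) x ξ =
      inversionDeriv (X x - p) (fderiv ℝ X x ξ) := by
  have h1 : HasLineDerivAt ℝ X (fderiv ℝ X x ξ) x ξ :=
    ((hX.contDiffAt (hO.mem_nhds hx)).differentiableAt (by norm_num)).hasFDerivAt.hasLineDerivAt ξ
  have h2 : HasLineDerivAt ℝ (fun x => EuclideanGeometry.inversion p 1 (X x)) _ x ξ :=
    (((contDiffOn_inversion hp hX hpos).contDiffAt (hO.mem_nhds hx)).differentiableAt
      (by norm_num)).hasFDerivAt.hasLineDerivAt ξ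
  have h3 := hasDerivAt_inversion (p := p) h1
    (by simpa using sub_ne_zero_of_mem_upperHalfSpace hp (hpos x hx))
  simpa using HasDerivAt.unique h2 h3

/-- The second derivative of the composition contains the Hessian of the inversion;
`christoffel_inversion` absorbs it, so covariant derivatives are transported by `inversionDeriv`. -/
lemma pd_pd_inversion (hp : p 2 = 0) (hO : IsOpen O) (hX : ContDiffOn ℝ ∞ X O)
    (hpos : ∀ x ∈ O, X x ∈ upperHalfSpace) {x : E2} (hx : x ∈ O) (i j : Fin 2) :
    pd (pd (fun x => EuclideanGeometry.inversion p 1 (X x)) j) i x +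
      christoffel (EuclideanGeometry.inversion p 1 (X x)) (inversionDeriv (X x - p) (pd X i x))
        (inversionDeriv (X x - p) (pd X j x)) =
    inversionDeriv (X x - p) (pd (pd X j) i x + christoffel (X x) (pd X i x) (pd X j x)) := by
  have hpd : ∀ Y : E2 → E3, ContDiffOn ℝ ∞ Y O → DifferentiableAt ℝ (pd Y j) x := fun Y hY =>
    (((hY.contDiffAt (hO.mem_nhds hx)).fderiv_right (m := ∞) (by norm_num)).differentiableAt
      (by norm_num)).clm_apply (differentiableAt_const _)
  set ξ : E2 := EuclideanSpace.single i 1 with hξ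
  have hr : X x - p ≠ 0 := sub_ne_zero_of_mem_upperHalfSpace hp (hpos x hx)
  have h1 : HasLineDerivAt ℝ X (pd X i x) x ξ :=
    ((hX.contDiffAt (hO.mem_nhds hx)).differentiableAt (by norm_num)).hasFDerivAt.hasLineDerivAt ξ
  have h2 : HasLineDerivAt ℝ (pd X j) (pd (pd X j) i x) x ξ :=
    (hpd X hX).hasFDerivAt.hasLineDerivAt ξ
  have h3 : HasLineDerivAt ℝ (pd (fun x => EuclideanGeometry.inversion p 1 (X x)) j)
      (pd (pd (fun x => EuclideanGeometry.inversion p 1 (X x)) j) i x) x ξ :=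
    (hpd _ (contDiffOn_inversion hp hX hpos)).hasFDerivAt.hasLineDerivAt ξ
  have h4 := hasDerivAt_inversionDeriv (HasDerivAt.sub_const p h1) h2 (by simpa using hr)
  have hev : (fun t : ℝ => pd (fun x => EuclideanGeometry.inversion p 1 (X x)) j (x + t • ξ)) =ᶠ[𝓝 0]
      fun t => inversionDeriv (X (x + t • ξ) - p) (pd X j (x + t • ξ)) := by
    have hc : Tendsto (fun t : ℝ => x + t • ξ) (𝓝 0) (𝓝 x) := by
      have : Continuous fun t : ℝ => x + t • ξ := by fun_prop
      simpa using this.tendsto 0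
    filter_upwards [hc (hO.mem_nhds hx)] with t ht using pd_inversion hp hO hX hpos ht _
  rw [HasDerivAt.unique h3 (h4.congr_of_eventuallyEq hev)]
  simp only [zero_smul, add_zero]
  exact christoffel_inversion hp (hpos x hx) _ _ _

lemma meanCurvature_inversion (hp : p 2 = 0) (hO : IsOpen O) (hX : ContDiffOn ℝ ∞ X O)
    (hpos : ∀ x ∈ O, X x ∈ upperHalfSpace) {x : E2} (hx : x ∈ O) (n : E3) :
    meanCurvature (fun x => EuclideanGeometry.inversion p 1 (X x)) x
      (inversionDeriv (X x - p) n) = meanCurvature X x n := by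
  have h1 : ∀ i, pd (fun x => EuclideanGeometry.inversion p 1 (X x)) i x =
      inversionDeriv (X x - p) (pd X i x) := fun i => pd_inversion hp hO hX hpos hx _
  have hfirst : firstForm (fun x => EuclideanGeometry.inversion p 1 (X x)) x = firstForm X x := by
    ext i j
    simp only [firstForm, Matrix.of_apply, h1]
    exact hypInner_inversion hp (hpos x hx) _ _
  have hsecond : secondForm (fun x => EuclideanGeometry.inversion p 1 (X x)) x
      (inversionDeriv (X x - p) n) = secondForm X x n := by
    ext i j
    simp only [secondForm, Matrix.of_apply, h1, pd_pd_inversion hp hO hX hpos hx]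
    exact hypInner_inversion hp (hpos x hx) _ _
  rw [meanCurvature, meanCurvature, hfirst, hsecond]

end meanCurvature

/-! ### Horo-shrinkers invariant under parabolic translations fixing a finite ideal point -/

/-- The form `L dA` is exact, hence closed: `dL ∧ dA = 0`. -/
lemma fderiv_mul_fderiv_comm {f L A : E2 → ℝ} {x : E2}
    (hf : ∀ᶠ y in 𝓝 x, HasFDerivAt f (L y • fderiv ℝ A y) y) (hA : ContDiffAt ℝ ∞ A x)
    (hL : DifferentiableAt ℝ L x) (a b : E2) :
    fderiv ℝ L x a * fderiv ℝ A x b = fderiv ℝ L x b * fderiv ℝ A x a := by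
  have h2 : HasFDerivAt (fderiv ℝ A) (fderiv ℝ (fderiv ℝ A) x) x :=
    ((hA.fderiv_right (m := ∞) (by norm_num)).differentiableAt (by norm_num)).hasFDerivAt
  have h3 := second_derivative_symmetric_of_eventually hf (hL.hasFDerivAt.smul h2) a b
  have h4 := (hA.isSymmSndFDerivAt (by
    rw [minSmoothness_of_isRCLikeNormedField]
    exact WithTop.coe_le_coe.2 (le_top : (2 : ℕ∞) ≤ ⊤))).eq a b
  simp only [add_apply, smul_apply, ContinuousLinearMap.smulRight_apply, smul_eq_mul] at h3
  rw [h4] at h3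
  linear_combination h3

/-- The slope function of the generating curve depends on the coordinate along the rulings. -/
lemma hasFDerivAt_inverted {a b z c s : E2 → ℝ} {a' b' z' c' s' : E2 →L[ℝ] ℝ} {x W : E2} (k : ℝ)
    (ha : HasFDerivAt a a' x) (hb : HasFDerivAt b b' x) (hz : HasFDerivAt z z' x)
    (hc : HasFDerivAt c c' x) (hs : HasFDerivAt s s' x) (hz0 : z x ≠ 0) (hc0 : c x ≠ 0)
    (haW : a' W = 0) (hbW : b' W = 1) (hzW : z' W = 0) (hcW : c' W = 0) (hsW : s' W = 0) :
    ∃ L' : E2 →L[ℝ] ℝ, HasFDerivAt (fun y => (2 * (((b y ^ 2 + (a y - k) ^ 2 + z y ^ 2) * c y -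
      2 * z y * (c y * z y - s y * (a y - k))) / z y) - 2 * c y) / z y / c y ^ 3) L' x ∧
      L' W = 4 * b x / (z x ^ 2 * c x ^ 2) := by
  have hd : DifferentiableAt ℝ (fun y => (2 * (((b y ^ 2 + (a y - k) ^ 2 + z y ^ 2) * c y -
      2 * z y * (c y * z y - s y * (a y - k))) / z y) - 2 * c y) / z y / c y ^ 3) x := by
    have h1 := ha.differentiableAt
    have h2 := hb.differentiableAt
    have h3 := hz.differentiableAt
    have h4 := hc.differentiableAt
    have h5 := hs.differentiableAt
    have h6 : c x ^ 3 ≠ 0 := pow_ne_zero 3 hc0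
    fun_prop (disch := assumption)
  refine ⟨_, hd.hasFDerivAt, ?_⟩
  -- Along `W` only `b` varies, at unit speed, so only the term `b² c` contributes.
  have h1 : HasDerivAt (fun t : ℝ => a (x + t • W)) 0 0 := by
    simpa [HasLineDerivAt, haW] using ha.hasLineDerivAt W
  have h2 : HasDerivAt (fun t : ℝ => z (x + t • W)) 0 0 := by
    simpa [HasLineDerivAt, hzW] using hz.hasLineDerivAt W
  have h3 : HasDerivAt (fun t : ℝ => c (x + t • W)) 0 0 := by
    simpa [HasLineDerivAt, hcW] using hc.hasLineDerivAt W
  have h4 : HasDerivAt (fun t : ℝ => s (x + t • W)) 0 0 := by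
    simpa [HasLineDerivAt, hsW] using hs.hasLineDerivAt W
  have h5 : HasDerivAt (fun t : ℝ => b (x + t • W)) 1 0 := by
    simpa [HasLineDerivAt, hbW] using hb.hasLineDerivAt W
  have h6 : z (x + (0 : ℝ) • W) ≠ 0 := by simpa using hz0
  have h7 : c (x + (0 : ℝ) • W) ^ 3 ≠ 0 := by simpa using hc0
  have h8 := (((((((((h5.fun_pow 2).fun_add ((h1.sub_const k).fun_pow 2)).fun_add
    (h2.fun_pow 2)).fun_mul h3).fun_sub ((h2.const_mul 2).fun_mul ((h3.fun_mul h2).fun_sub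
      (h4.fun_mul (h1.sub_const k))))).fun_div h2 h6).const_mul 2).fun_sub
        (h3.const_mul 2)).fun_div h2 h6).fun_div (h3.fun_pow 3) h7
  rw [HasDerivAt.unique (hd.hasFDerivAt.hasLineDerivAt W) h8]
  simp only [zero_smul, add_zero]
  field_simp
  ring

namespace IsGeneratingFrame

variable {M : Type u} [TopologicalSpace M] [ChartedSpace E2 M] [IsManifold (𝓡 2) ∞ M]
  {A B Z C S : M → ℝ} {c : ℝ}

/-- Where `C ≠ 0`, the slope satisfies `d(S / C) = L dA` with `L = K / C³`. Closedness makes `L`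
constant in the ruling direction `W`, whereas its derivative along `W` is `4B / (Z² C²)`. So `B = 0`
on an open set, contrary to `dB(W) = 1`. -/
lemma eq_zero_of_inverted (h : IsGeneratingFrame A Z C S fun p =>
      (2 * (((B p ^ 2 + (A p - c) ^ 2 + Z p ^ 2) * C p -
        2 * Z p * (C p * Z p - S p * (A p - c))) / Z p) - 2 * C p) / Z p)
    (hZ : ∀ p, 0 < Z p) (hB : ContMDiff (𝓡 2) 𝓘(ℝ, ℝ) ∞ B)
    (hW : ∀ m, ∀ x ∈ (chartAt E2 m).target, ∃ W, fderiv ℝ (B ∘ (chartAt E2 m).symm) x W = 1 ∧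
      fderiv ℝ (A ∘ (chartAt E2 m).symm) x W = 0) (p : M) : C p = 0 := by
  set e := chartAt E2 p with he
  have hAs := contDiffOn_comp_chart_symm h.smooth p
  have hBs := contDiffOn_comp_chart_symm hB p
  have hdC : ∀ x ∈ e.target, DifferentiableAt ℝ (C ∘ e.symm) x := fun x hx => by
    obtain ⟨σ, -, -, -, hC, -⟩ := h.exists_deriv p x hx
    exact hC.differentiableAt
  have hne : ∀ x ∈ e.target, C (e.symm x) ≠ 0 →
      ∀ᶠ y in 𝓝 x, y ∈ e.target ∧ C (e.symm y) ≠ 0 := fun x hx hC =>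
    (e.open_target.eventually_mem hx).and ((hdC x hx).continuousAt.eventually_ne hC)
  have key : ∀ x ∈ e.target, C (e.symm x) ≠ 0 → B (e.symm x) = 0 := by
    intro x hx hC0
    obtain ⟨σ, hσ, hA, hZd, hC, hS⟩ := h.exists_deriv p x hx
    have hBd : HasFDerivAt (B ∘ e.symm) (fderiv ℝ (B ∘ e.symm) x) x :=
      ((hBs.contDiffAt (e.open_target.mem_nhds hx)).differentiableAt (by norm_num)).hasFDerivAt
    obtain ⟨W, hWB, hWA⟩ := hW p x hx
    have hσW : σ W = 0 := by
      rw [hA.fderiv, smul_apply, smul_eq_mul] at hWA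
      exact (mul_eq_zero.1 hWA).resolve_left hC0
    obtain ⟨η, hη⟩ : ∃ η, σ η ≠ 0 := by
      by_contra! h0
      exact hσ (ContinuousLinearMap.ext h0)
    have hz := hZ (e.symm x)
    set L : E2 → ℝ := fun y => (2 * ((((B ∘ e.symm) y ^ 2 + ((A ∘ e.symm) y - c) ^ 2 +
      (Z ∘ e.symm) y ^ 2) * (C ∘ e.symm) y - 2 * (Z ∘ e.symm) y * ((C ∘ e.symm) y *
        (Z ∘ e.symm) y - (S ∘ e.symm) y * ((A ∘ e.symm) y - c))) / (Z ∘ e.symm) y) -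
      2 * (C ∘ e.symm) y) / (Z ∘ e.symm) y / (C ∘ e.symm) y ^ 3 with hL
    obtain ⟨L', hL', hLW⟩ := hasFDerivAt_inverted (W := W) c hA hBd hZd hC hS hz.ne' hC0
      (by simp [hσW]) hWB (by simp [hσW]) (by simp [hσW]) (by simp [hσW])
    change HasFDerivAt L L' x at hL'
    have hcomm := fderiv_mul_fderiv_comm (f := fun y => (S ∘ e.symm) y / (C ∘ e.symm) y)
      (A := A ∘ e.symm) (L := L) (x := x) ?_ (hAs.contDiffAt (e.open_target.mem_nhds hx)) 
      hL'.differentiableAt W η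
    · rw [hWA, mul_zero, hL'.fderiv, hLW, hA.fderiv, smul_apply, smul_eq_mul] at hcomm
      have h2 :=
        (mul_eq_zero.1 hcomm).resolve_right (mul_ne_zero hC0 hη)
      rw [div_eq_zero_iff] at h2
      have h3 := h2.resolve_right (mul_ne_zero (pow_ne_zero 2 hz.ne') (pow_ne_zero 2 hC0))
      exact (mul_eq_zero.1 h3).resolve_left four_ne_zero
    · filter_upwards [hne x hx hC0] with y hy
      obtain ⟨τ, -, hA', -, hC', hS'⟩ := h.exists_deriv p y hy.1
      have h1 := (hS'.mul ((hasDerivAt_inv hy.2).comp_hasFDerivAt y hC'))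
      rw [hA'.fderiv]
      refine (h1.congr_fderiv (g' := L y • C (e.symm y) • τ) ?_).congr_of_eventuallyEq
        (Eventually.of_forall fun z => div_eq_mul_inv _ _)
      ext1 ξ
      have hC1 := hy.2
      have hz1 := hZ (e.symm y)
      simp only [hL, Function.comp_apply, add_apply, smul_apply, smul_eq_mul, ← he]
      have h3 := h.sq_add_sq (e.symm y)
      generalize C (e.symm y) = C at *
      generalize S (e.symm y) = S at *
      generalize (2 * (((B (e.symm y) ^ 2 + (A (e.symm y) - c) ^ 2 + Z (e.symm y) ^ 2) * C -
        2 * Z (e.symm y) * (C * Z (e.symm y) - S * (A (e.symm y) - c))) / Z (e.symm y)) - 2 * C) /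
          Z (e.symm y) = K
      field_simp
      linear_combination K * τ ξ * h3
  by_contra hCp
  have hm := mem_chart_target E2 p
  have hCx : C (e.symm (e p)) ≠ 0 := by rwa [e.left_inv (mem_chart_source E2 p)]
  obtain ⟨W, hWB, -⟩ := hW p (e p) hm
  have hB0 : B ∘ e.symm =ᶠ[𝓝 (e p)] fun _ => 0 := by
    filter_upwards [hne _ hm hCx] with y hy using key y hy.1 hy.2
  rw [hB0.fderiv_eq] at hWB
  simp at hWB

/-- Since `C` vanishes identically, so does `dC = -K S σ`. With `S² = 1` and `σ ≠ 0` this means `K =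
0`, and for `C = 0` the formula reduces to `K = 4 S (A - c) / Z`. -/
lemma eq_const_of_inverted (h : IsGeneratingFrame A Z C S fun p =>
      (2 * (((B p ^ 2 + (A p - c) ^ 2 + Z p ^ 2) * C p -
        2 * Z p * (C p * Z p - S p * (A p - c))) / Z p) - 2 * C p) / Z p)
    (hZ : ∀ p, 0 < Z p) (hB : ContMDiff (𝓡 2) 𝓘(ℝ, ℝ) ∞ B)
    (hW : ∀ m, ∀ x ∈ (chartAt E2 m).target, ∃ W, fderiv ℝ (B ∘ (chartAt E2 m).symm) x W = 1 ∧
      fderiv ℝ (A ∘ (chartAt E2 m).symm) x W = 0) (p : M) : A p = c := by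
  have hC := h.eq_zero_of_inverted hZ hB hW
  obtain ⟨σ, hσ, -, -, hCd, -⟩ := h.exists_deriv p _ (mem_chart_target E2 p)
  obtain ⟨η, hη⟩ : ∃ η, σ η ≠ 0 := by
    by_contra! h0
    exact hσ (ContinuousLinearMap.ext h0)
  have h0 : C ∘ (chartAt E2 p).symm = fun _ => 0 := funext fun x => hC _
  rw [h0] at hCd
  have h1 := DFunLike.congr_fun (hCd.unique (hasFDerivAt_const (0 : ℝ) _)) η
  simp only [(chartAt E2 p).left_inv (mem_chart_source E2 p), hC, smul_apply, smul_eq_mul,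
    zero_apply] at h1
  have h2 := (mul_eq_zero.1 h1).resolve_right hη
  have h3 := h.sq_add_sq p
  rw [hC] at h3
  have hz := (hZ p).ne'
  field_simp at h2
  have h4 : Z p * (A p - c) = 0 := by linear_combination (-h2 / 4) - Z p * (A p - c) * h3
  exact sub_eq_zero.1 ((mul_eq_zero.1 h4).resolve_left hz)

end IsGeneratingFrame

lemma eq_zero_of_inversionDeriv_eq_zero {r a : E3} (hr : r ≠ 0) (h : inversionDeriv r a = 0) :
    a = 0 := by
  have h1 := inner_inversionDeriv hr a a
  rw [h, inner_zero_left] at h1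
  exact inner_self_eq_zero.1 ((mul_eq_zero.1 h1.symm).resolve_left
    (pow_ne_zero 2 (inv_ne_zero (inner_self_ne_zero.2 hr))))

section

variable {M : Type u} [TopologicalSpace M] [ChartedSpace E2 M] {Ψ : M → E3}
  {p : E3}

lemma mfderiv_inversion (hp : p 2 = 0) (hpos : ∀ m, Ψ m ∈ upperHalfSpace)
    (hs : ContMDiff (𝓡 2) 𝓘(ℝ, E3) ∞ Ψ) (m : M) (ξ : TangentSpace (𝓡 2) m) :
    mfderiv (𝓡 2) 𝓘(ℝ, E3) (fun m => EuclideanGeometry.inversion p 1 (Ψ m)) m ξ =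
      inversionDeriv (Ψ m - p) (mfderiv (𝓡 2) 𝓘(ℝ, E3) Ψ m ξ) := by
  have hd : DifferentiableAt ℝ (EuclideanGeometry.inversion p 1) (Ψ m) :=
    (contDiffAt_inversion hp (hpos m)).differentiableAt (by norm_num)
  have h1 : mfderiv (𝓡 2) 𝓘(ℝ, E3) (EuclideanGeometry.inversion p 1 ∘ Ψ) m =
      (mfderiv 𝓘(ℝ, E3) 𝓘(ℝ, E3) (EuclideanGeometry.inversion p 1) (Ψ m)).comp
        (mfderiv (𝓡 2) 𝓘(ℝ, E3) Ψ m) :=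
    mfderiv_comp m hd.mdifferentiableAt (hs.mdifferentiableAt (by norm_num))
  have h2 : ∀ a : E3, fderiv ℝ (EuclideanGeometry.inversion p 1) (Ψ m) a =
      inversionDeriv (Ψ m - p) a := by
    intro a
    have h3 : HasDerivAt (fun t : ℝ => Ψ m + t • a) a 0 := by
      simpa using ((hasDerivAt_id (0 : ℝ)).smul_const a).const_add (Ψ m)
    have h4 := hasDerivAt_inversion (p := p) h3
      (by simpa using sub_ne_zero_of_mem_upperHalfSpace hp (hpos m))
    simpa using HasDerivAt.unique (hd.hasFDerivAt.hasLineDerivAt a) h4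
  change mfderiv (𝓡 2) 𝓘(ℝ, E3) (EuclideanGeometry.inversion p 1 ∘ Ψ) m ξ = _
  rw [h1, mfderiv_eq_fderiv]
  exact h2 _

lemma contMDiff_comp_prodMk {G : E3 × E3 → E3} (hpos : ∀ m, Ψ m ∈ upperHalfSpace)
    (hs : ContMDiff (𝓡 2) 𝓘(ℝ, E3) ∞ Ψ) {N : M → E3} (hN : ContMDiff (𝓡 2) 𝓘(ℝ, E3) ∞ N)
    (hG : ∀ y : E3 × E3, y.1 ∈ upperHalfSpace → ContDiffAt ℝ ∞ G y) :
    ContMDiff (𝓡 2) 𝓘(ℝ, E3) ∞ fun m => G (Ψ m, N m) := fun m =>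
  (hG (Ψ m, N m) (hpos m)).contMDiffAt.comp m ((hs m).prodMk_space (hN m))

lemma contDiffAt_inversionDeriv (hp : p 2 = 0) (y : E3 × E3) (hy : y.1 ∈ upperHalfSpace) :
    ContDiffAt ℝ ∞ (fun y : E3 × E3 => inversionDeriv (y.1 - p) y.2) y := by
  have h : (inner ℝ (y.1 - p) (y.1 - p) : ℝ) ≠ 0 :=
    inner_self_ne_zero.2 (sub_ne_zero_of_mem_upperHalfSpace hp hy)
  have h1 : ContDiffAt ℝ ∞ (fun y : E3 × E3 => y.1 - p) y := contDiffAt_fst.sub contDiffAt_const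
  have h2 : ContDiffAt ℝ ∞ (fun y : E3 × E3 => y.2) y := contDiffAt_snd
  have h3 := (h1.inner ℝ h1).inv h
  exact (h3.smul h2).sub (((contDiffAt_const.mul (h1.inner ℝ h2)).mul (h3.pow 2)).smul h1)

/-- Written at the image point `y`, the transported field is `|y - p|² ∂_z - 2 y₂ (y - p)`. The
factor `|y - p|²` is the source of the dependence on the ruling coordinate. -/
lemma inversionDeriv_dz (hp : p 2 = 0) {q : E3} (hq : q ∈ upperHalfSpace) :
    inversionDeriv (q - p) dz =
      (inner ℝ (EuclideanGeometry.inversion p 1 q - p) (EuclideanGeometry.inversion p 1 q - p) : ℝ) •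
        dz - (2 * EuclideanGeometry.inversion p 1 q 2) • (EuclideanGeometry.inversion p 1 q - p) := by
  have h : (inner ℝ (q - p) (q - p) : ℝ) ≠ 0 :=
    inner_self_ne_zero.2 (sub_ne_zero_of_mem_upperHalfSpace hp hq)
  have hr2 : (q - p) 2 = q 2 := by simp [hp]
  rw [inversionDeriv, inversion_two' hp, inversion_eq', add_sub_cancel_right, inner_smul_left,
    inner_smul_right, inner_dz_right, hr2, smul_smul, conj_trivial]
  congr 2
  · field_simp
  · ring

/-- The equation of horo-shrinkers after an inversion. -/
lemma hypInner_dz_inversion (hp : p 2 = 0) {q n : E3} (hq : q ∈ upperHalfSpace) {v w : E3}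
    (hF : IsHorizontalFrame v w) (hn : (inner ℝ v (inversionDeriv (q - p) n) : ℝ) = 0) :
    hypInner q n dz = (((inner ℝ v (EuclideanGeometry.inversion p 1 q) - inner ℝ v p) ^ 2 +
      (inner ℝ w (EuclideanGeometry.inversion p 1 q) - inner ℝ w p) ^ 2 +
      EuclideanGeometry.inversion p 1 q 2 ^ 2) *
        (inversionDeriv (q - p) n 2 / EuclideanGeometry.inversion p 1 q 2) -
      2 * EuclideanGeometry.inversion p 1 q 2 *
        (inversionDeriv (q - p) n 2 / EuclideanGeometry.inversion p 1 q 2 *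
          EuclideanGeometry.inversion p 1 q 2 -
        -inner ℝ w (inversionDeriv (q - p) n) / EuclideanGeometry.inversion p 1 q 2 *
          (inner ℝ w (EuclideanGeometry.inversion p 1 q) - inner ℝ w p))) /
        EuclideanGeometry.inversion p 1 q 2 := by
  have hy : EuclideanGeometry.inversion p 1 q 2 ≠ 0 := ne_of_gt (inversion_mem_upperHalfSpace hp hq)
  rw [← hypInner_inversion hp hq, inversionDeriv_dz hp hq, hypInner, inner_sub_right,
    inner_smul_right, inner_smul_right, inner_dz_right, hF.inner_eq (inversionDeriv (q - p) n), hn,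
    hF.inner_eq (_ - p)]
  simp only [inner_sub_right, PiLp.sub_apply, hp, sub_zero]
  field_simp
  ring

/-- Horo-shrinkers invariant under parabolic translations fixing a point of the plane `z = 0`. -/
lemma exists_verticalPlane_of_invariant [IsManifold (𝓡 2) ∞ M] [T2Space M] [SecondCountableTopology M] [ConnectedSpace M]
    (hΨ : IsHoroShrinker Ψ) {v : E3} (hp : p 2 = 0) (hv2 : v 2 = 0) (hv : v ≠ 0)
    (hinv : IsInvariantUnder Ψ (parabolicAt p v)) :
    ∃ w, IsHorizontalNormal v w ∧ range Ψ ⊆ verticalPlane w (inner ℝ w p) ∧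
      (IsCompleteImmersion Ψ → range Ψ = verticalPlane w (inner ℝ w p)) := by
  obtain ⟨w, hw⟩ := exists_isHorizontalNormal hv2 hv
  have hF := hw.frame hv2 hv
  set v' := ‖v‖⁻¹ • v with hv'
  obtain ⟨hpos, hs, hinj, N, hN, hunit, hnormal, hH⟩ := id hΨ
  set Y : M → E3 := fun m => EuclideanGeometry.inversion p 1 (Ψ m) with hY
  set NY : M → E3 := fun m => inversionDeriv (Ψ m - p) (N m) with hNY
  have hinvol : ∀ q, EuclideanGeometry.inversion p 1 (EuclideanGeometry.inversion p 1 q) = q :=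
    EuclideanGeometry.inversion_inversion p one_ne_zero
  have hYpos : ∀ m, 0 < Y m 2 := fun m => inversion_mem_upperHalfSpace hp (hpos m)
  have hYs : ContMDiff (𝓡 2) 𝓘(ℝ, E3) ∞ Y :=
    contMDiff_comp_of_mem_upperHalfSpace hpos hs fun q hq => contDiffAt_inversion hp hq
  have hYd := mfderiv_inversion hp hpos hs
  have hYinj : ∀ m, Function.Injective (mfderiv (𝓡 2) 𝓘(ℝ, E3) Y m) := by
    intro m
    rw [injective_iff_map_eq_zero]
    intro ξ hξ
    rw [hYd] at hξ
    exact hinj m ((eq_zero_of_inversionDeriv_eq_zero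
      (sub_ne_zero_of_mem_upperHalfSpace hp (hpos m)) hξ).trans (map_zero _).symm)
  have hNYs : ContMDiff (𝓡 2) 𝓘(ℝ, E3) ∞ NY := 
    contMDiff_comp_prodMk hpos hs hN (contDiffAt_inversionDeriv hp)
  have hYunit : ∀ m, hypInner (Y m) (NY m) (NY m) = 1 := fun m =>
    (hypInner_inversion hp (hpos m) _ _).trans (hunit m)
  have hYnormal : ∀ m (ξ : TangentSpace (𝓡 2) m),
      hypInner (Y m) (mfderiv (𝓡 2) 𝓘(ℝ, E3) Y m ξ) (NY m) = 0 := fun m ξ => by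
    rw [hYd]
    exact (hypInner_inversion hp (hpos m) _ _).trans (hnormal m ξ)
  have hYinv : ∀ t : ℝ, ∀ q ∈ range Y, q + t • v' ∈ range Y := by
    rintro t _ ⟨m, rfl⟩
    obtain ⟨m', hm'⟩ : parabolicAt p v (t * ‖v‖⁻¹) (Ψ m) ∈ range Ψ := by
      rw [← hinv (t * ‖v‖⁻¹)]
      exact ⟨_, ⟨m, rfl⟩, rfl⟩
    refine ⟨m', ?_⟩
    rw [hY, hv', smul_smul]
    beta_reduce
    rw [hm', parabolicAt, hinvol, parabolicInfty]
  have htan := fun m x hx => exists_fderiv_eq_of_invariant hYs hYinj hYinv m (x := x) hx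
  -- The inverted surface has the same mean curvature as `Ψ`; `H` is the horo-shrinker condition
  -- expressed through the image point and the transported normal.
  have hframe := isGeneratingFrame_of_invariant hYpos hYs hYinj hNYs hYunit hYnormal
    (H := fun m => (((inner ℝ v' (Y m) - inner ℝ v' p) ^ 2 + (inner ℝ w (Y m) - inner ℝ w p) ^ 2 +
      Y m 2 ^ 2) * (NY m 2 / Y m 2) - 2 * Y m 2 * (NY m 2 / Y m 2 * Y m 2 -
        -inner ℝ w (NY m) / Y m 2 * (inner ℝ w (Y m) - inner ℝ w p))) / Y m 2)
    (fun m x hx => by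
      have hn : (inner ℝ v' (NY ((chartAt E2 m).symm x)) : ℝ) = 0 := by
        obtain ⟨ξ, hξ⟩ := htan m x hx
        have h1 := hYnormal ((chartAt E2 m).symm x) (mfderiv (𝓡 2) (𝓡 2) (chartAt E2 m).symm x ξ)
        rw [← fderiv_comp_chart_symm hYs m hx, hξ] at h1
        exact (div_eq_zero_iff.1 h1).resolve_right (pow_ne_zero 2 (hYpos _).ne')
      rw [← hypInner_dz_inversion hp (hpos _) hF hn]
      have h1 := hH _ (chart_mem_atlas E2 m) _ ((chartAt E2 m).map_target hx)
      rw [(chartAt E2 m).right_inv hx] at h1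
      rw [← h1]
      exact meanCurvature_inversion hp (chartAt E2 m).open_target (contDiffOn_comp_chart_symm hs m)
        (fun x _ => hpos _) hx _) hF hYinv
  have hconst : ∀ m, (inner ℝ w (Y m) : ℝ) = inner ℝ w p := by
    refine hframe.eq_const_of_inverted (B := fun m => inner ℝ v' (Y m) - inner ℝ v' p) hYpos
      (((innerSL ℝ v').contDiff.sub contDiff_const).contMDiff.comp hYs) fun m x hx => ?_
    obtain ⟨W, hW⟩ := htan m x hx
    have hd : HasFDerivAt (Y ∘ (chartAt E2 m).symm) (fderiv ℝ (Y ∘ (chartAt E2 m).symm) x) x :=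
      (((contDiffOn_comp_chart_symm hYs m).contDiffAt
        ((chartAt E2 m).open_target.mem_nhds hx)).differentiableAt (by norm_num)).hasFDerivAt
    have h1 : HasFDerivAt ((fun m => (inner ℝ v' (Y m) - inner ℝ v' p : ℝ)) ∘ (chartAt E2 m).symm)
        ((innerSL ℝ v').comp (fderiv ℝ (Y ∘ (chartAt E2 m).symm) x)) x :=
      ((innerSL ℝ v').hasFDerivAt.comp x hd).sub_const _
    have h2 : HasFDerivAt ((fun m => (inner ℝ w (Y m) : ℝ)) ∘ (chartAt E2 m).symm)
        ((innerSL ℝ w).comp (fderiv ℝ (Y ∘ (chartAt E2 m).symm) x)) x :=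
      (innerSL ℝ w).hasFDerivAt.comp x hd
    refine ⟨W, ?_, ?_⟩
    · rw [h1.fderiv, ContinuousLinearMap.comp_apply, hW]
      exact hF.inner_v
    · rw [h2.fderiv, ContinuousLinearMap.comp_apply, hW]
      exact hF.orth'
  have hmem : ∀ m, Ψ m ∈ verticalPlane w (inner ℝ w p) := fun m => by
    rw [← hinvol (Ψ m)]
    exact inversion_mem_verticalPlane hp ⟨hYpos m, hconst m⟩
  refine ⟨w, hw, ?_, fun hc => range_eq_verticalPlane hΨ hc hF fun m => (hmem m).2⟩
  rintro _ ⟨m, rfl⟩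
  exact hmem m

end

end

end HoroShrinker

theorem theoremt2 :
    -- horo-shrinkers invariant under parabolic translations fixing `∞`
    (∀ (M : Type u) [TopologicalSpace M] [T2Space M] [SecondCountableTopology M]
      [ConnectedSpace M] [ChartedSpace E2 M] [IsManifold (𝓡 2) ∞ M] (Ψ : M → E3),
      IsHoroShrinker Ψ →
      ∀ v : E3, v 2 = 0 → v ≠ 0 → IsInvariantUnder Ψ (parabolicInfty v) →
        ∃ S, IsGrimReaperModel v S ∧ range Ψ ⊆ S ∧ (IsCompleteImmersion Ψ → range Ψ = S)) ∧
    -- horo-shrinkers invariant under parabolic translations fixing a point of the plane `z = 0`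
    (∀ (M : Type u) [TopologicalSpace M] [T2Space M] [SecondCountableTopology M]
      [ConnectedSpace M] [ChartedSpace E2 M] [IsManifold (𝓡 2) ∞ M] (Ψ : M → E3),
      IsHoroShrinker Ψ →
      ∀ p v : E3, p 2 = 0 → v 2 = 0 → v ≠ 0 → IsInvariantUnder Ψ (parabolicAt p v) →
        ∃ w, IsHorizontalNormal v w ∧ range Ψ ⊆ verticalPlane w (inner ℝ w p) ∧
          (IsCompleteImmersion Ψ → range Ψ = verticalPlane w (inner ℝ w p))) ∧
    -- conversely, all these surfaces occur, as complete embedded surfaces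
    (∀ v : E3, v 2 = 0 → v ≠ 0 → ∀ S, IsGrimReaperModel v S →
      ∃ Ψ : E2 → E3, IsHoroShrinker Ψ ∧ IsCompleteImmersion Ψ ∧ IsEmbedding Ψ ∧
        range Ψ = S ∧ IsInvariantUnder Ψ (parabolicInfty v)) ∧
    (∀ p v w : E3, p 2 = 0 → v 2 = 0 → v ≠ 0 → IsHorizontalNormal v w →
      ∃ Ψ : E2 → E3, IsHoroShrinker Ψ ∧ IsCompleteImmersion Ψ ∧ IsEmbedding Ψ ∧
        range Ψ = verticalPlane w (inner ℝ w p) ∧ IsInvariantUnder Ψ (parabolicAt p v)) ∧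
    -- description of the family `𝒢(z₀)`, the graph of `z = U z₀ x`, of maximal height `zmax z₀`
    (∃ (U : ℝ → ℝ → ℝ) (zmax : ℝ → ℝ),
      (∀ z₀ ∈ Ioo (0 : ℝ) 1,
        ContDiff ℝ ∞ (U z₀) ∧
        generatingCurve z₀ = {q | q.2 = U z₀ q.1} ∧
        (∃ T : ℝ, 0 < T ∧ Function.Periodic (U z₀) T) ∧
        IsLeast (range (U z₀)) z₀ ∧
        IsGreatest (range (U z₀)) (zmax z₀)) ∧
      BijOn zmax (Ioo 0 1) (Ioi 1) ∧
      Tendsto zmax (𝓝[>] 0) atTop ∧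
      Tendsto zmax (𝓝[<] 1) (𝓝 1) ∧
      ConvergesToDoubleVertical U ∧
      (∀ k : ℕ, TendstoUniformly (fun z₀ => iteratedDeriv k (U z₀))
        (iteratedDeriv k (fun _ : ℝ => (1 : ℝ))) (𝓝[<] (1 : ℝ)))) := by
  refine ⟨?_, ?_, ?_, ?_, ?_⟩
  · intro M _ _ _ _ _ _ Ψ hΨ v hv2 hv hinv
    exact exists_model_of_invariant hΨ hv2 hv hinv
  · intro M _ _ _ _ _ _ Ψ hΨ p v hp hv2 hv hinv
    exact exists_verticalPlane_of_invariant hΨ hp hv2 hv hinv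
  · intro v hv2 hv S hS
    exact exists_horoShrinker_of_model hv2 hv hS
  · intro p v w hp hv2 hv hw
    exact exists_horoShrinker_verticalPlane_parabolicAt hp hv2 hv hw
  · refine ⟨profile, topHeight, fun z₀ hz₀ => ?_, bijOn_topHeight, tendsto_topHeight_zero,
      tendsto_topHeight_one, convergesToDoubleVertical_profile, tendstoUniformly_profile_one⟩
    have h := isProfile_profile hz₀
    exact ⟨h.contDiff, h.generatingCurve_eq hz₀, h.exists_periodic hz₀, h.isLeast hz₀,
      h.isGreatest hz₀⟩
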